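/- Let $N>1$ be an integer, $T>0$, $p>1$. Let $e_1,\dots,e_N$ be the canonical basis of $\mathbb{R}^N$, $J_i=\mathbb{R}_+e_i$ and $\mathcal{G}=\bigcup_{i=1}^N J_i\subset\mathbb{R}^N$, where $\mathbb{R}_+=[0,\infty)$. For $x\in\mathcal{G}$ and $t\in[0,T]$ let $\Gamma_t[x]$ be the set of $y\in C([t,T];\mathcal{G})\cap W^{1,p}(t,T;\mathbb{R}^N)$ with $y(t)=x$. For $i=1,\dots,N$ let $\ell_i\in C(\mathbb{R}_+\times\mathbb{R}\times[0,T])$ be such that, for every $s\in[0,T]$, $\ell_i(\cdot,\cdot,s)$ is differentiable in $\mathbb{R}_+\times\mathbb{R}$, and such that $\partial_y\ell_i,\partial_a\ell_i$ are continuous in $(y,a,s)$; let $\ell_*\in C([0,T])$, let $g_i\in C_b(\mathbb{R}_+)$ (bounded and continuous), and let $g_*\in\mathbb{R}$. Set $\ell_0(\tau)=\min\{\ell_*(\tau),\min_i\ell_i(0,0,\tau)\}$ and, for $t\in[0,T]$, $x\in\mathcal{G}$, $$u(x,t)=\inf_{y\in\Gamma_t[x]}\Big\{\int_t^T\Big(\sum_{i=1}^N\ell_i\big(|y(\tau)|,y'(\tau)\cdot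 e_i,\tau\big)\mathbf 1_{y(\tau)\in J_i\setminus\{0\}}+\ell_0(\tau)\mathbf 1_{y(\tau)=0}\Big)d\tau+g(y(T))\Big\},$$ where $g(y)=\sum_{i=1}^N g_i(|y|)\mathbf 1_{y\in J_i\setminus\{0\}}+\min\{g_*,\min_i g_i(0)\}\mathbf 1_{y=0}$. Assume: - [H1] there are $C_0>0$ and $c_0\in\mathbb{R}$ such that $\ell_i(y,a,s)\ge C_0|a|^p+c_0$ and $\ell_*(s)\ge c_0$ for all $i$ and all $(y,a,s)\in\mathbb{R}_+\times\mathbb{R}\times[0,T]$; - [H2] for every $r>0$ there is a modulus of continuity $\omega_r$ such that $|\ell_i(y,a,t_1)-\ell_i(y,a,t_2)|\le(1+|a|^p)\,\omega_r(|t_1-t_2|)$ for all $i$, $y\in[0,r]$, $a\in\mathbb{R}$, $t_1,t_2\in[0,T]$; - [H3] for every $r>0$ there is $\tilde c(r)\ge0$ such that $|\partial_y\ell_i(y,a,s)|\le\tilde c(r)(|a|^p+1)$ and $|\partial_a\ell_i(y,a,s)|\le\tilde c(r)(|a|^{p-1}+1)$ for all $i$ and all $(y,a,s)\in[0,r]\times\mathbb{R}\times[0,T]$;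 - [H4] $a\mapsto\ell_i(y,a,s)$ is strictly convex for all $i$ and all $(y,s)\in\mathbb{R}_+\times[0,T]$; - [H5] $g_i\in C^1(\mathbb{R}_+)$ for all $i$; - for every $r>0$ there is $K\ge0$ such that $|\ell_i(y,a,t_1)-\ell_i(y,a,t_2)|\le K|t_1-t_2|$ for all $i$, $y\in[0,r]$, $a\in[-r,r]$, $t_1,t_2\in[0,T]$. Then, for every $i\in\{1,\dots,N\}$, $u$ is locally semiconcave in $(J_i\setminus\{0\})\times(0,T)$ in the sense of Cannarsa and Sinestrari: for every compact $K\subset(J_i\setminus\{0\})\times(0,T)$ there is a nondecreasing upper semicontinuous $\omega:\mathbb{R}_+\to\mathbb{R}_+$ with $\lim_{\rho\to0^+}\omega(\rho)=0$ such that $$\lambda u(z_1)+(1-\lambda)u(z_2)-u(\lambda z_1+(1-\lambda)z_2)\le\lambda(1-\lambda)\,|z_1-z_2|\,\omega(|z_1-z_2|)$$ for all $z_1,z_2$ such that the segment $[z_1,z_2]$ is contained in $K$ and all $\lambda\in[0,1]$, where $|\cdot|$ is the Euclidean norm of $\mathbb{R}^N\times\mathbb{R}$. -/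

import Mathlib

open Set Filter Topology MeasureTheory
open scoped ContDiff

namespace Junction

noncomputable section

/-! ### The junction -/

/-- The closed half-line `J_i = ℝ₊ e_i`, where `e_i` is the `i`-th vector of the canonical basis
of `ℝ^N`. -/
def edge {N : ℕ} (i : Fin N) : Set (EuclideanSpace ℝ (Fin N)) :=
  {x | ∃ r : ℝ, 0 ≤ r ∧ x = r • EuclideanSpace.single i (1 : ℝ)}

/-- The edge without the vertex, `J_i ∖ {0}`. -/
def openEdge {N : ℕ} (i : Fin N) : Set (EuclideanSpace ℝ (Fin N)) :=
  edge i \ {0}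

/-- The junction `𝒢`, the union of the edges `J_i`. -/
def junction (N : ℕ) : Set (EuclideanSpace ℝ (Fin N)) :=
  ⋃ i : Fin N, edge i

/-! ### Admissible trajectories -/

/-- `v` is a weak derivative of `y` on the open interval `(a, b)`:
`∫ φ' y = - ∫ φ v` for all smooth `φ` with compact support contained in `(a, b)`. -/
def IsWeakDerivOn {E : Type*} [NormedAddCommGroup E] [NormedSpace ℝ E]
    (a b : ℝ) (y v : ℝ → E) : Prop :=
  ∀ φ : ℝ → ℝ, ContDiff ℝ ∞ φ → HasCompactSupport φ → tsupport φ ⊆ Ioo a b →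
    ∫ s in Ioo a b, deriv φ s • y s = -∫ s in Ioo a b, φ s • v s

/-- `y ∈ C([t,T]; 𝒢) ∩ W^{1,p}(t,T; ℝ^N)` with `y(t) = x`, i.e. `y` is an admissible trajectory
that starts from `x` at time `t`, and `v` is (a representative of) its weak derivative.
Only the values of `y` on `[t,T]` matter. -/
structure IsAdmissible {N : ℕ} (p T : ℝ) (x : EuclideanSpace ℝ (Fin N)) (t : ℝ)
    (y v : ℝ → EuclideanSpace ℝ (Fin N)) : Prop where
  continuousOn : ContinuousOn y (Icc t T)
  mapsTo : MapsTo y (Icc t T) (junction N)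
  memLp : MemLp y (ENNReal.ofReal p) (volume.restrict (Ioo t T))
  memLp_deriv : MemLp v (ENNReal.ofReal p) (volume.restrict (Ioo t T))
  isWeakDeriv : IsWeakDerivOn t T y v
  initial : y t = x

/-! ### Costs and value function -/

/-- The terminal cost
`g(y) = ∑ i, g_i(|y|) 1_{y ∈ J_i ∖ {0}} + min (g_*) (min_i g_i(0)) 1_{y = 0}`. -/
def terminalCost {N : ℕ} (g : Fin N → ℝ → ℝ) (gstar : ℝ) (y : EuclideanSpace ℝ (Fin N)) : ℝ :=
  ∑ i, (openEdge i).indicator (fun z => g i ‖z‖) y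
    + ({0} : Set (EuclideanSpace ℝ (Fin N))).indicator (fun _ => min gstar (⨅ i, g i 0)) y

/-- The cost for staying at the vertex, `ℓ_0(τ) = min (ℓ_*(τ)) (min_i ℓ_i(0,0,τ))`. -/
def vertexCost {N : ℕ} (ℓ : Fin N → ℝ → ℝ → ℝ → ℝ) (ℓstar : ℝ → ℝ) (τ : ℝ) : ℝ :=
  min (ℓstar τ) (⨅ i, ℓ i 0 0 τ)

/-- The running cost
`L(y, α, τ) = ∑ i, ℓ_i(|y|, ᾱ, τ) 1_{y ∈ J_i ∖ {0}} + ℓ_0(τ) 1_{y = 0}`.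
Along an admissible trajectory `α = ᾱ e_i` a.e. on `{y ∈ J_i ∖ {0}}`, so that there `ᾱ` is the
`i`-th coordinate of `α`. -/
def runningCost {N : ℕ} (ℓ : Fin N → ℝ → ℝ → ℝ → ℝ) (ℓstar : ℝ → ℝ)
    (y α : EuclideanSpace ℝ (Fin N)) (τ : ℝ) : ℝ :=
  ∑ i, (openEdge i).indicator (fun z => ℓ i ‖z‖ (α i) τ) y
    + ({0} : Set (EuclideanSpace ℝ (Fin N))).indicator (fun _ => vertexCost ℓ ℓstar τ) y

/-- The cost `J_t(x; y) = ∫_t^T L(y(τ), y'(τ), τ) dτ + g(y(T))` of a trajectory `y` with weak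
derivative `v`. -/
def cost {N : ℕ} (T : ℝ) (ℓ : Fin N → ℝ → ℝ → ℝ → ℝ) (ℓstar : ℝ → ℝ)
    (g : Fin N → ℝ → ℝ) (gstar : ℝ) (t : ℝ) (y v : ℝ → EuclideanSpace ℝ (Fin N)) : ℝ :=
  (∫ τ in t..T, runningCost ℓ ℓstar (y τ) (v τ) τ) + terminalCost g gstar (y T)

/-- The value function `u(x,t)`, the infimum of `J_t(x; y)` over the admissible trajectories `y`
that start from `x` at time `t`. -/
def valueFunction {N : ℕ} (p T : ℝ) (ℓ : Fin N → ℝ → ℝ → ℝ → ℝ) (ℓstar : ℝ → ℝ)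
    (g : Fin N → ℝ → ℝ) (gstar : ℝ) (x : EuclideanSpace ℝ (Fin N)) (t : ℝ) : ℝ :=
  sInf {c | ∃ y v : ℝ → EuclideanSpace ℝ (Fin N),
    IsAdmissible p T x t y v ∧ c = cost T ℓ ℓstar g gstar t y v}

/-! ### Assumptions on the costs

The running costs `ℓ_i` are functions on `ℝ₊ × ℝ × [0,T]`, and the terminal costs `g_i` are
functions on `ℝ₊`. They are represented by functions on `ℝ × ℝ × ℝ` and `ℝ`, whose values
outside these domains play no role. -/

/-- The partial derivative `∂_y ℓ_i(y,a,s)` on `ℝ₊` (one-sided at `y = 0`). -/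
def partialY {N : ℕ} (ℓ : Fin N → ℝ → ℝ → ℝ → ℝ) (i : Fin N) (y a s : ℝ) : ℝ :=
  derivWithin (fun z => ℓ i z a s) (Ici 0) y

/-- The partial derivative `∂_a ℓ_i(y,a,s)`. -/
def partialA {N : ℕ} (ℓ : Fin N → ℝ → ℝ → ℝ → ℝ) (i : Fin N) (y a s : ℝ) : ℝ :=
  deriv (fun b => ℓ i y b s) a

/-- The standing regularity of the running costs: `ℓ_i` is continuous on `ℝ₊ × ℝ × [0,T]`,
`ℓ_i(·,·,s)` is differentiable in `ℝ₊ × ℝ` for every `s ∈ [0,T]`, and `∂_y ℓ_i`, `∂_a ℓ_i` are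
continuous with respect to `(y,a,s)`. -/
structure RegularRunningCosts {N : ℕ} (T : ℝ) (ℓ : Fin N → ℝ → ℝ → ℝ → ℝ) : Prop where
  continuousOn : ∀ i, ContinuousOn (fun q : ℝ × ℝ × ℝ => ℓ i q.1 q.2.1 q.2.2)
    (Ici 0 ×ˢ univ ×ˢ Icc 0 T)
  differentiableOn : ∀ i, ∀ s ∈ Icc 0 T,
    DifferentiableOn ℝ (fun q : ℝ × ℝ => ℓ i q.1 q.2 s) (Ici 0 ×ˢ univ)
  continuousOn_partialY : ∀ i, ContinuousOn (fun q : ℝ × ℝ × ℝ => partialY ℓ i q.1 q.2.1 q.2.2)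
    (Ici 0 ×ˢ univ ×ˢ Icc 0 T)
  continuousOn_partialA : ∀ i, ContinuousOn (fun q : ℝ × ℝ × ℝ => partialA ℓ i q.1 q.2.1 q.2.2)
    (Ici 0 ×ˢ univ ×ˢ Icc 0 T)

/-- The standing assumption `g_i ∈ C_b(ℝ₊)`. -/
def RegularTerminalCosts {N : ℕ} (g : Fin N → ℝ → ℝ) : Prop :=
  ∀ i, ContinuousOn (g i) (Ici 0) ∧ ∃ M : ℝ, ∀ y, 0 ≤ y → |g i y| ≤ M

/-- [H1], coercivity of the running costs and lower bound on `ℓ_*`. -/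
def H1 {N : ℕ} (p T : ℝ) (ℓ : Fin N → ℝ → ℝ → ℝ → ℝ) (ℓstar : ℝ → ℝ) : Prop :=
  ∃ C₀ c₀ : ℝ, 0 < C₀ ∧
    (∀ i, ∀ y a s : ℝ, 0 ≤ y → s ∈ Icc 0 T → C₀ * |a| ^ p + c₀ ≤ ℓ i y a s) ∧
    ∀ s ∈ Icc 0 T, c₀ ≤ ℓstar s

/-- A modulus of continuity: a nondecreasing function `w` on `ℝ₊` with `w(0) = 0` which is
continuous at `0`. -/
structure IsModulusOfContinuity (w : ℝ → ℝ) : Prop where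
  monotoneOn : MonotoneOn w (Ici 0)
  map_zero : w 0 = 0
  tendsto : Tendsto w (𝓝[≥] 0) (𝓝 0)

/-- [H2], continuity of the running costs in time. -/
def H2 {N : ℕ} (p T : ℝ) (ℓ : Fin N → ℝ → ℝ → ℝ → ℝ) : Prop :=
  ∀ r : ℝ, 0 < r → ∃ w : ℝ → ℝ, IsModulusOfContinuity w ∧
    ∀ i, ∀ y ∈ Icc 0 r, ∀ a : ℝ, ∀ t₁ ∈ Icc 0 T, ∀ t₂ ∈ Icc 0 T,
      |ℓ i y a t₁ - ℓ i y a t₂| ≤ (1 + |a| ^ p) * w |t₁ - t₂|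

/-- [H3], growth of the partial derivatives of the running costs. -/
def H3 {N : ℕ} (p T : ℝ) (ℓ : Fin N → ℝ → ℝ → ℝ → ℝ) : Prop :=
  ∀ r : ℝ, 0 < r → ∃ c : ℝ, 0 ≤ c ∧
    ∀ i, ∀ y ∈ Icc 0 r, ∀ a : ℝ, ∀ s ∈ Icc 0 T,
      |partialY ℓ i y a s| ≤ c * (|a| ^ p + 1) ∧
      |partialA ℓ i y a s| ≤ c * (|a| ^ (p - 1) + 1)

/-- [H4], strict convexity of the running costs in the control. -/
def H4 {N : ℕ} (T : ℝ) (ℓ : Fin N → ℝ → ℝ → ℝ → ℝ) : Prop :=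
  ∀ i, ∀ y s : ℝ, 0 ≤ y → s ∈ Icc 0 T → StrictConvexOn ℝ univ (fun a => ℓ i y a s)

/-- [H5], `g_i ∈ C^1(ℝ₊)`. -/
def H5 {N : ℕ} (g : Fin N → ℝ → ℝ) : Prop :=
  ∀ i, ContDiffOn ℝ 1 (g i) (Ici 0)

/-- The running costs are Lipschitz continuous in time, locally uniformly in the state and in the
control. -/
def LocallyUniformlyLipschitzInTime {N : ℕ} (T : ℝ) (ℓ : Fin N → ℝ → ℝ → ℝ → ℝ) : Prop :=
  ∀ r : ℝ, 0 < r → ∃ K : ℝ, 0 ≤ K ∧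
    ∀ i, ∀ y ∈ Icc 0 r, ∀ a ∈ Icc (-r) r, ∀ t₁ ∈ Icc 0 T, ∀ t₂ ∈ Icc 0 T,
      |ℓ i y a t₁ - ℓ i y a t₂| ≤ K * |t₁ - t₂|

/-! ### Semiconcavity -/

/-- `f` is semiconcave in `S` (Cannarsa and Sinestrari): there is a nondecreasing upper
semicontinuous `w : ℝ₊ → ℝ₊` with `w(ρ) → 0` as `ρ → 0⁺` such that
`λ f(x) + (1-λ) f(y) - f(λ x + (1-λ) y) ≤ λ (1-λ) |x-y| w(|x-y|)` for all `x, y` with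
`[x,y] ⊆ S` and all `λ ∈ [0,1]`. -/
def IsSemiconcaveOn {E : Type*} [NormedAddCommGroup E] [NormedSpace ℝ E]
    (S : Set E) (f : E → ℝ) : Prop :=
  ∃ w : ℝ → ℝ, MonotoneOn w (Ici 0) ∧ UpperSemicontinuousOn w (Ici 0) ∧
    (∀ ρ, 0 ≤ ρ → 0 ≤ w ρ) ∧ Tendsto w (𝓝[>] 0) (𝓝 0) ∧
    ∀ x y : E, segment ℝ x y ⊆ S → ∀ θ ∈ Icc (0 : ℝ) 1,
      θ * f x + (1 - θ) * f y - f (θ • x + (1 - θ) • y)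
        ≤ θ * (1 - θ) * ‖x - y‖ * w ‖x - y‖

/-- `f` is locally semiconcave in `S`: it is semiconcave in every compact subset of `S`. -/
def IsLocallySemiconcaveOn {E : Type*} [NormedAddCommGroup E] [NormedSpace ℝ E]
    (S : Set E) (f : E → ℝ) : Prop :=
  ∀ K : Set E, K ⊆ S → IsCompact K → IsSemiconcaveOn K f

end

end Junction

/-! Semiconcavity is deduced from uniform approximate supergradients. Near (r₀, t₀) the value
function lies below an affine function of bounded slope, up to ε times the distance and an
arbitrarily small η; the radius δ of validity and the slope bound depend neither on the point nor on
η. Taking the base point inside a segment and evaluating at both ends cancels the linear parts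
(`isSemiconcaveOn_of_supergradient`).

To obtain such a bound, a nearly optimal trajectory from (r₀, t₀) is bent so that it starts from (r,
t) and rejoins the old one at time t₀ + h. By coercivity, nearly optimal trajectories from a compact
part of an open edge stay on that edge for a uniform time (`exists_confinement`), so only one C¹
Lagrangian matters. Expanding the bent cost requires bounded speeds, which a nearly optimal
trajectory need not have. Existence and regularity of continuous minimizers are bypassed by
discretization. The trajectory is sampled on a fine grid at almost no cost, by Jensen's inequality
(`exists_discreteCost_le`). The samples are replaced by discrete minimizers with the same end
points: the discrete Euler-Lagrange equation controls the oscillation of the derivative in the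
control, hence the speed, independently of the number of nodes (`exists_bounded_speed`). Polygonal
lines lead back from nodes to the value function (`exists_le_discreteCost_add`).

The bending adds x (1 - k/m) to the k-th of the first m nodes, where x = r - r₀, and multiplies the
first m time steps by 1 - τ, where τ = (t - t₀)/h (`discreteCost_deformed_le`). The Lagrangian has
no time derivative: being only Lipschitz in time, it gives an error proportional to |t - t₀|, not
o(|t - t₀|). This error acts only during a time h, so it is O(h |t - t₀|), and a small h brings it
below ε |t - t₀| / 2. Letting h depend on ε produces a general modulus of semiconcavity
(`exists_supergradient`). -/

namespace Junction

/-! ### Weak derivatives on an interval -/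

/-- A primitive of an integrable function has this function as weak derivative. -/
theorem integral_deriv_mul_of_primitive {a b : ℝ} (hab : a ≤ b) {y v : ℝ → ℝ}
    (hv : IntervalIntegrable v volume a b)
    (hy : ∀ s ∈ Icc a b, y s = y a + ∫ τ in a..s, v τ) {φ : ℝ → ℝ} (hφ : ContDiff ℝ ∞ φ)
    (hsupp : tsupport φ ⊆ Ioo a b) :
    ∫ s in a..b, deriv φ s * y s = -∫ s in a..b, φ s * v s := by
  have hφa : φ a = 0 := image_eq_zero_of_notMem_tsupport fun h => lt_irrefl _ (hsupp h).1
  have hφb : φ b = 0 := image_eq_zero_of_notMem_tsupport fun h => lt_irrefl _ (hsupp h).2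
  have hφac : AbsolutelyContinuousOnInterval φ a b :=
    ContDiffOn.absolutelyContinuousOnInterval
      ((hφ.of_le (by exact_mod_cast le_top)).contDiffOn)
  have hg := hv.absolutelyContinuousOnInterval_intervalIntegral (c := a) (by simp)
  -- Integration by parts for absolutely continuous functions; the boundary terms vanish because the
  -- support of φ avoids both end points.
  have key := hφac.integral_mul_deriv_eq_deriv_mul hg
  simp only [hφa, hφb, zero_mul, sub_zero, zero_sub] at key
  have h1 : ∫ s in a..b, φ s * deriv (fun x => ∫ τ in a..x, v τ) s = ∫ s in a..b, φ s * v s := by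
    apply intervalIntegral.integral_congr_ae
    filter_upwards [hv.ae_hasDerivAt_integral] with s hs hsI
    rw [(hs (uIoc_subset_uIcc hsI) a (by simp)).deriv]
  have hdφ : Continuous (deriv φ) := hφ.continuous_deriv (by exact_mod_cast le_top)
  have h2 : ∫ s in a..b, deriv φ s * y a = 0 := by
    rw [intervalIntegral.integral_mul_const, intervalIntegral.integral_deriv_eq_sub]
    · simp [hφa, hφb]
    · exact fun s _ => (hφ.differentiable (by simp)) s
    · exact hdφ.intervalIntegrable _ _
  have h3 : ∫ s in a..b, deriv φ s * y s
      = ∫ s in a..b, (deriv φ s * y a + deriv φ s * ∫ τ in a..s, v τ) := by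
    apply intervalIntegral.integral_congr
    intro s hs
    rw [uIcc_of_le hab] at hs
    simp only
    rw [hy s hs]; ring
  rw [h3, intervalIntegral.integral_add, h2, zero_add, ← h1, key, neg_neg]
  · exact (hdφ.mul continuous_const).intervalIntegrable _ _
  · exact (hdφ.intervalIntegrable a b).mul_continuousOn hg.continuousOn

/-- A smooth function with compact support in `(a, b)` and integral zero is the derivative of a
test function. -/
theorem exists_testFunction_deriv_eq {a b : ℝ} {g : ℝ → ℝ} (hg : ContDiff ℝ ∞ g)
    (hc : HasCompactSupport g) (hsupp : tsupport g ⊆ Ioo a b) (h0 : ∫ s in a..b, g s = 0) :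
    ∃ φ : ℝ → ℝ, ContDiff ℝ ∞ φ ∧ HasCompactSupport φ ∧ tsupport φ ⊆ Ioo a b ∧ deriv φ = g := by
  rcases (tsupport g).eq_empty_or_nonempty with he | hne
  · refine ⟨fun _ => 0, contDiff_const, HasCompactSupport.zero, ?_, ?_⟩
    · simp [tsupport]
    · rw [tsupport_eq_empty_iff] at he
      rw [he]; funext s; simp
  -- The primitive from a vanishes to the left of the support trivially, and to its right because
  -- the total integral is zero.
  obtain ⟨c, hcm, hcl⟩ := hc.isCompact.exists_isLeast hne
  obtain ⟨d, hdm, hdl⟩ := hc.isCompact.exists_isGreatest hne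
  have hgc : Continuous g := hg.continuous
  have hz : ∀ s, s ∉ Icc c d → g s = 0 := fun s hs =>
    image_eq_zero_of_notMem_tsupport fun h => hs ⟨hcl h, hdl h⟩
  have hder : ∀ s, HasDerivAt (fun x => ∫ τ in a..x, g τ) (g s) s := fun s =>
    intervalIntegral.integral_hasDerivAt_right (hgc.intervalIntegrable _ _)
      hgc.stronglyMeasurable.stronglyMeasurableAtFilter hgc.continuousAt
  have hderiv : deriv (fun x => ∫ τ in a..x, g τ) = g := funext fun s => (hder s).deriv
  have hzero : ∀ s, s ∉ Icc c d → ∫ τ in a..s, g τ = 0 := by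
    intro s hs
    rw [mem_Icc, not_and_or, not_le, not_le] at hs
    rcases hs with hs | hs
    · rw [intervalIntegral.integral_congr (g := fun _ => (0 : ℝ))]
      · simp
      · intro τ hτ
        refine hz τ fun h => ?_
        have := (hsupp hcm).1
        rcases le_total a s with has | has
        · rw [uIcc_of_le has] at hτ; linarith [hτ.2, h.1]
        · rw [uIcc_of_ge has] at hτ; linarith [hτ.2, h.1]
    · have : ∫ τ in s..b, g τ = 0 := by
        rw [intervalIntegral.integral_congr (g := fun _ => (0 : ℝ))]
        · simp
        · intro τ hτ
          refine hz τ fun h => ?_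
          have := (hsupp hdm).2
          rcases le_total s b with has | has
          · rw [uIcc_of_le has] at hτ; linarith [hτ.1, h.2]
          · rw [uIcc_of_ge has] at hτ; linarith [hτ.1, h.2]
      rw [← intervalIntegral.integral_add_adjacent_intervals (b := s)
        (hgc.intervalIntegrable _ _) (hgc.intervalIntegrable _ _), this, add_zero] at h0
      exact h0
  have hts : tsupport (fun x => ∫ τ in a..x, g τ) ⊆ Icc c d := by
    refine closure_minimal ?_ isClosed_Icc
    intro s hs
    by_contra h
    exact hs (hzero s h)
  refine ⟨fun x => ∫ τ in a..x, g τ, ?_, ?_, ?_, hderiv⟩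
  · rw [contDiff_infty_iff_deriv]
    exact ⟨fun s => (hder s).differentiableAt, by rw [hderiv]; exact hg⟩
  · exact HasCompactSupport.of_support_subset_isCompact isCompact_Icc
      ((subset_tsupport _).trans hts)
  · exact hts.trans fun s hs => ⟨(hsupp hcm).1.trans_le hs.1, hs.2.trans_lt (hsupp hdm).2⟩

/-- A continuous function with vanishing weak derivative is constant. -/
theorem eq_of_integral_deriv_mul_eq_zero {a b : ℝ} (hab : a < b) {z : ℝ → ℝ}
    (hz : ContinuousOn z (Icc a b))
    (h : ∀ φ : ℝ → ℝ, ContDiff ℝ ∞ φ → HasCompactSupport φ → tsupport φ ⊆ Ioo a b →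
      ∫ s in a..b, deriv φ s * z s = 0) :
    ∀ s ∈ Icc a b, z s = z a := by
  -- Du Bois-Reymond's argument: subtracting (∫ g) θ from a test function g, with θ of mass one,
  -- leaves a derivative of a test function. Hence z - ∫ θ z is orthogonal to every g.
  obtain ⟨θ, hθ, hθc, hθs, hθ1⟩ : ∃ θ : ℝ → ℝ, ContDiff ℝ ∞ θ ∧ HasCompactSupport θ ∧
      tsupport θ ⊆ Ioo a b ∧ ∫ s in a..b, θ s = 1 := by
    let B : ContDiffBump ((a + b) / 2) :=
      ⟨(b - a) / 8, (b - a) / 4, by linarith, by linarith⟩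
    have hs : tsupport (B.normed volume) ⊆ Ioo a b := by
      rw [B.tsupport_normed_eq, Real.closedBall_eq_Icc]
      intro s hs
      have h1 : (a + b) / 2 - (b - a) / 4 ≤ s := hs.1
      have h2 : s ≤ (a + b) / 2 + (b - a) / 4 := hs.2
      exact ⟨by linarith, by linarith⟩
    refine ⟨B.normed volume, B.contDiff_normed, B.hasCompactSupport_normed, hs, ?_⟩
    rw [intervalIntegral.integral_of_le hab.le, setIntegral_eq_integral_of_forall_compl_eq_zero,
      B.integral_normed]
    intro s hs'
    exact image_eq_zero_of_notMem_tsupport fun h => hs' (Ioo_subset_Ioc_self (hs h))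
  set c := ∫ s in a..b, θ s * z s with hcdef
  have hzi : ∀ g : ℝ → ℝ, Continuous g → IntervalIntegrable (fun s => g s * z s) volume a b :=
    fun g hg => (hg.continuousOn.mul (by rwa [uIcc_of_le hab.le])).intervalIntegrable
  have hae : ∀ᵐ s ∂volume, s ∈ Ioo a b → z s - c = 0 := by
    refine isOpen_Ioo.ae_eq_zero_of_integral_contDiff_smul_eq_zero ?_ ?_
    · exact ((hz.mono Ioo_subset_Icc_self).sub continuousOn_const).locallyIntegrableOn
        measurableSet_Ioo
    · intro g hg hgc hgs
      have hgi : IntervalIntegrable g volume a b := hg.continuous.intervalIntegrable _ _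
      have hθi : IntervalIntegrable θ volume a b := hθ.continuous.intervalIntegrable _ _
      set m := ∫ s in a..b, g s with hm
      obtain ⟨φ, hφ, hφc, hφs, hφd⟩ := exists_testFunction_deriv_eq (a := a) (b := b)
        (g := fun s => g s - m * θ s) (hg.sub (contDiff_const.mul hθ))
        (hgc.sub hθc.mul_left)
        (by
          refine (tsupport_sub g (fun s => m * θ s)).trans (union_subset hgs ?_)
          exact (closure_mono (Function.support_mul_subset_right (fun _ => m) θ)).trans hθs)
        (by
          rw [intervalIntegral.integral_sub hgi (hθi.const_mul m),
            intervalIntegral.integral_const_mul, hθ1, mul_one, sub_self])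
      have h1 := h φ hφ hφc hφs
      rw [hφd] at h1
      have h2 : ∫ s in a..b, (g s - m * θ s) * z s = (∫ s in a..b, g s * z s) - m * c := by
        rw [hcdef, ← intervalIntegral.integral_const_mul, ← intervalIntegral.integral_sub
          (hzi g hg.continuous) ((hzi θ hθ.continuous).const_mul m)]
        exact intervalIntegral.integral_congr fun s _ => by ring
      have h3 : ∫ s in a..b, g s * (z s - c) = 0 := by
        have : ∫ s in a..b, g s * (z s - c) = (∫ s in a..b, g s * z s) - m * c := by
          rw [hm, ← intervalIntegral.integral_mul_const, ← intervalIntegral.integral_sub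
            (hzi g hg.continuous) (hgi.mul_const c)]
          exact intervalIntegral.integral_congr fun s _ => by ring
        rw [this, ← h2, h1]
      rw [← h3, intervalIntegral.integral_of_le hab.le,
        setIntegral_eq_integral_of_forall_compl_eq_zero]
      · rfl
      intro s hs
      rw [image_eq_zero_of_notMem_tsupport fun h => hs (Ioo_subset_Ioc_self (hgs h)), zero_mul]
  have hEq : EqOn z (fun _ => c) (Ioo a b) := by
    refine Measure.eqOn_open_of_ae_eq (μ := volume) ?_ isOpen_Ioo
      (hz.mono Ioo_subset_Icc_self) continuousOn_const
    rw [EventuallyEq, ae_restrict_iff' measurableSet_Ioo]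
    filter_upwards [hae] with s hs hsI using sub_eq_zero.1 (hs hsI)
  have hEq' : EqOn z (fun _ => c) (Icc a b) := by
    refine hEq.of_subset_closure hz continuousOn_const Ioo_subset_Icc_self ?_
    rw [closure_Ioo hab.ne]
  intro s hs
  rw [hEq' hs, hEq' (left_mem_Icc.2 hab.le)]

/-- A continuous function is the primitive of its weak derivative. -/
theorem eq_primitive_of_integral_deriv_mul {a b : ℝ} (hab : a ≤ b) {y v : ℝ → ℝ}
    (hyc : ContinuousOn y (Icc a b)) (hv : IntervalIntegrable v volume a b)
    (h : ∀ φ : ℝ → ℝ, ContDiff ℝ ∞ φ → HasCompactSupport φ → tsupport φ ⊆ Ioo a b →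
      ∫ s in a..b, deriv φ s * y s = -∫ s in a..b, φ s * v s) :
    ∀ s ∈ Icc a b, y s = y a + ∫ τ in a..s, v τ := by
  rcases hab.eq_or_lt with rfl | hab'
  · intro s hs
    rw [Icc_self, mem_singleton_iff] at hs
    simp [hs]
  have hgc := (hv.absolutelyContinuousOnInterval_intervalIntegral (c := a) (by simp)).continuousOn
  rw [uIcc_of_le hab] at hgc
  have hconst := eq_of_integral_deriv_mul_eq_zero hab'
    (z := fun s => y s - ∫ τ in a..s, v τ) (hyc.sub hgc) (by
      intro φ hφ hφc hφs
      have hdφ : Continuous (deriv φ) := hφ.continuous_deriv (by exact_mod_cast le_top)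
      have h1 := h φ hφ hφc hφs
      have h2 := integral_deriv_mul_of_primitive (y := fun s => ∫ τ in a..s, v τ) hab hv
        (by simp) hφ hφs
      have : ∫ s in a..b, deriv φ s * (y s - ∫ τ in a..s, v τ)
          = ∫ s in a..b, (deriv φ s * y s - deriv φ s * ∫ τ in a..s, v τ) :=
        intervalIntegral.integral_congr fun s _ => by ring
      rw [this, intervalIntegral.integral_sub, h1, h2, sub_self]
      · exact (hdφ.continuousOn.mul (by rwa [uIcc_of_le hab])).intervalIntegrable
      · exact (hdφ.continuousOn.mul (by rwa [uIcc_of_le hab])).intervalIntegrable)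
  intro s hs
  have := hconst s hs
  simp only [intervalIntegral.integral_same, sub_zero] at this
  linarith

/-! ### Powers -/

theorem rpow_sub_one_mul_self {p x : ℝ} (hp : 1 < p) (hx : 0 ≤ x) : x ^ (p - 1) * x = x ^ p := by
  rcases hx.eq_or_lt with rfl | h
  · rw [mul_zero, Real.zero_rpow (by linarith)]
  · rw [Real.rpow_sub_one h.ne', div_mul_cancel₀ _ h.ne']

/-- A linear function is bounded by a small multiple of a superlinear power, up to a constant. -/
theorem exists_le_mul_rpow_add {p : ℝ} (hp : 1 < p) {μ : ℝ} (hμ : 0 < μ) :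
    ∃ c, 0 ≤ c ∧ ∀ x, 0 ≤ x → x ≤ μ * x ^ p + c := by
  -- This is the point where μ x^(p-1) = 1; beyond it the power dominates.
  refine ⟨(1 / μ) ^ (1 / (p - 1)), by positivity, fun x hx => ?_⟩
  have hc : (0 : ℝ) ≤ (1 / μ) ^ (1 / (p - 1)) := by positivity
  have hxp : 0 ≤ x ^ p := by positivity
  rcases le_total x ((1 / μ) ^ (1 / (p - 1))) with h | h
  · nlinarith
  · have h1 : 1 / μ ≤ x ^ (p - 1) := by
      have := Real.rpow_le_rpow hc h (by linarith : 0 ≤ p - 1)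
      rwa [← Real.rpow_mul (by positivity), one_div_mul_cancel (by linarith),
        Real.rpow_one] at this
    have h2 : x ≤ μ * x ^ p := by
      rw [← rpow_sub_one_mul_self hp hx, ← mul_assoc]
      have : 1 ≤ μ * x ^ (p - 1) := by
        rw [div_le_iff₀ hμ] at h1; linarith
      nlinarith
    linarith

theorem rpow_sub_one_le {p x : ℝ} (hp : 1 < p) (hx : 0 ≤ x) : x ^ (p - 1) ≤ x ^ p + 1 := by
  rcases le_total x 1 with h | h
  · have : x ^ (p - 1) ≤ 1 := Real.rpow_le_one hx h (by linarith)
    have : 0 ≤ x ^ p := by positivity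
    linarith
  · have := Real.rpow_le_rpow_of_exponent_le h (by linarith : p - 1 ≤ p)
    linarith

theorem le_rpow_add_one {p x : ℝ} (hp : 1 < p) (hx : 0 ≤ x) : x ≤ x ^ p + 1 := by
  rcases le_total x 1 with h | h
  · have : 0 ≤ x ^ p := by positivity
    linarith
  · have := Real.self_le_rpow_of_one_le h hp.le
    linarith

/-! ### Lagrangians on a half-line -/

/-- The properties of the running cost `f` on one edge, with partial derivatives `fy` and `fa` in
the state and in the control. -/
structure IsLagrangian (p T : ℝ) (f fy fa : ℝ → ℝ → ℝ → ℝ) : Prop where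
  continuousOn : ContinuousOn (fun q : ℝ × ℝ × ℝ => f q.1 q.2.1 q.2.2) (Ici 0 ×ˢ univ ×ˢ Icc 0 T)
  continuousOn_fy :
    ContinuousOn (fun q : ℝ × ℝ × ℝ => fy q.1 q.2.1 q.2.2) (Ici 0 ×ˢ univ ×ˢ Icc 0 T)
  continuousOn_fa :
    ContinuousOn (fun q : ℝ × ℝ × ℝ => fa q.1 q.2.1 q.2.2) (Ici 0 ×ˢ univ ×ˢ Icc 0 T)
  hasFDerivAt : ∀ y a s, 0 < y → s ∈ Icc 0 T →
    HasFDerivAt (fun q : ℝ × ℝ => f q.1 q.2 s)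
      (fy y a s • ContinuousLinearMap.fst ℝ ℝ ℝ + fa y a s • ContinuousLinearMap.snd ℝ ℝ ℝ) (y, a)
  tangent_le : ∀ y a b s, 0 ≤ y → s ∈ Icc 0 T → f y a s + fa y a s * (b - a) ≤ f y b s
  coercive : ∃ C₀ c₀ : ℝ, 0 < C₀ ∧ ∀ y a s, 0 ≤ y → s ∈ Icc 0 T → C₀ * |a| ^ p + c₀ ≤ f y a s
  time_modulus : ∀ r, 0 < r → ∃ w : ℝ → ℝ, IsModulusOfContinuity w ∧
    ∀ y ∈ Icc 0 r, ∀ a, ∀ t₁ ∈ Icc 0 T, ∀ t₂ ∈ Icc 0 T,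
      |f y a t₁ - f y a t₂| ≤ (1 + |a| ^ p) * w |t₁ - t₂|
  growth : ∀ r, 0 < r → ∃ c, 0 ≤ c ∧ ∀ y ∈ Icc 0 r, ∀ a, ∀ s ∈ Icc 0 T,
    |fy y a s| ≤ c * (|a| ^ p + 1) ∧ |fa y a s| ≤ c * (|a| ^ (p - 1) + 1)
  time_lipschitz : ∀ r, 0 < r → ∃ K, 0 ≤ K ∧ ∀ y ∈ Icc 0 r, ∀ a ∈ Icc (-r) r,
    ∀ t₁ ∈ Icc 0 T, ∀ t₂ ∈ Icc 0 T, |f y a t₁ - f y a t₂| ≤ K * |t₁ - t₂|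

namespace IsLagrangian

variable {p T : ℝ} {f fy fa : ℝ → ℝ → ℝ → ℝ}

theorem compact_subset {y₀ y₁ A T : ℝ} (hy₀ : 0 ≤ y₀) :
    Icc y₀ y₁ ×ˢ Icc (-A) A ×ˢ Icc 0 T ⊆ (Ici 0 ×ˢ univ ×ˢ Icc 0 T : Set (ℝ × ℝ × ℝ)) :=
  prod_mono (fun _ h => hy₀.trans h.1) (prod_mono (subset_univ _) le_rfl)

theorem isCompact_box {y₀ y₁ A T : ℝ} :
    IsCompact (Icc y₀ y₁ ×ˢ Icc (-A) A ×ˢ Icc 0 T : Set (ℝ × ℝ × ℝ)) :=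
  isCompact_Icc.prod (isCompact_Icc.prod isCompact_Icc)

theorem exists_bound_of_continuousOn {φ : ℝ → ℝ → ℝ → ℝ}
    (hφ : ContinuousOn (fun q : ℝ × ℝ × ℝ => φ q.1 q.2.1 q.2.2) (Ici 0 ×ˢ univ ×ˢ Icc 0 T))
    (y₁ A : ℝ) :
    ∃ C, 0 ≤ C ∧ ∀ y ∈ Icc 0 y₁, ∀ a ∈ Icc (-A) A, ∀ s ∈ Icc 0 T, |φ y a s| ≤ C := by
  obtain ⟨C, hC⟩ := (isCompact_box (y₀ := 0) (y₁ := y₁) (A := A) (T := T)).exists_bound_of_continuousOn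
    (hφ.mono (compact_subset le_rfl))
  exact ⟨max C 0, le_max_right _ _, fun y hy a ha s hs =>
    (hC (y, a, s) ⟨hy, ha, hs⟩).trans (le_max_left _ _)⟩

theorem exists_uniform_of_continuousOn {φ : ℝ → ℝ → ℝ → ℝ}
    (hφ : ContinuousOn (fun q : ℝ × ℝ × ℝ => φ q.1 q.2.1 q.2.2) (Ici 0 ×ˢ univ ×ˢ Icc 0 T))
    (y₁ A : ℝ) {ε : ℝ} (hε : 0 < ε) :
    ∃ δ, 0 < δ ∧ ∀ y ∈ Icc 0 y₁, ∀ y' ∈ Icc 0 y₁, ∀ a ∈ Icc (-A) A, ∀ a' ∈ Icc (-A) A,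
      ∀ s ∈ Icc 0 T, ∀ s' ∈ Icc 0 T, |y' - y| ≤ δ → |a' - a| ≤ δ → |s' - s| ≤ δ →
      |φ y' a' s' - φ y a s| ≤ ε := by
  have hu := (isCompact_box (y₀ := 0) (y₁ := y₁) (A := A)
    (T := T)).uniformContinuousOn_of_continuous (hφ.mono (compact_subset le_rfl))
  obtain ⟨δ, hδ, h⟩ := Metric.uniformContinuousOn_iff.1 hu ε hε
  refine ⟨δ / 2, by positivity, fun y hy y' hy' a ha a' ha' s hs s' hs' h1 h2 h3 => ?_⟩
  have := h (y', a', s') ⟨hy', ha', hs'⟩ (y, a, s) ⟨hy, ha, hs⟩ (by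
    simp only [Prod.dist_eq, Real.dist_eq]
    exact max_lt (by linarith) (max_lt (by linarith) (by linarith)))
  exact this.le

theorem hasDerivAt_comp (hf : IsLagrangian p T f fy fa) {Y A : ℝ → ℝ} {Y' A' θ s : ℝ}
    (hY : HasDerivAt Y Y' θ) (hA : HasDerivAt A A' θ) (hpos : 0 < Y θ) (hs : s ∈ Icc 0 T) :
    HasDerivAt (fun θ => f (Y θ) (A θ) s)
      (fy (Y θ) (A θ) s * Y' + fa (Y θ) (A θ) s * A') θ := by
  have := (hf.hasFDerivAt (Y θ) (A θ) s hpos hs).comp_hasDerivAt θ (hY.prodMk hA)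
  simpa [Function.comp_def] using this

/-- Uniform first order expansion on compact sets. -/
theorem exists_taylor (hf : IsLagrangian p T f fy fa) {y₀ : ℝ} (hy₀ : 0 < y₀) (y₁ A : ℝ) {ε : ℝ}
    (hε : 0 < ε) :
    ∃ δ, 0 < δ ∧ ∀ y ∈ Icc y₀ y₁, ∀ y' ∈ Icc y₀ y₁, ∀ a ∈ Icc (-A) A, ∀ a' ∈ Icc (-A) A,
      ∀ s ∈ Icc 0 T, |y' - y| ≤ δ → |a' - a| ≤ δ →
      f y' a' s ≤ f y a s + fy y a s * (y' - y) + fa y a s * (a' - a)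
        + ε * (|y' - y| + |a' - a|) := by
  obtain ⟨δ₁, hδ₁, h₁⟩ := exists_uniform_of_continuousOn hf.continuousOn_fy y₁ A hε
  obtain ⟨δ₂, hδ₂, h₂⟩ := exists_uniform_of_continuousOn hf.continuousOn_fa y₁ A hε
  refine ⟨min δ₁ δ₂, lt_min hδ₁ hδ₂, fun y hy y' hy' a ha a' ha' s hs hyy haa => ?_⟩
  have hT : |s - s| ≤ min δ₁ δ₂ := by simp [hδ₁.le, hδ₂.le]
  have hin : ∀ θ ∈ Icc (0 : ℝ) 1, y + θ * (y' - y) ∈ Icc y₀ y₁ ∧ a + θ * (a' - a) ∈ Icc (-A) A := by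
    intro θ hθ
    have e1 : y + θ * (y' - y) = (1 - θ) * y + θ * y' := by ring
    have e2 : a + θ * (a' - a) = (1 - θ) * a + θ * a' := by ring
    rw [e1, e2]
    obtain ⟨h0, h1⟩ := hθ
    exact ⟨convex_Icc _ _ hy hy' (by linarith) h0 (by ring),
      convex_Icc _ _ ha ha' (by linarith) h0 (by ring)⟩
  have hd : ∀ θ ∈ Icc (0 : ℝ) 1, HasDerivAt (fun θ => f (y + θ * (y' - y)) (a + θ * (a' - a)) s)
      (fy (y + θ * (y' - y)) (a + θ * (a' - a)) s * (y' - y)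
        + fa (y + θ * (y' - y)) (a + θ * (a' - a)) s * (a' - a)) θ := by
    intro θ hθ
    refine hf.hasDerivAt_comp ?_ ?_ (hy₀.trans_le (hin θ hθ).1.1) hs
    · simpa using ((hasDerivAt_id θ).mul_const (y' - y)).const_add y
    · simpa using ((hasDerivAt_id θ).mul_const (a' - a)).const_add a
  -- The mean value theorem along the segment, which stays in y ≥ y₀ > 0, where differentiability is
  -- available; uniform continuity of the gradient then controls the remainder.
  obtain ⟨θ, hθ, hslope⟩ := exists_hasDerivAt_eq_slope
    (fun θ => f (y + θ * (y' - y)) (a + θ * (a' - a)) s) _ zero_lt_one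
    (fun θ hθ => (hd θ hθ).continuousAt.continuousWithinAt)
    (fun θ hθ => hd θ ⟨hθ.1.le, hθ.2.le⟩)
  have hθ' : θ ∈ Icc (0 : ℝ) 1 := ⟨hθ.1.le, hθ.2.le⟩
  simp only [one_mul, zero_mul, add_zero, add_sub_cancel, sub_zero, div_one] at hslope
  have small : ∀ x d : ℝ, |x| ≤ d → |y + θ * x - y| ≤ d ∧ |a + θ * x - a| ≤ d := by
    intro x d hx
    rw [add_sub_cancel_left, add_sub_cancel_left, abs_mul, abs_of_pos hθ.1]
    have := abs_nonneg x
    constructor <;> nlinarith [hθ.2]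
  have h0 : ∀ z ∈ Icc y₀ y₁, z ∈ Icc 0 y₁ := fun z hz => ⟨hy₀.le.trans hz.1, hz.2⟩
  have b1 := h₁ y (h0 y hy) _ (h0 _ (hin θ hθ').1) a ha _ (hin θ hθ').2 s hs s hs
    ((small _ _ hyy).1.trans (min_le_left _ _)) ((small _ _ haa).2.trans (min_le_left _ _))
    (hT.trans (min_le_left _ _))
  have b2 := h₂ y (h0 y hy) _ (h0 _ (hin θ hθ').1) a ha _ (hin θ hθ').2 s hs s hs
    ((small _ _ hyy).1.trans (min_le_right _ _)) ((small _ _ haa).2.trans (min_le_right _ _))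
    (hT.trans (min_le_right _ _))
  set P := fy (y + θ * (y' - y)) (a + θ * (a' - a)) s
  set Q := fa (y + θ * (y' - y)) (a + θ * (a' - a)) s
  have c1 : (P - fy y a s) * (y' - y) ≤ ε * |y' - y| :=
    (le_abs_self _).trans (by rw [abs_mul]; gcongr)
  have c2 : (Q - fa y a s) * (a' - a) ≤ ε * |a' - a| :=
    (le_abs_self _).trans (by rw [abs_mul]; gcongr)
  linarith

/-- First order expansion of the perspective `(y, τ, b) ↦ (1 - τ) f(y, (a - b) / (1 - τ), s)`. -/
theorem exists_perspective (hf : IsLagrangian p T f fy fa) {y₀ : ℝ} (hy₀ : 0 < y₀) (y₁ : ℝ)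
    {M : ℝ} (hM : 0 ≤ M) {ε : ℝ} (hε : 0 < ε) :
    ∃ δ, 0 < δ ∧ ∀ y ∈ Icc y₀ y₁, ∀ d, y + d ∈ Icc y₀ y₁ → ∀ a ∈ Icc (-M) M, ∀ τ b,
      ∀ s ∈ Icc 0 T, |τ| ≤ δ → |b| ≤ δ → |d| ≤ δ →
      (1 - τ) * f (y + d) ((a - b) / (1 - τ)) s ≤ f y a s - f y a s * τ + fy y a s * d
        + fa y a s * (τ * a - b) + ε * (|τ| + |b| + |d|) := by
  obtain ⟨C, hC0, hC⟩ := exists_bound_of_continuousOn hf.continuousOn_fy y₁ M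
  set ε' := ε / (8 * (M + 1)) with hε'
  have hε'0 : 0 < ε' := by positivity
  obtain ⟨δ, hδ, h⟩ := hf.exists_taylor hy₀ y₁ (2 * (M + 1)) hε'0
  -- The first bound gives 1 - τ ≥ 1/2 and a new control of size at most 2(M + 1), the second keeps
  -- both increments within δ, and the third absorbs the cross term τ ∂_y f d.
  refine ⟨min (1 / 2) (min (δ / (2 * (M + 1))) (ε / (2 * (C + 1)))), by positivity,
    fun y hy d hd a ha τ b s hs hτ hb hdδ => ?_⟩
  have hτ2 : |τ| ≤ 1 / 2 := hτ.trans (min_le_left _ _)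
  have hb2 : |b| ≤ 1 / 2 := hb.trans (min_le_left _ _)
  have hd3 : |d| * (2 * (M + 1)) ≤ δ := by
    rw [← le_div_iff₀ (by positivity)]
    exact hdδ.trans ((min_le_right _ _).trans (min_le_left _ _))
  have hτ4 : |τ| * (2 * (C + 1)) ≤ ε := by
    rw [← le_div_iff₀ (by positivity)]
    exact hτ.trans ((min_le_right _ _).trans (min_le_right _ _))
  have hd0 := abs_nonneg d
  have hb0 := abs_nonneg b
  have hτ0 := abs_nonneg τ
  obtain ⟨hτl, hτu⟩ := abs_le.1 hτ2
  have hpos : 0 < 1 - τ := by linarith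
  have haM : |a| ≤ M := abs_le.2 ha
  have hdiff : (a - b) / (1 - τ) - a = (τ * a - b) / (1 - τ) := by field_simp; ring
  have hnum : |τ * a - b| ≤ M * |τ| + |b| := by
    refine (abs_sub _ _).trans ?_
    rw [abs_mul]; nlinarith
  have hda : |(a - b) / (1 - τ) - a| ≤ 2 * (M * |τ| + |b|) := by
    rw [hdiff, abs_div, abs_of_pos hpos, div_le_iff₀ hpos]
    have : 0 ≤ M * |τ| + |b| := by positivity
    nlinarith
  have hsmall : 2 * (M * |τ| + |b|) ≤ δ := by
    have hτ5 : |τ| ≤ δ / (2 * (M + 1)) := hτ.trans ((min_le_right _ _).trans (min_le_left _ _))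
    have hb5 : |b| ≤ δ / (2 * (M + 1)) := hb.trans ((min_le_right _ _).trans (min_le_left _ _))
    calc 2 * (M * |τ| + |b|) ≤ 2 * (M * (δ / (2 * (M + 1))) + δ / (2 * (M + 1))) := by gcongr
      _ = δ := by field_simp
  have ht := h y hy (y + d) hd a ⟨by linarith [ha.1], by linarith [ha.2]⟩
    ((a - b) / (1 - τ)) (by
      refine abs_le.1 ?_
      rw [abs_div, abs_of_pos hpos, div_le_iff₀ hpos]
      have := abs_sub a b
      nlinarith) s hs (by rw [add_sub_cancel_left]; nlinarith) (hda.trans hsmall)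
  rw [add_sub_cancel_left] at ht
  have h1 := mul_le_mul_of_nonneg_left ht hpos.le
  -- The factor 1 - τ cancels the denominator of the control increment, so the control term is
  -- exactly linear in τ and b.
  have h2 : (1 - τ) * (f y a s + fy y a s * d + fa y a s * ((a - b) / (1 - τ) - a)
      + ε' * (|d| + |(a - b) / (1 - τ) - a|))
      = f y a s - f y a s * τ + fy y a s * d + fa y a s * (τ * a - b) - τ * fy y a s * d
        + (1 - τ) * (ε' * (|d| + |(a - b) / (1 - τ) - a|)) := by
    rw [hdiff]; field_simp; ring
  have h3 : -(τ * fy y a s * d) ≤ ε / 2 * |d| := by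
    refine (neg_le_abs _).trans ?_
    rw [abs_mul, abs_mul]
    have := hC y ⟨hy₀.le.trans hy.1, hy.2⟩ a ha s hs
    have : |τ| * |fy y a s| ≤ ε / 2 := by nlinarith
    gcongr
  have h4 : (1 - τ) * (ε' * (|d| + |(a - b) / (1 - τ) - a|)) ≤ ε / 2 * (|τ| + |b| + |d|) := by
    have e1 : (1 - τ) * (ε' * (|d| + |(a - b) / (1 - τ) - a|))
        ≤ 2 * (ε' * (|d| + 2 * (M * |τ| + |b|))) := by
      gcongr; linarith
    have e2 : |d| + 2 * (M * |τ| + |b|) ≤ 2 * (M + 1) * (|τ| + |b| + |d|) := by nlinarith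
    have e3 : 2 * (ε' * (2 * (M + 1) * (|τ| + |b| + |d|))) = ε / 2 * (|τ| + |b| + |d|) := by
      rw [hε']; field_simp; ring
    rw [← e3]
    refine e1.trans ?_
    gcongr
  have h5 : ε / 2 * |d| ≤ ε / 2 * (|τ| + |b| + |d|) := by gcongr; linarith
  linarith

/-- By convexity the tangent at a, evaluated at the control 0, gives f(y,a,s) ≤ f(y,0,s) + ∂_a
f(y,a,s) a, and the last term grows at most like |a|^p. The lower bound is coercivity. -/
theorem exists_le_growth (hf : IsLagrangian p T f fy fa) (hp : 1 < p) {r : ℝ} (hr : 0 < r) :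
    ∃ C, 0 ≤ C ∧ ∀ y ∈ Icc 0 r, ∀ a, ∀ s ∈ Icc 0 T, |f y a s| ≤ C * (|a| ^ p + 1) := by
  obtain ⟨c, hc0, hc⟩ := hf.growth r hr
  obtain ⟨F, hF0, hF⟩ := exists_bound_of_continuousOn hf.continuousOn r 0
  obtain ⟨C₀, c₀, hC₀, hco⟩ := hf.coercive
  refine ⟨F + 2 * c + |c₀|, by positivity, fun y hy a s hs => ?_⟩
  have ht := hf.tangent_le y a 0 s hy.1 hs
  have h0 := (abs_le.1 (hF y hy 0 (by simp) s hs)).2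
  have hfa := (hc y hy a s hs).2
  have hap : 0 ≤ |a| ^ p := by positivity
  have h1 : fa y a s * a ≤ c * (2 * |a| ^ p + 1) := by
    refine (le_abs_self _).trans ?_
    rw [abs_mul]
    calc |fa y a s| * |a| ≤ c * (|a| ^ (p - 1) + 1) * |a| := by gcongr
      _ = c * (|a| ^ (p - 1) * |a| + |a|) := by ring
      _ ≤ c * (2 * |a| ^ p + 1) := by
        rw [rpow_sub_one_mul_self hp (abs_nonneg a)]
        have := le_rpow_add_one hp (abs_nonneg a)
        exact mul_le_mul_of_nonneg_left (by linarith) hc0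
  have h2 := hco y a s hy.1 hs
  have h3 := neg_abs_le c₀
  have h4 := abs_nonneg c₀
  rw [abs_le]
  constructor
  · linarith [mul_nonneg hF0 hap, mul_nonneg hc0 hap, mul_nonneg h4 hap, mul_nonneg hC₀.le hap]
  · linarith [mul_nonneg hF0 hap, mul_nonneg hc0 hap, mul_nonneg h4 hap]

/-- Lipschitz continuity in the state. -/
theorem abs_sub_le_of_growth (hf : IsLagrangian p T f fy fa) {r c : ℝ}
    (hc : ∀ y ∈ Icc 0 r, ∀ a, ∀ s ∈ Icc 0 T,
      |fy y a s| ≤ c * (|a| ^ p + 1) ∧ |fa y a s| ≤ c * (|a| ^ (p - 1) + 1))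
    {y y' a s : ℝ} (hy : y ∈ Ioc 0 r) (hy' : y' ∈ Ioc 0 r) (hs : s ∈ Icc 0 T) :
    |f y' a s - f y a s| ≤ c * (|a| ^ p + 1) * |y' - y| := by
  refine (convex_Ioc (0 : ℝ) r).norm_image_sub_le_of_norm_hasDerivWithin_le
    (f := fun z => f z a s) (f' := fun z => fy z a s)
    (fun z hz => ?_) (fun z hz => (hc z ⟨hz.1.le, hz.2⟩ a s hs).1) hy hy'
  have := hf.hasDerivAt_comp (hasDerivAt_id z) (hasDerivAt_const z a) hz.1 hs
  simpa using this.hasDerivWithinAt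

end IsLagrangian

/-! ### Discretized costs -/

/-- The cost of the nodes `w 0, …, w n` on the uniform grid of step `d` that starts at `t₀`. -/
noncomputable def discreteCost (f : ℝ → ℝ → ℝ → ℝ) (n : ℕ) (d t₀ : ℝ) (w : ℕ → ℝ) : ℝ :=
  ∑ k ∈ Finset.range n, d * f (w k) ((w (k + 1) - w k) / d) (t₀ + k * d)

theorem abs_sub_le_sum_speed {d : ℝ} (hd : 0 < d) (w : ℕ → ℝ) (k : ℕ) :
    |w k - w 0| ≤ ∑ m ∈ Finset.range k, d * |(w (m + 1) - w m) / d| := by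
  rw [← Finset.sum_range_sub]
  refine (Finset.abs_sum_le_sum_abs _ _).trans (le_of_eq (Finset.sum_congr rfl fun m _ => ?_))
  rw [abs_div, abs_of_pos hd, mul_div_cancel₀ _ hd.ne']

theorem grid_mem {n k : ℕ} {d t₀ T : ℝ} (hd : 0 ≤ d) (ht₀ : 0 ≤ t₀) (hT : t₀ + n * d ≤ T)
    (hk : k ≤ n) : t₀ + k * d ∈ Icc 0 T := by
  have : (k : ℝ) * d ≤ n * d := by gcongr
  exact ⟨by positivity, by linarith⟩

/-! ### Discrete Euler-Lagrange equation and speed bounds. -/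

namespace IsLagrangian

variable {p T : ℝ} {f fy fa : ℝ → ℝ → ℝ → ℝ}

/-- The discrete Euler-Lagrange equation, summed between two nodes. -/
theorem discrete_euler_lagrange (hf : IsLagrangian p T f fy fa) {n : ℕ} {d t₀ : ℝ} (hd : 0 < d)
    {w : ℕ → ℝ} (hw : ∀ m < n, 0 < w m) (ht : ∀ m < n, t₀ + m * d ∈ Icc 0 T) {j k : ℕ}
    (hjk : j < k) (hk : k < n)
    (hmin : ∀ᶠ x in 𝓝 (0 : ℝ), discreteCost f n d t₀ w
      ≤ discreteCost f n d t₀ fun m => w m + x * if j < m ∧ m ≤ k then 1 else 0) :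
    fa (w k) ((w (k + 1) - w k) / d) (t₀ + k * d) - fa (w j) ((w (j + 1) - w j) / d) (t₀ + j * d)
      = ∑ m ∈ Finset.range n, d * (fy (w m) ((w (m + 1) - w m) / d) (t₀ + m * d)
          * if j < m ∧ m ≤ k then 1 else 0) := by
  set χ : ℕ → ℝ := fun m => if j < m ∧ m ≤ k then 1 else 0 with hχ
  have hder : HasDerivAt (fun x : ℝ => discreteCost f n d t₀ fun m => w m + x * χ m)
      (∑ m ∈ Finset.range n, d * (fy (w m) ((w (m + 1) - w m) / d) (t₀ + m * d) * χ m
        + fa (w m) ((w (m + 1) - w m) / d) (t₀ + m * d) * ((χ (m + 1) - χ m) / d))) 0 := by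
    unfold discreteCost
    refine HasDerivAt.fun_sum fun m hm => ?_
    have hmn := Finset.mem_range.1 hm
    have h1 : HasDerivAt (fun x : ℝ => w m + x * χ m) (χ m) 0 := by
      simpa using ((hasDerivAt_id (0 : ℝ)).mul_const (χ m)).const_add (w m)
    have h1' : HasDerivAt (fun x : ℝ => w (m + 1) + x * χ (m + 1)) (χ (m + 1)) 0 := by
      simpa using ((hasDerivAt_id (0 : ℝ)).mul_const (χ (m + 1))).const_add (w (m + 1))
    have h2 := (h1'.fun_sub h1).div_const d
    have h3 := hf.hasDerivAt_comp h1 h2 (by simpa using hw m hmn) (ht m hmn)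
    simpa using h3.const_mul d
  have h0 : ∑ m ∈ Finset.range n, d * (fy (w m) ((w (m + 1) - w m) / d) (t₀ + m * d) * χ m
        + fa (w m) ((w (m + 1) - w m) / d) (t₀ + m * d) * ((χ (m + 1) - χ m) / d)) = 0 := by
    refine IsLocalMin.hasDerivAt_eq_zero ?_ hder
    simpa only [IsLocalMin, IsMinFilter, zero_mul, add_zero] using hmin
  -- The indicator of (j, k] jumps up from j to j + 1 and down from k to k + 1, so its difference
  -- quotients isolate the control derivatives at j and k.
  have h1 : ∀ m, d * (fy (w m) ((w (m + 1) - w m) / d) (t₀ + m * d) * χ m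
        + fa (w m) ((w (m + 1) - w m) / d) (t₀ + m * d) * ((χ (m + 1) - χ m) / d))
      = d * (fy (w m) ((w (m + 1) - w m) / d) (t₀ + m * d) * χ m)
        + ((if m = j then fa (w m) ((w (m + 1) - w m) / d) (t₀ + m * d) else 0)
          - if m = k then fa (w m) ((w (m + 1) - w m) / d) (t₀ + m * d) else 0) := by
    intro m
    have : χ (m + 1) - χ m = (if m = j then 1 else 0) - if m = k then 1 else 0 := by
      simp only [hχ]
      split_ifs <;> first | omega | norm_num
    rw [this, mul_add]
    congr 1
    split_ifs <;> field_simp <;> ring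
  rw [Finset.sum_congr rfl fun m _ => h1 m, Finset.sum_add_distrib, Finset.sum_sub_distrib,
    Finset.sum_ite_eq', Finset.sum_ite_eq', if_pos (Finset.mem_range.2 (hjk.trans hk)),
    if_pos (Finset.mem_range.2 hk)] at h0
  linarith

/-- A bound on `fa` is a bound on the control. -/
theorem exists_abs_le_of_abs_fa_le (hf : IsLagrangian p T f fy fa) (hp : 1 < p) (r : ℝ) {Q : ℝ}
    (hQ : 0 ≤ Q) :
    ∃ M, 0 ≤ M ∧ ∀ y ∈ Icc 0 r, ∀ a, ∀ s ∈ Icc 0 T, |fa y a s| ≤ Q → |a| ≤ M := by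
  obtain ⟨F, hF0, hF⟩ := exists_bound_of_continuousOn hf.continuousOn r 0
  obtain ⟨C₀, c₀, hC₀, hco⟩ := hf.coercive
  -- With this μ the linear term (Q + 1)|a|, coming from the tangent at a evaluated at 0, uses at
  -- most half of the coercive term.
  obtain ⟨c, hc0, hc⟩ := exists_le_mul_rpow_add hp (μ := C₀ / (2 * (Q + 1))) (by positivity)
  refine ⟨2 * (F + |c₀| + (Q + 1) * c) / C₀ + 1, by positivity, fun y hy a s hs ha => ?_⟩
  have h1 := hco y a s hy.1 hs
  have h2 := hf.tangent_le y a 0 s hy.1 hs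
  have h3 := (abs_le.1 (hF y hy 0 (by simp) s hs)).2
  have h4 : fa y a s * a ≤ (Q + 1) * |a| := by
    refine (le_abs_self _).trans ?_
    rw [abs_mul]
    exact mul_le_mul_of_nonneg_right (by linarith) (abs_nonneg a)
  have h5 : (Q + 1) * |a| ≤ C₀ / 2 * |a| ^ p + (Q + 1) * c := by
    calc (Q + 1) * |a| ≤ (Q + 1) * (C₀ / (2 * (Q + 1)) * |a| ^ p + c) := by
          gcongr; exact hc _ (abs_nonneg a)
      _ = _ := by field_simp
  have h6 := neg_abs_le c₀
  have h7 : |a| ^ p ≤ 2 * (F + |c₀| + (Q + 1) * c) / C₀ := by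
    rw [le_div_iff₀ hC₀]; linarith
  linarith [le_rpow_add_one hp (abs_nonneg a)]

theorem continuousOn_discreteCost (hf : IsLagrangian p T f fy fa) {n : ℕ} {d t₀ : ℝ}
    {S : Set (ℕ → ℝ)} (hS : ∀ w ∈ S, ∀ m < n, 0 ≤ w m) (ht : ∀ m < n, t₀ + m * d ∈ Icc 0 T) :
    ContinuousOn (discreteCost f n d t₀) S := by
  unfold discreteCost
  refine continuousOn_finsetSum _ fun m hm => continuousOn_const.mul ?_
  have hmn := Finset.mem_range.1 hm
  have hc : Continuous fun w : ℕ → ℝ => (w m, (w (m + 1) - w m) / d, t₀ + m * d) := by fun_prop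
  exact hf.continuousOn.comp (f := fun w : ℕ → ℝ => (w m, (w (m + 1) - w m) / d, t₀ + m * d))
    hc.continuousOn fun w hw => ⟨hS w hw m hmn, mem_univ _, ht m hmn⟩

/-- Bounds on the speed and on the displacement along nodes of bounded cost. -/
theorem exists_small_displacement (hf : IsLagrangian p T f fy fa) (hp : 1 < p) (E : ℝ) {η : ℝ}
    (hη : 0 < η) :
    ∃ E₁ h₀, 0 ≤ E₁ ∧ 0 < h₀ ∧ ∀ (n : ℕ) (d t₀ : ℝ) (w : ℕ → ℝ), 0 < d → n * d ≤ h₀ → 0 ≤ t₀ →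
      t₀ + n * d ≤ T → (∀ m < n, 0 ≤ w m) → discreteCost f n d t₀ w ≤ E →
      ∑ m ∈ Finset.range n, d * |(w (m + 1) - w m) / d| ^ p ≤ E₁ ∧ ∀ k ≤ n, |w k - w 0| ≤ η := by
  obtain ⟨C₀, c₀, hC₀, hco⟩ := hf.coercive
  set E₁ := (|E| + |c₀|) / C₀ with hE₁
  have hE₁0 : 0 ≤ E₁ := by positivity
  -- The total displacement is at most μ E₁ + n d c: the choice of μ bounds the first term by η/2,
  -- and a short duration bounds the second.
  obtain ⟨c, hc0, hc⟩ := exists_le_mul_rpow_add hp (μ := η / (2 * (E₁ + 1))) (by positivity)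
  refine ⟨E₁, min 1 (η / (2 * (c + 1))), hE₁0, by positivity,
    fun n d t₀ w hd hh ht₀ hT hw hE => ?_⟩
  have hh1 : n * d ≤ 1 := hh.trans (min_le_left _ _)
  have hh2 : n * d * (c + 1) ≤ η / 2 := by
    have := hh.trans (min_le_right _ _)
    rw [le_div_iff₀ (by positivity)] at this
    linarith
  have hnd : 0 ≤ n * d := by positivity
  have hsum : ∑ m ∈ Finset.range n, d * |(w (m + 1) - w m) / d| ^ p ≤ E₁ := by
    have h1 : ∑ m ∈ Finset.range n, d * (C₀ * |(w (m + 1) - w m) / d| ^ p + c₀)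
        ≤ discreteCost f n d t₀ w := by
      refine Finset.sum_le_sum fun m hm => ?_
      have hmn := Finset.mem_range.1 hm
      exact mul_le_mul_of_nonneg_left (hco _ _ _ (hw m hmn) (grid_mem hd.le ht₀ hT hmn.le)) hd.le
    have h2 : ∑ m ∈ Finset.range n, d * (C₀ * |(w (m + 1) - w m) / d| ^ p + c₀)
        = C₀ * ∑ m ∈ Finset.range n, d * |(w (m + 1) - w m) / d| ^ p + n * d * c₀ := by
      rw [Finset.mul_sum, Finset.sum_congr rfl fun m _ =>
        show d * (C₀ * |(w (m + 1) - w m) / d| ^ p + c₀)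
          = C₀ * (d * |(w (m + 1) - w m) / d| ^ p) + d * c₀ by ring, Finset.sum_add_distrib]
      simp [mul_assoc]
    rw [h2] at h1
    have h3 : -(n * d * c₀) ≤ |c₀| := by
      refine (neg_le_abs _).trans ?_
      rw [abs_mul, abs_of_nonneg hnd]
      exact mul_le_of_le_one_left (abs_nonneg _) hh1
    rw [hE₁, le_div_iff₀ hC₀]
    linarith [le_abs_self E]
  refine ⟨hsum, fun k hk => (abs_sub_le_sum_speed hd w k).trans ?_⟩
  calc ∑ m ∈ Finset.range k, d * |(w (m + 1) - w m) / d|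
      ≤ ∑ m ∈ Finset.range n, d * |(w (m + 1) - w m) / d| :=
        Finset.sum_le_sum_of_subset_of_nonneg (Finset.range_mono hk) fun _ _ _ => by positivity
    _ ≤ ∑ m ∈ Finset.range n,
          (η / (2 * (E₁ + 1)) * (d * |(w (m + 1) - w m) / d| ^ p) + d * c) := by
        refine Finset.sum_le_sum fun m _ => ?_
        have := mul_le_mul_of_nonneg_left (hc _ (abs_nonneg ((w (m + 1) - w m) / d))) hd.le
        linarith
    _ = η / (2 * (E₁ + 1)) * ∑ m ∈ Finset.range n, d * |(w (m + 1) - w m) / d| ^ p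
          + n * d * c := by
        rw [Finset.sum_add_distrib, ← Finset.mul_sum]
        simp [mul_assoc]
    _ ≤ η / (2 * (E₁ + 1)) * (E₁ + 1) + n * d * (c + 1) := by
        gcongr <;> linarith
    _ ≤ η / 2 + η / 2 := by
        gcongr
        apply le_of_eq; field_simp
    _ = η := by ring

/-- Nodes of bounded discrete cost can be replaced by nodes with the same end points, no larger
cost and speed bounded independently of the number of nodes. -/
theorem exists_bounded_speed (hf : IsLagrangian p T f fy fa) (hp : 1 < p) (E : ℝ) {a b : ℝ}
    (ha : 0 < a) (hab : a ≤ b) :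
    ∃ h₀, 0 < h₀ ∧ ∀ h, 0 < h → h ≤ h₀ → ∃ M, 0 ≤ M ∧ ∀ (n : ℕ) (t₀ : ℝ) (w : ℕ → ℝ), 0 < n →
      0 ≤ t₀ → t₀ + h ≤ T → w 0 ∈ Icc a b → (∀ k ≤ n, |w k - w 0| ≤ a / 4) →
      discreteCost f n (h / n) t₀ w ≤ E →
      ∃ w' : ℕ → ℝ, w' 0 = w 0 ∧ w' n = w n ∧ (∀ k ≤ n, |w' k - w 0| ≤ a / 4) ∧
        discreteCost f n (h / n) t₀ w' ≤ discreteCost f n (h / n) t₀ w ∧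
        ∀ k < n, |(w' (k + 1) - w' k) / (h / n)| ≤ M := by
  obtain ⟨E₁, h₀, hE₁, hh₀, hdisp⟩ := hf.exists_small_displacement hp E (η := a / 4) (by positivity)
  obtain ⟨c, hc0, hc⟩ := hf.growth (b + a) (by linarith)
  refine ⟨min h₀ 1, by positivity, fun h hh hhle => ?_⟩
  have hhle1 := hhle.trans (min_le_left _ _)
  -- The first term bounds the control derivative at one step of at most average energy, the second
  -- its variation along the nodes. The result depends on h but not on n.
  obtain ⟨M, hM0, hM⟩ := hf.exists_abs_le_of_abs_fa_le hp (b + a)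
    (Q := c * (E₁ / h + 2) + c * (E₁ + 1)) (by positivity)
  refine ⟨M, hM0, fun n t₀ w hn ht₀ hT hw0 hw hE => ?_⟩
  have hn' : (0 : ℝ) < n := by exact_mod_cast hn
  set d := h / n with hd
  have hd0 : 0 < d := by positivity
  have hnd : n * d = h := by rw [hd]; field_simp
  have hT' : t₀ + n * d ≤ T := by rwa [hnd]
  have ht : ∀ m < n, t₀ + m * d ∈ Icc 0 T := fun m hm => grid_mem hd0.le ht₀ hT' hm.le
  -- Both end points are pinned, as are the irrelevant indices beyond n, so that the product over ℕ
  -- is compact and a minimizer exists.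
  set I : ℕ → Set ℝ := fun k => if k = 0 ∨ n ≤ k then {w k} else Icc (w 0 - a / 2) (w 0 + a / 2)
    with hI
  have hIc : ∀ k, IsCompact (I k) := by
    intro k
    simp only [hI]
    split_ifs
    · exact isCompact_singleton
    · exact isCompact_Icc
  have hS : IsCompact (univ.pi I) := isCompact_univ_pi hIc
  have hwS : w ∈ univ.pi I := by
    intro k _
    simp only [hI]
    split_ifs with hk
    · rfl
    · have := abs_le.1 (hw k (by omega))
      constructor <;> linarith
  have hSpos : ∀ z ∈ univ.pi I, ∀ m < n, 0 ≤ z m := by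
    intro z hz m hm
    have := hz m (mem_univ m)
    simp only [hI] at this
    split_ifs at this with hk
    · rw [mem_singleton_iff] at this
      have h1 : m = 0 := by omega
      rw [this, h1]; linarith [hw0.1]
    · linarith [this.1, hw0.1]
  obtain ⟨w', hw'S, hmin⟩ := hS.exists_isMinOn ⟨w, hwS⟩ (hf.continuousOn_discreteCost hSpos ht)
  have hw'0 : w' 0 = w 0 := by simpa [hI] using hw'S 0 (mem_univ _)
  have hw'n : w' n = w n := by simpa [hI] using hw'S n (mem_univ _)
  have hle : discreteCost f n d t₀ w' ≤ discreteCost f n d t₀ w := hmin hwS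
  -- The minimizer also has cost at most E, so it stays within a/4 of its start while the box has
  -- radius a/2. The constraints are inactive and the Euler-Lagrange equation applies at every inner
  -- node.
  obtain ⟨hen, hdis⟩ := hdisp n d t₀ w' hd0 (by rwa [hnd]) ht₀ hT' (hSpos w' hw'S) (hle.trans hE)
  rw [hw'0] at hdis
  refine ⟨w', hw'0, hw'n, hdis, hle, ?_⟩
  have hrange : ∀ m ≤ n, 0 < w' m ∧ w' m ≤ b + a := by
    intro m hm
    have := abs_le.1 (hdis m hm)
    constructor <;> linarith [hw0.1, hw0.2]
  have hrange' : ∀ m < n, w' m ∈ Icc 0 (b + a) := fun m hm =>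
    ⟨(hrange m hm.le).1.le, (hrange m hm.le).2⟩
  set V : ℕ → ℝ := fun m => (w' (m + 1) - w' m) / d with hV
  have hfysum : ∑ m ∈ Finset.range n, d * |fy (w' m) (V m) (t₀ + m * d)| ≤ c * (E₁ + 1) := by
    calc ∑ m ∈ Finset.range n, d * |fy (w' m) (V m) (t₀ + m * d)|
        ≤ ∑ m ∈ Finset.range n, (c * (d * |V m| ^ p) + d * c) := by
          refine Finset.sum_le_sum fun m hm => ?_
          have hmn := Finset.mem_range.1 hm
          have := mul_le_mul_of_nonneg_left (hc _ (hrange' m hmn) (V m) _ (ht m hmn)).1 hd0.le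
          linarith
      _ = c * ∑ m ∈ Finset.range n, d * |V m| ^ p + h * c := by
          rw [Finset.sum_add_distrib, ← Finset.mul_sum, ← hnd]
          simp [mul_assoc]
      _ ≤ c * E₁ + 1 * c := by
          gcongr
          exact hhle.trans (min_le_right _ _)
      _ = c * (E₁ + 1) := by ring
  have hEL : ∀ j k, j < k → k < n →
      |fa (w' k) (V k) (t₀ + k * d) - fa (w' j) (V j) (t₀ + j * d)| ≤ c * (E₁ + 1) := by
    intro j k hjk hk
    rw [hf.discrete_euler_lagrange hd0 (fun m hm => (hrange m hm.le).1) ht hjk hk ?_]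
    · refine (Finset.abs_sum_le_sum_abs _ _).trans (le_trans ?_ hfysum)
      refine Finset.sum_le_sum fun m _ => ?_
      rw [abs_mul, abs_of_pos hd0, abs_mul]
      refine mul_le_mul_of_nonneg_left (mul_le_of_le_one_right (abs_nonneg _) ?_) hd0.le
      split_ifs <;> simp
    · filter_upwards [Metric.ball_mem_nhds (0 : ℝ) (by positivity : 0 < a / 4)] with x hx
      rw [mem_ball_zero_iff, Real.norm_eq_abs] at hx
      refine hmin fun m _ => ?_
      have hm' := hw'S m (mem_univ m)
      simp only [hI] at hm' ⊢
      by_cases hm : m = 0 ∨ n ≤ m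
      · rw [if_pos hm] at hm' ⊢
        rw [if_neg (by omega)]
        simpa using hm'
      · rw [if_neg hm]
        have h1 := abs_le.1 (hdis m (by omega))
        have h2 := abs_lt.1 hx
        split_ifs <;> constructor <;> linarith
  -- Some step has no more than the average energy; the Euler-Lagrange equation carries its bound to
  -- all the others.
  obtain ⟨j, hj, hjV⟩ : ∃ j ∈ Finset.range n, d * |V j| ^ p ≤ d * (E₁ / h) := by
    refine Finset.exists_le_of_sum_le (Finset.nonempty_range_iff.2 hn.ne') (hen.trans ?_)
    rw [Finset.sum_const, Finset.card_range, nsmul_eq_mul, ← mul_assoc, hnd]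
    apply le_of_eq; field_simp
  have hjn := Finset.mem_range.1 hj
  have hjV' : |V j| ^ p ≤ E₁ / h := le_of_mul_le_mul_left hjV hd0
  have hfaj : |fa (w' j) (V j) (t₀ + j * d)| ≤ c * (E₁ / h + 2) := by
    refine (hc _ (hrange' j hjn) (V j) _ (ht j hjn)).2.trans ?_
    have := rpow_sub_one_le hp (abs_nonneg (V j))
    exact mul_le_mul_of_nonneg_left (by linarith) hc0
  intro k hk
  refine hM _ (hrange' k hk) _ _ (ht k hk) ?_
  have hsplit : |fa (w' k) (V k) (t₀ + k * d)| ≤ |fa (w' j) (V j) (t₀ + j * d)|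
      + |fa (w' k) (V k) (t₀ + k * d) - fa (w' j) (V j) (t₀ + j * d)| := by
    have := abs_add_le (fa (w' j) (V j) (t₀ + j * d))
      (fa (w' k) (V k) (t₀ + k * d) - fa (w' j) (V j) (t₀ + j * d))
    rwa [add_sub_cancel] at this
  refine hsplit.trans (add_le_add hfaj ?_)
  rcases lt_trichotomy j k with hjk | rfl | hjk
  · exact hEL j k hjk hk
  · rw [sub_self, abs_zero]; positivity
  · rw [abs_sub_comm]; exact hEL k j hjk hjn

end IsLagrangian

/-! ### Costs along curves and their sampling. -/

namespace IsLagrangian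

variable {p T : ℝ} {f fy fa : ℝ → ℝ → ℝ → ℝ}

/-- Integrability of the running cost along a curve. -/
theorem intervalIntegrable_comp (hf : IsLagrangian p T f fy fa) (hp : 1 < p) {s t r : ℝ}
    (hst : s ≤ t) (hs : 0 ≤ s) (ht : t ≤ T) {ρ v : ℝ → ℝ} (hρc : ContinuousOn ρ (Icc s t))
    (hρ : ∀ τ ∈ Icc s t, ρ τ ∈ Icc 0 r) (hv : AEStronglyMeasurable v (volume.restrict (Ioc s t)))
    (hvp : IntervalIntegrable (fun τ => |v τ| ^ p) volume s t) :
    IntervalIntegrable (fun τ => f (ρ τ) (v τ) τ) volume s t := by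
  have hr : 0 < max r 1 := by positivity
  obtain ⟨C, hC0, hC⟩ := hf.exists_le_growth hp hr
  -- Clamping state and time gives a continuous function on the whole space, hence measurability of
  -- the composition; on the curve the clamps do nothing.
  have hcont : Continuous fun q : ℝ × ℝ × ℝ => f (max q.1 0) q.2.1 (max 0 (min q.2.2 T)) := by
    rw [← continuousOn_univ]
    refine hf.continuousOn.comp
      (f := fun q : ℝ × ℝ × ℝ => (max q.1 0, q.2.1, max 0 (min q.2.2 T)))
      (by fun_prop) fun q _ => ⟨mem_Ici.2 (le_max_right _ _), mem_univ _, le_max_left _ _, ?_⟩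
    exact max_le (hs.trans (hst.trans ht)) (min_le_right _ _)
  have hρm : AEStronglyMeasurable ρ (volume.restrict (Ioc s t)) :=
    (hρc.mono Ioc_subset_Icc_self).aestronglyMeasurable measurableSet_Ioc
  have hm := hcont.comp_aestronglyMeasurable (hρm.prodMk (hv.prodMk aestronglyMeasurable_id))
  rw [intervalIntegrable_iff_integrableOn_Ioc_of_le hst] at hvp ⊢
  have hdom : IntegrableOn (fun τ => C * (|v τ| ^ p + 1)) (Ioc s t) :=
    (hvp.add (integrableOn_const (by simp))).const_mul C
  refine Integrable.mono' hdom (hm.congr ?_) ?_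
  · filter_upwards [ae_restrict_mem measurableSet_Ioc] with τ hτ
    simp only [id]
    rw [max_eq_left (hρ τ (Ioc_subset_Icc_self hτ)).1, min_eq_left (hτ.2.trans ht),
      max_eq_right (hs.trans hτ.1.le)]
  · filter_upwards [ae_restrict_mem measurableSet_Ioc] with τ hτ
    have := hρ τ (Ioc_subset_Icc_self hτ)
    exact hC _ ⟨this.1, this.2.trans (le_max_left _ _)⟩ _ _ ⟨hs.trans hτ.1.le, hτ.2.trans ht⟩

/-- By Jensen's inequality, sampling a curve on a fine grid does not increase the cost by much. -/
theorem exists_discreteCost_le (hf : IsLagrangian p T f fy fa) (hp : 1 < p) {t₀ h r : ℝ}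
    (hr : 0 < r) (ht₀ : 0 ≤ t₀) (hh : 0 < h) (hT : t₀ + h ≤ T) {ρ v : ℝ → ℝ}
    (hρc : ContinuousOn ρ (Icc t₀ (t₀ + h))) (hρ : ∀ s ∈ Icc t₀ (t₀ + h), ρ s ∈ Ioc 0 r)
    (hv : IntervalIntegrable v volume t₀ (t₀ + h))
    (hvp : IntervalIntegrable (fun τ => |v τ| ^ p) volume t₀ (t₀ + h))
    (hprim : ∀ s ∈ Icc t₀ (t₀ + h), ρ s = ρ t₀ + ∫ τ in t₀..s, v τ) {η : ℝ} (hη : 0 < η) :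
    ∃ n₀ : ℕ, ∀ n ≥ n₀, 0 < n →
      discreteCost f n (h / n) t₀ (fun k => ρ (t₀ + k * (h / n)))
        ≤ (∫ τ in t₀..(t₀ + h), f (ρ τ) (v τ) τ) + η := by
  set B := ∫ τ in t₀..(t₀ + h), (1 + |v τ| ^ p) with hB
  have hBi : IntervalIntegrable (fun τ => 1 + |v τ| ^ p) volume t₀ (t₀ + h) :=
    intervalIntegrable_const.add hvp
  have hB0 : 0 ≤ B := intervalIntegral.integral_nonneg (by linarith) fun τ _ => by positivity
  -- Each cell contributes an error ε ∫ (1 + |v|^p), half from freezing the time and half from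
  -- freezing the state; the total is at most ε B ≤ η.
  set ε := η / (B + 1) with hε
  have hε0 : 0 < ε := by positivity
  obtain ⟨w, hw, hfw⟩ := hf.time_modulus r hr
  obtain ⟨c, hc0, hc⟩ := hf.growth r hr
  obtain ⟨δ₁, hδ₁, hw1⟩ : ∃ δ > 0, ∀ x, 0 ≤ x → x < δ → w x < ε / 2 := by
    have := hw.tendsto.eventually (gt_mem_nhds (half_pos hε0))
    obtain ⟨δ, hδ, h⟩ := Metric.mem_nhdsWithin_iff.1 this
    refine ⟨δ, hδ, fun x hx hxδ => h ⟨?_, hx⟩⟩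
    rwa [mem_ball_zero_iff, Real.norm_eq_abs, abs_of_nonneg hx]
  obtain ⟨δ₂, hδ₂, hρu⟩ := Metric.uniformContinuousOn_iff.1
    (isCompact_Icc.uniformContinuousOn_of_continuous hρc) (ε / (2 * (c + 1))) (by positivity)
  obtain ⟨n₀, hn₀⟩ := exists_nat_gt (h / min δ₁ δ₂)
  refine ⟨n₀, fun n hn hn0 => ?_⟩
  have hn' : (0 : ℝ) < n := by exact_mod_cast hn0
  set d := h / n with hd
  have hd0 : 0 < d := by positivity
  have hdδ : d < min δ₁ δ₂ := by
    have h1 : h / min δ₁ δ₂ < n := hn₀.trans_le (by exact_mod_cast hn)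
    rw [div_lt_iff₀ (by positivity)] at h1
    rw [hd, div_lt_iff₀ hn']; linarith
  have hnd : n * d = h := by rw [hd]; field_simp
  have hfi : IntervalIntegrable (fun τ => f (ρ τ) (v τ) τ) volume t₀ (t₀ + h) :=
    hf.intervalIntegrable_comp hp (by linarith) ht₀ hT hρc (fun τ hτ => Ioc_subset_Icc_self (hρ τ hτ))
      hv.1.aestronglyMeasurable hvp
  set s : ℕ → ℝ := fun k => t₀ + k * d with hsdef
  have hs0 : s 0 = t₀ := by simp [hsdef]
  have hsn : s n = t₀ + h := by simp [hsdef, hnd]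
  have hsm : ∀ k ≤ n, s k ∈ Icc t₀ (t₀ + h) := by
    intro k hk
    have : (k : ℝ) * d ≤ n * d := by gcongr
    exact ⟨by simp only [hsdef]; nlinarith [Nat.cast_nonneg (α := ℝ) k],
      by simp only [hsdef]; linarith⟩
  have hstep : ∀ k, s (k + 1) = s k + d := by intro k; simp only [hsdef]; push_cast; ring
  have hsub : ∀ k < n, uIcc (s k) (s (k + 1)) ⊆ uIcc t₀ (t₀ + h) := by
    intro k hk
    rw [uIcc_of_le (by rw [hstep]; linarith), uIcc_of_le (by linarith)]
    exact Icc_subset_Icc (hsm k hk.le).1 (hsm (k + 1) hk).2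
  have hcell : ∀ k < n, d * f (ρ (s k)) ((ρ (s (k + 1)) - ρ (s k)) / d) (s k)
      ≤ ∫ τ in s k..s (k + 1), (f (ρ τ) (v τ) τ + ε * (1 + |v τ| ^ p)) := by
    intro k hk
    have hsk := hsm k hk.le
    have hsk1 := hsm (k + 1) hk
    have hvk : IntervalIntegrable v volume (s k) (s (k + 1)) := hv.mono_set (hsub k hk)
    set V := (ρ (s (k + 1)) - ρ (s k)) / d with hV
    have hVint : ∫ τ in s k..s (k + 1), v τ = d * V := by
      rw [hV, mul_div_cancel₀ _ hd0.ne', hprim _ hsk, hprim _ hsk1, add_sub_add_left_eq_sub]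
      refine (intervalIntegral.integral_interval_sub_left ?_ ?_).symm
      · exact hv.mono_set (by
          rw [uIcc_of_le hsk1.1, uIcc_of_le (by linarith)]; exact Icc_subset_Icc le_rfl hsk1.2)
      · exact hv.mono_set (by
          rw [uIcc_of_le hsk.1, uIcc_of_le (by linarith)]; exact Icc_subset_Icc le_rfl hsk.2)
    -- Jensen's inequality through the tangent at V: since V is the mean of v on the cell, the
    -- linear term has integral zero.
    have hlin : d * f (ρ (s k)) V (s k) = ∫ τ in s k..s (k + 1),
        (f (ρ (s k)) V (s k) + fa (ρ (s k)) V (s k) * (v τ - V)) := by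
      rw [intervalIntegral.integral_add intervalIntegrable_const
        ((hvk.sub intervalIntegrable_const).const_mul _), intervalIntegral.integral_const_mul,
        intervalIntegral.integral_sub hvk intervalIntegrable_const, hVint,
        intervalIntegral.integral_const, intervalIntegral.integral_const, hstep]
      simp
    rw [hlin]
    refine intervalIntegral.integral_mono_on (by rw [hstep]; linarith)
      (intervalIntegrable_const.add ((hvk.sub intervalIntegrable_const).const_mul _))
      ((hfi.mono_set (hsub k hk)).add ((hBi.mono_set (hsub k hk)).const_mul ε)) fun τ hτ => ?_
    have hτ' : τ ∈ Icc t₀ (t₀ + h) := ⟨hsk.1.trans hτ.1, hτ.2.trans hsk1.2⟩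
    have hIcc : ∀ x ∈ Icc t₀ (t₀ + h), x ∈ Icc 0 T := fun x hx =>
      ⟨ht₀.trans hx.1, hx.2.trans hT⟩
    have hdist : |s k - τ| ≤ d := by
      rw [abs_sub_comm, abs_of_nonneg (by linarith [hτ.1])]
      linarith [hτ.2, hstep k]
    have hap : 0 ≤ |v τ| ^ p := by positivity
    have e1 := hf.tangent_le (ρ (s k)) V (v τ) (s k) (hρ _ hsk).1.le (hIcc _ hsk)
    have e2 := (abs_le.1 (hfw (ρ (s k)) (Ioc_subset_Icc_self (hρ _ hsk)) (v τ) (s k) (hIcc _ hsk)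
      τ (hIcc _ hτ'))).2
    have e3 := (abs_le.1 (hf.abs_sub_le_of_growth hc (a := v τ) (hρ τ hτ') (hρ _ hsk)
      (hIcc _ hτ'))).2
    have e4 : (1 + |v τ| ^ p) * w |s k - τ| ≤ (1 + |v τ| ^ p) * (ε / 2) := by
      gcongr
      exact (hw1 _ (abs_nonneg _) (hdist.trans_lt (hdδ.trans_le (min_le_left _ _)))).le
    have e5 : c * |ρ (s k) - ρ τ| ≤ ε / 2 := by
      have := (hρu (s k) hsk τ hτ' (hdist.trans_lt (hdδ.trans_le (min_le_right _ _)))).le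
      rw [Real.dist_eq, le_div_iff₀ (by positivity)] at this
      linarith [abs_nonneg (ρ (s k) - ρ τ)]
    have e6 : c * (|v τ| ^ p + 1) * |ρ (s k) - ρ τ| ≤ (1 + |v τ| ^ p) * (ε / 2) := by
      calc c * (|v τ| ^ p + 1) * |ρ (s k) - ρ τ|
          = (1 + |v τ| ^ p) * (c * |ρ (s k) - ρ τ|) := by ring
        _ ≤ _ := by gcongr
    linarith
  have hsum : discreteCost f n d t₀ (fun k => ρ (t₀ + k * d))
      ≤ ∑ k ∈ Finset.range n, ∫ τ in s k..s (k + 1), (f (ρ τ) (v τ) τ + ε * (1 + |v τ| ^ p)) :=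
    Finset.sum_le_sum fun k hk => hcell k (Finset.mem_range.1 hk)
  rw [intervalIntegral.sum_integral_adjacent_intervals (fun k hk =>
    (hfi.add (hBi.const_mul ε)).mono_set (hsub k hk)), hs0, hsn,
    intervalIntegral.integral_add hfi (hBi.const_mul ε), intervalIntegral.integral_const_mul] at hsum
  refine hsum.trans ?_
  have : ε * B ≤ η := by
    rw [hε, div_mul_eq_mul_div, div_le_iff₀ (by positivity)]
    nlinarith
  linarith

end IsLagrangian

/-! ### First order upper bounds for the value function -/

theorem discreteCost_add (f : ℝ → ℝ → ℝ → ℝ) (m q : ℕ) (d t₀ : ℝ) (w : ℕ → ℝ) :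
    discreteCost f (m + q) d t₀ w
      = discreteCost f m d t₀ w + discreteCost f q d (t₀ + m * d) fun k => w (m + k) := by
  unfold discreteCost
  rw [Finset.sum_range_add]
  congr 1
  refine Finset.sum_congr rfl fun k _ => ?_
  rw [add_assoc m k 1]
  push_cast
  rw [show t₀ + (m + k) * d = t₀ + m * d + k * d by ring]

/-- The value function `W` on an edge is not improved by starting along a straight line. -/
def HasDynamicProgramming (T : ℝ) (f : ℝ → ℝ → ℝ → ℝ) (W : ℝ → ℝ → ℝ) : Prop :=
  ∀ r r' t t', 0 < r → 0 < r' → 0 ≤ t → t < t' → t' < T →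
    W r t ≤ (∫ τ in t..t', f (r + (τ - t) * ((r' - r) / (t' - t))) ((r' - r) / (t' - t)) τ)
      + W r' t'

/-- Nearly optimal curves for `W` on `[t₀, t₀ + h]`, staying close to their starting point `r₀`. -/
structure IsNearlyOptimal (p : ℝ) (f : ℝ → ℝ → ℝ → ℝ) (W : ℝ → ℝ → ℝ) (a E h r₀ t₀ η : ℝ)
    (ρ v : ℝ → ℝ) : Prop where
  continuousOn : ContinuousOn ρ (Icc t₀ (t₀ + h))
  intervalIntegrable : IntervalIntegrable v volume t₀ (t₀ + h)
  intervalIntegrable_rpow : IntervalIntegrable (fun τ => |v τ| ^ p) volume t₀ (t₀ + h)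
  eq_primitive : ∀ s ∈ Icc t₀ (t₀ + h), ρ s = r₀ + ∫ τ in t₀..s, v τ
  abs_sub_le : ∀ s ∈ Icc t₀ (t₀ + h), |ρ s - r₀| ≤ a / 4
  cost_le : ∫ τ in t₀..(t₀ + h), f (ρ τ) (v τ) τ ≤ E
  cost_add_le : (∫ τ in t₀..(t₀ + h), f (ρ τ) (v τ) τ) + W (ρ (t₀ + h)) (t₀ + h) ≤ W r₀ t₀ + η

/-- The slope in the state of the cost of nodes whose first `m` steps, of total length `h`, are
deformed linearly. -/
noncomputable def stateSlope (fy fa : ℝ → ℝ → ℝ → ℝ) (m : ℕ) (d h t₀ : ℝ) (w : ℕ → ℝ) : ℝ :=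
  ∑ k ∈ Finset.range m, d * (fy (w k) ((w (k + 1) - w k) / d) (t₀ + k * d) * (1 - k / m)
    - fa (w k) ((w (k + 1) - w k) / d) (t₀ + k * d) / h)

/-- The slope in the initial time of the cost of nodes whose first `m` steps, of total length `h`,
are deformed linearly. -/
noncomputable def timeSlope (f fa : ℝ → ℝ → ℝ → ℝ) (m : ℕ) (d h t₀ : ℝ) (w : ℕ → ℝ) : ℝ :=
  ∑ k ∈ Finset.range m, d * ((-f (w k) ((w (k + 1) - w k) / d) (t₀ + k * d)
    + fa (w k) ((w (k + 1) - w k) / d) (t₀ + k * d) * ((w (k + 1) - w k) / d)) / h)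

theorem abs_sum_mul_le {m : ℕ} {d h C : ℝ} (hd : 0 < d) (hmd : m * d = h) {Q : ℕ → ℝ}
    (hQ : ∀ k < m, |Q k| ≤ C) : |∑ k ∈ Finset.range m, d * Q k| ≤ h * C := by
  refine (Finset.abs_sum_le_sum_abs _ _).trans ?_
  calc ∑ k ∈ Finset.range m, |d * Q k| ≤ ∑ k ∈ Finset.range m, d * C := by
        refine Finset.sum_le_sum fun k hk => ?_
        rw [abs_mul, abs_of_pos hd]
        exact mul_le_mul_of_nonneg_left (hQ k (Finset.mem_range.1 hk)) hd.le
    _ = h * C := by rw [Finset.sum_const, Finset.card_range, nsmul_eq_mul, ← hmd]; ring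

theorem one_sub_div_mem {m k : ℕ} (hm : 0 < m) (hk : k ≤ m) :
    0 ≤ 1 - (k : ℝ) / m ∧ 1 - (k : ℝ) / m ≤ 1 := by
  have hm' : (0 : ℝ) < m := by exact_mod_cast hm
  have h1 : (k : ℝ) / m ≤ 1 := by
    rw [div_le_one hm']; exact_mod_cast hk
  have h2 : 0 ≤ (k : ℝ) / m := by positivity
  constructor <;> linarith

theorem abs_stateSlope_le {fy fa : ℝ → ℝ → ℝ → ℝ} {m : ℕ} {d h t₀ Cy Ca : ℝ} {w : ℕ → ℝ}
    (hd : 0 < d) (hh : 0 < h) (hm : 0 < m) (hmd : m * d = h)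
    (hy : ∀ k < m, |fy (w k) ((w (k + 1) - w k) / d) (t₀ + k * d)| ≤ Cy)
    (ha : ∀ k < m, |fa (w k) ((w (k + 1) - w k) / d) (t₀ + k * d)| ≤ Ca) :
    |stateSlope fy fa m d h t₀ w| ≤ h * Cy + Ca := by
  refine (abs_sum_mul_le (C := Cy + Ca / h) hd hmd fun k hk => ?_).trans (by
    apply le_of_eq; field_simp)
  have hfrac := one_sub_div_mem hm hk.le
  refine (abs_sub _ _).trans (add_le_add ?_ ?_)
  · rw [abs_mul, abs_of_nonneg hfrac.1]
    exact (mul_le_of_le_one_right (abs_nonneg _) hfrac.2).trans (hy k hk)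
  · rw [abs_div, abs_of_pos hh]
    exact div_le_div_of_nonneg_right (ha k hk) hh.le

theorem abs_timeSlope_le {f fa : ℝ → ℝ → ℝ → ℝ} {m : ℕ} {d h t₀ Cf Ca M : ℝ} {w : ℕ → ℝ}
    (hd : 0 < d) (hh : 0 < h) (hCa : 0 ≤ Ca) (hmd : m * d = h)
    (hf : ∀ k < m, |f (w k) ((w (k + 1) - w k) / d) (t₀ + k * d)| ≤ Cf)
    (ha : ∀ k < m, |fa (w k) ((w (k + 1) - w k) / d) (t₀ + k * d)| ≤ Ca)
    (hV : ∀ k < m, |(w (k + 1) - w k) / d| ≤ M) :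
    |timeSlope f fa m d h t₀ w| ≤ Cf + Ca * M := by
  refine (abs_sum_mul_le (C := (Cf + Ca * M) / h) hd hmd fun k hk => ?_).trans (by
    apply le_of_eq; field_simp)
  rw [abs_div, abs_of_pos hh]
  refine div_le_div_of_nonneg_right ((abs_add_le _ _).trans (add_le_add ?_ ?_)) hh.le
  · rw [abs_neg]; exact hf k hk
  · rw [abs_mul]; exact mul_le_mul (ha k hk) (hV k hk) (abs_nonneg _) hCa

/-- The speed of linearly deformed nodes. -/
theorem deformed_speed {m : ℕ} {d h τ x : ℝ} (w : ℕ → ℝ) (hd : 0 < d) (hm : 0 < m)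
    (hmd : m * d = h) (k : ℕ) :
    (w (k + 1) + x * (1 - (k + 1 : ℕ) / m) - (w k + x * (1 - k / m))) / (d * (1 - τ))
      = ((w (k + 1) - w k) / d - x / h) / (1 - τ) := by
  have hm' : (0 : ℝ) < m := by exact_mod_cast hm
  have : w (k + 1) + x * (1 - (k + 1 : ℕ) / m) - (w k + x * (1 - k / m))
      = d * ((w (k + 1) - w k) / d - x / h) := by
    rw [← hmd]; push_cast; field_simp; ring
  rw [this, mul_div_mul_left _ _ hd.ne']

theorem abs_deformed_speed_le {V M τ β : ℝ} (hV : |V| ≤ M) (hτ : |τ| ≤ 1 / 2) (hβ : |β| ≤ 1 / 2) :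
    |(V - β) / (1 - τ)| ≤ 2 * (M + 1) := by
  obtain ⟨hτl, hτu⟩ := abs_le.1 hτ
  have hpos : 0 < 1 - τ := by linarith
  rw [abs_div, abs_of_pos hpos, div_le_iff₀ hpos]
  have h1 := abs_sub V β
  have h2 := abs_nonneg V
  nlinarith

/-- The effect of a linear deformation of the nodes on the discrete cost. -/
theorem discreteCost_deformed_le {f fy fa : ℝ → ℝ → ℝ → ℝ} {T y₀ y₁ M R K ε δ : ℝ}
    (hy₀ : 0 ≤ y₀) (hy₁ : y₁ ≤ R) (hMR : 2 * (M + 1) ≤ R) (hK0 : 0 ≤ K) (hε : 0 ≤ ε)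
    (hpersp : ∀ y ∈ Icc y₀ y₁, ∀ d, y + d ∈ Icc y₀ y₁ → ∀ a ∈ Icc (-M) M, ∀ τ b,
      ∀ s ∈ Icc 0 T, |τ| ≤ δ → |b| ≤ δ → |d| ≤ δ →
      (1 - τ) * f (y + d) ((a - b) / (1 - τ)) s ≤ f y a s - f y a s * τ + fy y a s * d
        + fa y a s * (τ * a - b) + ε * (|τ| + |b| + |d|))
    (hK : ∀ y ∈ Icc 0 R, ∀ a ∈ Icc (-R) R, ∀ t₁ ∈ Icc 0 T, ∀ t₂ ∈ Icc 0 T,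
      |f y a t₁ - f y a t₂| ≤ K * |t₁ - t₂|)
    {m : ℕ} {d h t₀ t x : ℝ} {w : ℕ → ℝ} (hm : 0 < m) (hd : 0 < d) (hh : 0 < h)
    (hmd : m * d = h) (ht₀ : 0 ≤ t₀) (ht : 0 ≤ t) (hT : t₀ + h ≤ T)
    (hw : ∀ k < m, w k ∈ Icc y₀ y₁) (hz : ∀ k < m, w k + x * (1 - k / m) ∈ Icc y₀ y₁)
    (hV : ∀ k < m, |(w (k + 1) - w k) / d| ≤ M)
    (hτδ : |(t - t₀) / h| ≤ δ) (hτ2 : |(t - t₀) / h| ≤ 1 / 2) (hβδ : |x / h| ≤ δ)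
    (hβ2 : |x / h| ≤ 1 / 2) (hx : |x| ≤ δ) :
    discreteCost f m (d * (1 - (t - t₀) / h)) t (fun k => w k + x * (1 - k / m))
      ≤ discreteCost f m d t₀ w + stateSlope fy fa m d h t₀ w * x
        + timeSlope f fa m d h t₀ w * (t - t₀)
        + h * (ε * (|(t - t₀) / h| + |x / h| + |x|) + 2 * K * |t - t₀|) := by
  have hm' : (0 : ℝ) < m := by exact_mod_cast hm
  set τ := (t - t₀) / h with hτ
  obtain ⟨hτl, hτu⟩ := abs_le.1 hτ2
  have hpos : 0 < 1 - τ := by linarith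
  have hτh : t - t₀ = h * τ := by rw [hτ]; field_simp
  have hmd' : m * (d * (1 - τ)) = h - (t - t₀) := by
    rw [← mul_assoc, hmd, hτh]; ring
  have hcell : ∀ k ∈ Finset.range m,
      d * (1 - τ) * f (w k + x * (1 - k / m))
        ((w (k + 1) + x * (1 - (k + 1 : ℕ) / m) - (w k + x * (1 - k / m))) / (d * (1 - τ)))
        (t + k * (d * (1 - τ)))
      ≤ d * f (w k) ((w (k + 1) - w k) / d) (t₀ + k * d)
        + d * (fy (w k) ((w (k + 1) - w k) / d) (t₀ + k * d) * (1 - k / m)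
          - fa (w k) ((w (k + 1) - w k) / d) (t₀ + k * d) / h) * x
        + d * ((-f (w k) ((w (k + 1) - w k) / d) (t₀ + k * d)
          + fa (w k) ((w (k + 1) - w k) / d) (t₀ + k * d) * ((w (k + 1) - w k) / d)) / h) * (t - t₀)
        + d * (ε * (|τ| + |x / h| + |x|) + 2 * K * |t - t₀|) := by
    intro k hk
    have hkm := Finset.mem_range.1 hk
    have hfrac := one_sub_div_mem hm hkm.le
    rw [deformed_speed w hd hm hmd]
    have hVk := hV k hkm
    have hVk' := abs_le.1 (abs_deformed_speed_le hVk hτ2 hβ2)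
    have hzk := hz k hkm
    have hwk := hw k hkm
    have htk : t + k * (d * (1 - τ)) ∈ Icc 0 T :=
      grid_mem (n := m) (by positivity) ht (by rw [hmd']; linarith) hkm.le
    have hsk : t₀ + k * d ∈ Icc 0 T := grid_mem hd.le ht₀ (by rwa [hmd]) hkm.le
    -- The time shift, like the spatial one, decreases linearly to zero at k = m, so the deformed
    -- grid also ends at t₀ + h.
    have hdt : t + k * (d * (1 - τ)) - (t₀ + k * d) = (t - t₀) * (1 - k / m) := by
      have h1 : (k : ℝ) / m = k * d / h := by rw [← hmd]; field_simp
      have h2 : (t - t₀) * (k * d / h) = k * d * τ := by rw [hτ]; ring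
      rw [h1]; linear_combination h2
    have hdt' : |t + k * (d * (1 - τ)) - (t₀ + k * d)| ≤ |t - t₀| := by
      rw [hdt, abs_mul, abs_of_nonneg hfrac.1]
      exact mul_le_of_le_one_right (abs_nonneg _) hfrac.2
    have hd1 : |x * (1 - k / m)| ≤ |x| := by
      rw [abs_mul, abs_of_nonneg hfrac.1]
      exact mul_le_of_le_one_right (abs_nonneg _) hfrac.2
    have e2 := hpersp (w k) hwk (x * (1 - k / m)) hzk _ (abs_le.1 hVk) τ (x / h) (t₀ + k * d) hsk
      hτδ hβδ (hd1.trans hx)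
    have e1 := (abs_le.1 (hK _ ⟨hy₀.trans hzk.1, hzk.2.trans hy₁⟩ _
      ⟨(neg_le_neg hMR).trans hVk'.1, hVk'.2.trans hMR⟩ _ htk _ hsk)).2
    clear_value τ
    generalize (w (k + 1) - w k) / d = V at *
    generalize w k + x * (1 - k / m) = zk at *
    generalize t + k * (d * (1 - τ)) = s' at *
    generalize t₀ + k * d = s at *
    generalize f zk ((V - x / h) / (1 - τ)) s' = F' at *
    generalize f zk ((V - x / h) / (1 - τ)) s = F at *
    generalize fa (w k) V s = A at *
    generalize fy (w k) V s = Y at *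
    generalize f (w k) V s = F₀ at *
    -- The Lipschitz bound in time restores the original time of the node; the factor 2 bounds 1 -
    -- τ.
    have e3 : (1 - τ) * F' ≤ (1 - τ) * F + 2 * K * |t - t₀| := by
      have h1 : K * |s' - s| ≤ K * |t - t₀| := mul_le_mul_of_nonneg_left hdt' hK0
      have h2 : 0 ≤ K * |t - t₀| := by positivity
      have h3 : (1 - τ) * (F' - F) ≤ (1 - τ) * (K * |t - t₀|) :=
        mul_le_mul_of_nonneg_left (e1.trans h1) hpos.le
      nlinarith
    have e4 : ε * (|τ| + |x / h| + |x * (1 - k / m)|) ≤ ε * (|τ| + |x / h| + |x|) :=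
      mul_le_mul_of_nonneg_left (by linarith) hε
    have e6 : F₀ - F₀ * τ + Y * (x * (1 - k / m)) + A * (τ * V - x / h)
        = F₀ + (Y * (1 - k / m) - A / h) * x + (-F₀ + A * V) / h * (t - t₀) := by
      rw [hτh]; field_simp; ring
    rw [e6] at e2
    have e5 : (1 - τ) * F' ≤ F₀ + (Y * (1 - k / m) - A / h) * x + (-F₀ + A * V) / h * (t - t₀)
        + (ε * (|τ| + |x / h| + |x|) + 2 * K * |t - t₀|) := by linarith
    calc d * (1 - τ) * F' = d * ((1 - τ) * F') := by ring
      _ ≤ _ := mul_le_mul_of_nonneg_left e5 hd.le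
      _ = _ := by ring
  refine (Finset.sum_le_sum hcell).trans (le_of_eq ?_)
  rw [Finset.sum_add_distrib, Finset.sum_add_distrib, Finset.sum_add_distrib, ← Finset.sum_mul,
    ← Finset.sum_mul, Finset.sum_const, Finset.card_range, nsmul_eq_mul, ← mul_assoc, hmd]
  rfl

/-- The prefactor h cancels the 1/h in the relative shifts and makes the Lipschitz error in time
small. The expansion tolerance ε / (2(1 + h)) uses one half of ε, the time error the other. -/
theorem deformation_error_le {h K ε dt x : ℝ} (hh : 0 < h) (hε : 0 ≤ ε)
    (hhK : h * (2 * K) ≤ ε / 2) :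
    h * (ε / (2 * (1 + h)) * (|dt / h| + |x / h| + |x|) + 2 * K * |dt|) ≤ ε * (|x| + |dt|) := by
  have hx := abs_nonneg x
  have hdt := abs_nonneg dt
  rw [abs_div, abs_div, abs_of_pos hh]
  have e1 : h * (|dt| / h + |x| / h + |x|) ≤ (1 + h) * (|x| + |dt|) := by
    have : h * (|dt| / h + |x| / h + |x|) = |dt| + |x| + h * |x| := by field_simp
    rw [this]
    nlinarith [mul_nonneg hh.le hdt]
  have e2 : ε / (2 * (1 + h)) * (h * (|dt| / h + |x| / h + |x|)) ≤ ε / 2 * (|x| + |dt|) := by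
    calc ε / (2 * (1 + h)) * (h * (|dt| / h + |x| / h + |x|))
        ≤ ε / (2 * (1 + h)) * ((1 + h) * (|x| + |dt|)) := by gcongr
      _ = _ := by field_simp
  have e3 : h * (2 * K) * |dt| ≤ ε / 2 * |dt| := by gcongr
  have e4 : 0 ≤ ε / 2 * |x| := by positivity
  linarith

/-! ### Polygonal lines and construction of the supergradients. -/

namespace IsLagrangian

variable {p T : ℝ} {f fy fa : ℝ → ℝ → ℝ → ℝ} {W : ℝ → ℝ → ℝ}

/-- Dynamic programming along the polygonal line through given nodes. -/
theorem exists_le_discreteCost_add (hf : IsLagrangian p T f fy fa)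
    (hW : HasDynamicProgramming T f W) (y₁ M : ℝ) {ε : ℝ} (hε : 0 < ε) :
    ∃ δ, 0 < δ ∧ ∀ (n : ℕ) (d t₀ : ℝ) (w : ℕ → ℝ), 0 < d → d ≤ δ → 0 ≤ t₀ → t₀ + n * d < T →
      (∀ k ≤ n, w k ∈ Ioc 0 y₁) → (∀ k < n, |(w (k + 1) - w k) / d| ≤ M) →
      W (w 0) t₀ ≤ discreteCost f n d t₀ w + n * d * ε + W (w n) (t₀ + n * d) := by
  obtain ⟨δ', hδ', hu⟩ := exists_uniform_of_continuousOn hf.continuousOn y₁ M hε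
  -- With this step, neither the time nor the state moves by more than δ' along one segment, so
  -- freezing the integrand at the left node costs at most ε per unit time.
  refine ⟨δ' / (|M| + 1), by positivity, fun n d t₀ w hd hdδ ht₀ hT hw hV => ?_⟩
  rw [le_div_iff₀ (by positivity)] at hdδ
  have hM0 := abs_nonneg M
  have key : ∀ k ≤ n, W (w 0) t₀ ≤ discreteCost f k d t₀ w + k * d * ε + W (w k) (t₀ + k * d) := by
    intro k
    induction k with
    | zero => intro _; simp [discreteCost]
    | succ k ih =>
      intro hk
      refine (ih (by omega)).trans ?_
      have ht : t₀ + k * d ∈ Icc 0 T := grid_mem hd.le ht₀ hT.le (by omega)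
      have ht' : t₀ + (k + 1 : ℕ) * d ∈ Icc 0 T := grid_mem hd.le ht₀ hT.le hk
      have htT : t₀ + (k + 1 : ℕ) * d < T := by
        have : ((k + 1 : ℕ) : ℝ) * d ≤ n * d := by gcongr
        linarith
      have hstep : t₀ + (k + 1 : ℕ) * d - (t₀ + k * d) = d := by push_cast; ring
      have hdp := hW (w k) (w (k + 1)) (t₀ + k * d) (t₀ + (k + 1 : ℕ) * d) (hw k (by omega)).1
        (hw (k + 1) hk).1 ht.1 (by linarith) htT
      rw [hstep] at hdp
      have hVk := hV k (by omega)
      set V := (w (k + 1) - w k) / d with hVdef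
      have hline : ∀ τ ∈ Icc (t₀ + k * d) (t₀ + (k + 1 : ℕ) * d),
          w k + (τ - (t₀ + k * d)) * V ∈ Icc 0 y₁ := by
        intro τ hτ
        have e : w k + (τ - (t₀ + k * d)) * V = (1 - (τ - (t₀ + k * d)) / d) * w k
            + (τ - (t₀ + k * d)) / d * w (k + 1) := by
          rw [hVdef]; field_simp; ring
        rw [e]
        have h1 : (τ - (t₀ + k * d)) / d ≤ 1 := by
          rw [div_le_one hd]; linarith [hτ.2]
        exact convex_Icc 0 y₁ (Ioc_subset_Icc_self (hw k (by omega)))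
          (Ioc_subset_Icc_self (hw (k + 1) hk)) (by linarith)
          (div_nonneg (by linarith [hτ.1]) hd.le) (by ring)
      have hint : ∫ τ in (t₀ + k * d)..(t₀ + (k + 1 : ℕ) * d),
          f (w k + (τ - (t₀ + k * d)) * V) V τ ≤ d * (f (w k) V (t₀ + k * d) + ε) := by
        have hconst : ∫ _ in (t₀ + k * d)..(t₀ + (k + 1 : ℕ) * d),
            (f (w k) V (t₀ + k * d) + ε) = d * (f (w k) V (t₀ + k * d) + ε) := by
          rw [intervalIntegral.integral_const, hstep, smul_eq_mul]
        rw [← hconst]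
        have hle : t₀ + k * d ≤ t₀ + (k + 1 : ℕ) * d := by linarith
        refine intervalIntegral.integral_mono_on hle ?_ intervalIntegrable_const fun τ hτ => ?_
        · refine ContinuousOn.intervalIntegrable ?_
          rw [uIcc_of_le hle]
          refine hf.continuousOn.comp (f := fun τ => (w k + (τ - (t₀ + k * d)) * V, V, τ))
            (by fun_prop) fun τ hτ => ⟨(hline τ hτ).1, mem_univ _, ht.1.trans hτ.1, hτ.2.trans ht'.2⟩
        · have hτd : |τ - (t₀ + k * d)| ≤ d := by
            rw [abs_of_nonneg (by linarith [hτ.1])]; linarith [hτ.2]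
          have := (abs_le.1 (hu (w k) (Ioc_subset_Icc_self (hw k (by omega))) _ (hline τ hτ) V
            (abs_le.1 hVk) V (abs_le.1 hVk) (t₀ + k * d) ht τ ⟨ht.1.trans hτ.1, hτ.2.trans ht'.2⟩
            (by
              rw [add_sub_cancel_left, abs_mul]
              have : |τ - (t₀ + k * d)| * |V| ≤ d * |M| := by
                exact mul_le_mul hτd (hVk.trans (le_abs_self M)) (abs_nonneg _) hd.le
              linarith)
            (by rw [sub_self, abs_zero]; exact hδ'.le)
            (by nlinarith))).2
          linarith
      have hD : discreteCost f (k + 1) d t₀ w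
          = discreteCost f k d t₀ w + d * f (w k) V (t₀ + k * d) := by
        unfold discreteCost; rw [Finset.sum_range_succ]
      rw [hD]
      push_cast at hdp hint ⊢
      linarith
  exact key n le_rfl

set_option maxHeartbeats 800000 in
/-- Uniform approximate supergradients of the value function. -/
theorem exists_supergradient (hf : IsLagrangian p T f fy fa) (hp : 1 < p)
    (hW : HasDynamicProgramming T f W) {a b α β h₁ E : ℝ} (ha : 0 < a) (hab : a ≤ b) (hα : 0 ≤ α)
    (hβ : β < T) (hh₁ : 0 < h₁)
    (hnear : ∀ h, 0 < h → h ≤ h₁ → ∀ r₀ ∈ Icc a b, ∀ t₀ ∈ Icc α β, ∀ η, 0 < η → η ≤ 1 →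
      ∃ ρ v, IsNearlyOptimal p f W a E h r₀ t₀ η ρ v) {ε : ℝ} (hε : 0 < ε) :
    ∃ δ P, 0 < δ ∧ 0 ≤ P ∧ ∀ r₀ ∈ Icc a b, ∀ t₀ ∈ Icc α β, ∀ η, 0 < η →
      ∃ p₁ p₂, |p₁| ≤ P ∧ |p₂| ≤ P ∧ ∀ r ∈ Icc a b, ∀ t ∈ Icc α β, |r - r₀| ≤ δ → |t - t₀| ≤ δ →
        W r t ≤ W r₀ t₀ + η + p₁ * (r - r₀) + p₂ * (t - t₀) + ε * (|r - r₀| + |t - t₀|) := by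
  -- The sampled nodes cost at most E + η' with η' ≤ 1, whence E + 1.
  obtain ⟨h₂, hh₂, hspeed⟩ := hf.exists_bounded_speed hp (E + 1) ha hab
  set h₀ := min h₁ (min h₂ ((T - β) / 2)) with hh₀def
  have hh₀ : 0 < h₀ := lt_min hh₁ (lt_min hh₂ (by linarith))
  have hh₀T : h₀ ≤ (T - β) / 2 := (min_le_right _ _).trans (min_le_right _ _)
  obtain ⟨M, hM0, hM⟩ := hspeed h₀ hh₀ ((min_le_right _ _).trans (min_le_left _ _))
  obtain ⟨K, hK0, hK⟩ := hf.time_lipschitz (b + a + 2 * (M + 1)) (by linarith)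
  -- Two time scales avoid a circularity: the speed bound M depends on the window length and K
  -- depends on M, while the deformation time must be small compared with ε / K. Thus M is fixed on
  -- the window h₀, and only an initial part h is deformed. Taking h₀ / h an integer makes t₀ + h a
  -- grid point.
  obtain ⟨q', hq'⟩ := exists_nat_gt (h₀ * (4 * K) / ε)
  set h := h₀ / (q' + 1 : ℕ) with hhdef
  have hh : 0 < h := by positivity
  have hhK : h * (2 * K) ≤ ε / 2 := by
    rw [div_lt_iff₀ hε] at hq'
    rw [hhdef, div_mul_eq_mul_div, div_le_iff₀ (by positivity)]
    push_cast
    linarith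
  have hhh₀ : h ≤ h₀ := div_le_self hh₀.le (by push_cast; linarith [Nat.cast_nonneg (α := ℝ) q'])
  obtain ⟨δp, hδp, hpersp⟩ := hf.exists_perspective (y₀ := a / 4) (by positivity) (b + a) hM0
    (ε := ε / (2 * (1 + h))) (by positivity)
  obtain ⟨Cf, hCf0, hCf⟩ := exists_bound_of_continuousOn hf.continuousOn (b + a) M
  obtain ⟨Cy, hCy0, hCy⟩ := exists_bound_of_continuousOn hf.continuousOn_fy (b + a) M
  obtain ⟨Ca, hCa0, hCa⟩ := exists_bound_of_continuousOn hf.continuousOn_fa (b + a) M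
  refine ⟨min (a / 4) (min δp (min (h * δp) (h / 2))), h * Cy + Ca + (Cf + Ca * M),
    by positivity, by positivity, fun r₀ hr₀ t₀ ht₀ η hη => ?_⟩
  -- The four quarters of η pay for near optimality, for the sampling, and (two of them) for the
  -- polygonal lines.
  set η' := min 1 (η / 4) with hη'
  have hη'0 : 0 < η' := by positivity
  have hη'4 : 4 * η' ≤ η := by linarith [min_le_right 1 (η / 4)]
  obtain ⟨ρ, v, hopt⟩ := hnear h₀ hh₀ (min_le_left _ _) r₀ hr₀ t₀ ht₀ η' hη'0 (min_le_left _ _)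
  have ht₀0 : 0 ≤ t₀ := hα.trans ht₀.1
  have ht₀T : t₀ + h₀ < T := by linarith [ht₀.2]
  have hρ0 : ρ t₀ = r₀ := by
    simpa using hopt.eq_primitive t₀ ⟨le_rfl, by linarith⟩
  obtain ⟨n₀, hn₀⟩ := hf.exists_discreteCost_le hp (r := b + a) (by linarith) ht₀0 hh₀ ht₀T.le
    hopt.continuousOn (fun s hs => by
      have := abs_le.1 (hopt.abs_sub_le s hs)
      constructor <;> linarith [hr₀.1, hr₀.2]) hopt.intervalIntegrable
    hopt.intervalIntegrable_rpow (by rw [hρ0]; exact hopt.eq_primitive) hη'0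
  obtain ⟨δ₆, hδ₆, hpoly⟩ := hf.exists_le_discreteCost_add hW (b + a) (2 * (M + 1))
    (ε := η' / h₀) (by positivity)
  obtain ⟨m₁, hm₁⟩ := exists_nat_gt (2 * h₀ / δ₆)
  set m := max (n₀ + 1) m₁ with hmdef
  have hm0 : 0 < m := lt_of_lt_of_le (by omega) (le_max_left _ _)
  have hm' : (0 : ℝ) < m := by exact_mod_cast hm0
  set n := m + m * q' with hndef
  have hnm : m ≤ n := by omega
  have hn0 : 0 < n := by omega
  have hn' : (0 : ℝ) < n := by exact_mod_cast hn0
  have hnn₀ : n₀ ≤ n := by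
    have : n₀ + 1 ≤ m := le_max_left _ _
    omega
  set d := h₀ / n with hd
  have hd0 : 0 < d := by positivity
  have hnd : n * d = h₀ := by rw [hd]; field_simp
  have hmd : m * d = h := by
    rw [hd, hhdef, hndef]; push_cast; field_simp; ring
  have hqd : (m * q' : ℕ) * d = h₀ - h := by
    rw [← hnd, ← hmd, hndef]; push_cast; ring
  have hdδ : 2 * d ≤ δ₆ := by
    have h1 : 2 * h₀ / δ₆ < n := by
      refine hm₁.trans_le ?_
      exact_mod_cast (le_max_right _ _).trans hnm
    rw [div_lt_iff₀ hδ₆] at h1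
    rw [hd, ← mul_div_assoc, div_le_iff₀ hn']; linarith
  have hD0 := hn₀ n hnn₀ hn0
  obtain ⟨w, hw0, hwn, hwr, hwD, hwV⟩ := hM n t₀ (fun k => ρ (t₀ + k * (h₀ / n))) hn0 ht₀0 ht₀T.le
    (by simpa [hρ0] using hr₀)
    (fun k hk => by
      simp only [Nat.cast_zero, zero_mul, add_zero, hρ0]
      refine hopt.abs_sub_le _ ⟨by simp only [le_add_iff_nonneg_right]; positivity, ?_⟩
      rw [add_le_add_iff_left, ← hd, ← hnd]
      gcongr)
    (hD0.trans (by linarith [hopt.cost_le, min_le_left 1 (η / 4)]))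
  simp only [Nat.cast_zero, zero_mul, add_zero, hρ0] at hw0 hwr
  rw [← hd] at hD0 hwD hwV hwn
  rw [hnd] at hwn
  have hwr' : ∀ k ≤ n, r₀ - a / 4 ≤ w k ∧ w k ≤ r₀ + a / 4 := by
    intro k hk
    have := abs_le.1 (hwr k hk)
    constructor <;> linarith
  have hwI : ∀ k < m, w k ∈ Icc 0 (b + a) := fun k hk => by
    have := hwr' k (by omega)
    constructor <;> linarith [hr₀.1, hr₀.2]
  have hVI : ∀ k < m, (w (k + 1) - w k) / d ∈ Icc (-M) M := fun k hk =>
    abs_le.1 (hwV k (by omega))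
  have hsI : ∀ k < m, t₀ + k * d ∈ Icc 0 T := fun k hk =>
    grid_mem hd0.le ht₀0 (by rw [hmd]; linarith) hk.le
  have hbCa : ∀ k < m, |fa (w k) ((w (k + 1) - w k) / d) (t₀ + k * d)| ≤ Ca := fun k hk =>
    hCa _ (hwI k hk) _ (hVI k hk) _ (hsI k hk)
  -- The number of nodes depends on η, but the slopes are averages over the first m steps and are
  -- bounded through M alone.
  refine ⟨stateSlope fy fa m d h t₀ w, timeSlope f fa m d h t₀ w,
    (abs_stateSlope_le hd0 hh hm0 hmd (fun k hk => hCy _ (hwI k hk) _ (hVI k hk) _ (hsI k hk))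
      hbCa).trans ?_,
    (abs_timeSlope_le hd0 hh hCa0 hmd (fun k hk => hCf _ (hwI k hk) _ (hVI k hk) _ (hsI k hk))
      hbCa fun k hk => hwV k (by omega)).trans ?_, ?_⟩
  · have : 0 ≤ Ca * M := by positivity
    linarith
  · have : 0 ≤ h * Cy := by positivity
    linarith
  intro r hr t ht hrδ htδ
  have hrδ1 : |r - r₀| ≤ a / 4 := hrδ.trans (min_le_left _ _)
  have hrδ2 : |r - r₀| ≤ δp := hrδ.trans ((min_le_right _ _).trans (min_le_left _ _))
  have hrδ3 : |r - r₀| ≤ h * δp :=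
    hrδ.trans ((min_le_right _ _).trans ((min_le_right _ _).trans (min_le_left _ _)))
  have hrδ4 : |r - r₀| ≤ h / 2 :=
    hrδ.trans ((min_le_right _ _).trans ((min_le_right _ _).trans (min_le_right _ _)))
  have htδ3 : |t - t₀| ≤ h * δp :=
    htδ.trans ((min_le_right _ _).trans ((min_le_right _ _).trans (min_le_left _ _)))
  have htδ4 : |t - t₀| ≤ h / 2 :=
    htδ.trans ((min_le_right _ _).trans ((min_le_right _ _).trans (min_le_right _ _)))
  set x := r - r₀ with hx
  set τ := (t - t₀) / h with hτ
  set β' := x / h with hβ'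
  have hτh : t - t₀ = h * τ := by rw [hτ]; field_simp
  have hτabs : |τ| = |t - t₀| / h := by rw [hτ, abs_div, abs_of_pos hh]
  have hβabs : |β'| = |x| / h := by rw [hβ', abs_div, abs_of_pos hh]
  have hτδ : |τ| ≤ δp := by rw [hτabs, div_le_iff₀ hh]; linarith
  have hβδ : |β'| ≤ δp := by rw [hβabs, div_le_iff₀ hh]; linarith
  have hτ2 : |τ| ≤ 1 / 2 := by rw [hτabs, div_le_iff₀ hh]; linarith
  have hβ2 : |β'| ≤ 1 / 2 := by rw [hβabs, div_le_iff₀ hh]; linarith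
  obtain ⟨hτl, hτu⟩ := abs_le.1 hτ2
  have hpos : 0 < 1 - τ := by linarith
  set d' := d * (1 - τ) with hd'
  have hd'0 : 0 < d' := by positivity
  have hd'δ : d' ≤ δ₆ :=
    (mul_le_mul_of_nonneg_left (by linarith : 1 - τ ≤ 2) hd0.le).trans (by linarith)
  have hmd' : m * d' = h - (t - t₀) := by
    rw [hd', ← mul_assoc, hmd, hτh]; ring
  set z : ℕ → ℝ := fun k => w k + x * (1 - k / m) with hz
  have hz0 : z 0 = r := by simp [hz, hw0, hx]
  have hzm : z m = w m := by simp [hz, hm'.ne']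
  have hzr : ∀ k ≤ m, z k ∈ Icc (a / 4) (b + a) := by
    intro k hk
    have h1 : |x * (1 - k / m)| ≤ a / 4 := by
      have h2 : (k : ℝ) / m ≤ 1 := by rw [div_le_one hm']; exact_mod_cast hk
      have h3 : 0 ≤ (k : ℝ) / m := by positivity
      rw [abs_mul, abs_of_nonneg (by linarith : 0 ≤ 1 - (k : ℝ) / m)]
      exact (mul_le_of_le_one_right (abs_nonneg _) (by linarith)).trans hrδ1
    have h4 := abs_le.1 h1
    have h5 := hwr' k (by omega)
    simp only [hz]
    constructor <;> linarith [hr₀.1, hr₀.2]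
  -- Dynamic programming is used twice: along the deformed nodes from (r, t) to (w m, t₀ + h), then
  -- along the untouched nodes up to t₀ + h₀.
  have hW1 := hpoly m d' t z hd'0 hd'δ (hα.trans ht.1) (by rw [hmd']; linarith)
    (fun k hk => ⟨by linarith [(hzr k hk).1], (hzr k hk).2⟩)
    (fun k hk => by
      rw [deformed_speed w hd0 hm0 hmd]
      exact abs_deformed_speed_le (hwV k (by omega)) hτ2 hβ2)
  have hW2 := hpoly (m * q') d (t₀ + h) (fun k => w (m + k)) hd0 (by linarith) (by linarith)
    (by rw [hqd]; linarith)
    (fun k hk => by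
      have := hwr' (m + k) (by omega)
      constructor <;> linarith [hr₀.1, hr₀.2])
    (fun k hk => (hwV (m + k) (by omega)).trans (by linarith))
  rw [hz0, hzm, hmd', show t + (h - (t - t₀)) = t₀ + h by ring] at hW1
  rw [add_zero, ← hndef, hqd, show t₀ + h + (h₀ - h) = t₀ + h₀ by ring] at hW2
  have hDsplit := discreteCost_add f m (m * q') d t₀ w
  rw [← hndef, hmd] at hDsplit
  have hsum := discreteCost_deformed_le (by positivity) (by linarith : b + a ≤ b + a + 2 * (M + 1))
    (by linarith) hK0 (by positivity) hpersp hK hm0 hd0 hh hmd ht₀0 (hα.trans ht.1)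
    (by linarith) (fun k hk => by
      have := hwr' k (by omega)
      constructor <;> linarith [hr₀.1, hr₀.2]) (fun k hk => hzr k hk.le)
    (fun k hk => hwV k (by omega)) hτδ hτ2 hβδ hβ2 hrδ2
  change discreteCost f m d' t z ≤ _ at hsum
  have herr := deformation_error_le (dt := t - t₀) (x := x) hh hε.le hhK
  have herr2 : (h - (t - t₀)) * (η' / h₀) + (h₀ - h) * (η' / h₀) ≤ 2 * η' := by
    have h1 : h₀ * (η' / h₀) = η' := by field_simp
    have h2 : -(t - t₀) ≤ h₀ := by linarith [neg_abs_le (t - t₀), abs_nonneg (t - t₀)]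
    have h3 : -(t - t₀) * (η' / h₀) ≤ h₀ * (η' / h₀) := by gcongr
    linarith
  have hend := hopt.cost_add_le
  rw [← hwn] at hend
  linarith

end IsLagrangian

/-! ### A criterion for semiconcavity -/

section Semiconcavity

variable {E : Type*} [NormedAddCommGroup E] [NormedSpace ℝ E]

/-- The semiconcavity inequality with constant `c` for points of `S` at distance at most `σ`. -/
def SemiconcaveUpTo (S : Set E) (f : E → ℝ) (σ c : ℝ) : Prop :=
  ∀ x y : E, segment ℝ x y ⊆ S → ‖x - y‖ ≤ σ → ∀ θ ∈ Icc (0 : ℝ) 1,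
    θ * f x + (1 - θ) * f y - f (θ • x + (1 - θ) • y) ≤ θ * (1 - θ) * ‖x - y‖ * c

/-- Semiconcavity from the inequality with small constants at small distances. -/
theorem isSemiconcaveOn_of_semiconcaveUpTo {S : Set E} {f : E → ℝ}
    (hsmall : ∀ ε, 0 < ε → ∃ δ, 0 < δ ∧ SemiconcaveUpTo S f δ ε)
    (hlarge : ∃ C, 0 ≤ C ∧ ∀ σ, SemiconcaveUpTo S f σ C) : IsSemiconcaveOn S f := by
  obtain ⟨C, hC0, hC⟩ := hlarge
  -- The modulus is the infimum of the constants valid up to some scale strictly larger than ρ. The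
  -- strict inequality makes each constant usable for nearby ρ' too, which gives upper
  -- semicontinuity.
  set A : ℝ → Set ℝ := fun ρ => {c | 0 ≤ c ∧ ∃ σ, ρ < σ ∧ SemiconcaveUpTo S f σ c} with hA
  have hne : ∀ ρ, (A ρ).Nonempty := fun ρ => ⟨C, hC0, ρ + 1, by linarith, hC _⟩
  have hbdd : ∀ ρ, BddBelow (A ρ) := fun ρ => ⟨0, fun c hc => hc.1⟩
  have hle : ∀ {ρ c}, c ∈ A ρ → sInf (A ρ) ≤ c := fun {ρ c} hc => csInf_le (hbdd ρ) hc
  have hnonneg : ∀ ρ, 0 ≤ sInf (A ρ) := fun ρ => le_csInf (hne ρ) fun c hc => hc.1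
  refine ⟨fun ρ => sInf (A ρ), ?_, ?_, fun ρ _ => hnonneg ρ, ?_, ?_⟩
  · intro ρ _ ρ' _ hρ
    refine csInf_le_csInf (hbdd ρ) (hne ρ') ?_
    rintro c ⟨hc, σ, hσ, h⟩
    exact ⟨hc, σ, hρ.trans_lt hσ, h⟩
  · intro ρ _ c hc
    obtain ⟨c', ⟨hc', σ, hσ, h⟩, hcc⟩ := exists_lt_of_csInf_lt (hne ρ) hc
    filter_upwards [mem_nhdsWithin_of_mem_nhds (Iio_mem_nhds hσ)] with ρ' hρ'
    exact (hle ⟨hc', σ, hρ', h⟩).trans_lt hcc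
  · rw [Metric.tendsto_nhdsWithin_nhds]
    intro ε hε
    obtain ⟨δ, hδ, h⟩ := hsmall (ε / 2) (by positivity)
    refine ⟨δ, hδ, fun {ρ} hρ hρδ => ?_⟩
    rw [Real.dist_eq, sub_zero] at hρδ ⊢
    rw [abs_of_nonneg (hnonneg ρ)]
    have : sInf (A ρ) ≤ ε / 2 := hle ⟨by positivity, δ, (le_abs_self ρ).trans_lt hρδ, h⟩
    linarith
  · intro x y hxy θ hθ
    have h0 : 0 ≤ θ * (1 - θ) * ‖x - y‖ :=
      mul_nonneg (mul_nonneg hθ.1 (by linarith [hθ.2])) (norm_nonneg _)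
    rcases h0.eq_or_lt with h | h
    · have := hC ‖x - y‖ x y hxy le_rfl θ hθ
      rw [← h, zero_mul] at this ⊢
      exact this
    · rw [← div_le_iff₀' h]
      refine le_csInf (hne _) ?_
      rintro c ⟨-, σ, hσ, hc⟩
      rw [div_le_iff₀' h]
      exact hc x y hxy hσ.le θ hθ

/-- A bounded function with uniform approximate supergradients is semiconcave. -/
theorem isSemiconcaveOn_of_supergradient {S : Set E} {f : E → ℝ} {B : ℝ}
    (hB : ∀ z ∈ S, |f z| ≤ B)
    (hsup : ∀ ε, 0 < ε → ∃ δ P, 0 < δ ∧ 0 ≤ P ∧ ∀ z₀ ∈ S, ∀ η, 0 < η →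
      ∃ φ : E → ℝ, (∀ (c : ℝ) x, φ (c • x) = c * φ x) ∧ (∀ x, φ x ≤ P * ‖x‖) ∧
        ∀ z ∈ S, ‖z - z₀‖ ≤ δ → f z ≤ f z₀ + η + φ (z - z₀) + ε * ‖z - z₀‖) :
    IsSemiconcaveOn S f := by
  have hx : ∀ (x y : E) (θ : ℝ), x - (θ • x + (1 - θ) • y) = (1 - θ) • (x - y) := by
    intros; module
  have hy : ∀ (x y : E) (θ : ℝ), y - (θ • x + (1 - θ) • y) = (-θ) • (x - y) := by
    intros; module
  have hnx : ∀ (x y : E), ∀ θ ∈ Icc (0 : ℝ) 1,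
      ‖x - (θ • x + (1 - θ) • y)‖ = (1 - θ) * ‖x - y‖ := by
    intro x y θ hθ
    rw [hx, norm_smul, Real.norm_eq_abs, abs_of_nonneg (by linarith [hθ.2])]
  have hny : ∀ (x y : E), ∀ θ ∈ Icc (0 : ℝ) 1,
      ‖y - (θ • x + (1 - θ) • y)‖ = θ * ‖x - y‖ := by
    intro x y θ hθ
    rw [hy, norm_smul, Real.norm_eq_abs, abs_neg, abs_of_nonneg hθ.1]
  have hmem : ∀ x y : E, segment ℝ x y ⊆ S → ∀ θ ∈ Icc (0 : ℝ) 1,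
      θ • x + (1 - θ) • y ∈ S := fun x y h θ hθ =>
    h ⟨θ, 1 - θ, hθ.1, by linarith [hθ.2], by ring, rfl⟩
  refine isSemiconcaveOn_of_semiconcaveUpTo ?_ ?_
  · intro ε hε
    obtain ⟨δ, P, hδ, -, h⟩ := hsup (ε / 2) (by positivity)
    refine ⟨δ, hδ, fun x y hxy hd θ hθ => le_of_forall_pos_le_add fun η hη => ?_⟩
    -- The base point is the convex combination. The displacements to x and y are (1 - θ)(x - y) and
    -- -θ(x - y), so homogeneity of φ makes the weighted linear terms cancel; each end contributes
    -- ε/2.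
    obtain ⟨φ, hφ, -, hsg⟩ := h _ (hmem x y hxy θ hθ) η hη
    have h1θ : 0 ≤ 1 - θ := by linarith [hθ.2]
    have hn := norm_nonneg (x - y)
    have h1 := hsg x (hxy (left_mem_segment ℝ x y)) (by
      rw [hnx x y θ hθ]; nlinarith [hθ.1])
    have h2 := hsg y (hxy (right_mem_segment ℝ x y)) (by
      rw [hny x y θ hθ]; nlinarith [hθ.2])
    rw [hnx x y θ hθ, hx, hφ] at h1
    rw [hny x y θ hθ, hy, hφ] at h2
    have h3 := mul_le_mul_of_nonneg_left h1 hθ.1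
    have h4 := mul_le_mul_of_nonneg_left h2 h1θ
    linarith
  · obtain ⟨δ, P, hδ, hP, h⟩ := hsup 1 one_pos
    -- Supergradients give a Lipschitz bound at distances up to δ; beyond δ the bound on f suffices.
    have hlip : ∀ z₀ ∈ S, ∀ z ∈ S, f z - f z₀ ≤ (P + 1 + 2 * |B| / δ) * ‖z - z₀‖ := by
      intro z₀ hz₀ z hz
      have hn := norm_nonneg (z - z₀)
      have hq : 0 ≤ 2 * |B| / δ := by positivity
      rcases le_total ‖z - z₀‖ δ with hd | hd
      · refine le_of_forall_pos_le_add fun η hη => ?_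
        obtain ⟨φ, -, hφ, hsg⟩ := h z₀ hz₀ η hη
        have h1 := hsg z hz hd
        have h2 := hφ (z - z₀)
        have h3 := mul_nonneg hq hn
        linarith
      · have h1 := (abs_le.1 (hB z hz)).2
        have h2 := (abs_le.1 (hB z₀ hz₀)).1
        have h3 : 2 * |B| ≤ 2 * |B| / δ * ‖z - z₀‖ := by
          rw [div_mul_eq_mul_div, le_div_iff₀ hδ]
          gcongr
        have h4 : 0 ≤ (P + 1) * ‖z - z₀‖ := by positivity
        linarith [le_abs_self B]
    refine ⟨2 * (P + 1 + 2 * |B| / δ), by positivity, fun σ x y hxy _ θ hθ => ?_⟩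
    have h1 := hlip _ (hmem x y hxy θ hθ) x (hxy (left_mem_segment ℝ x y))
    have h2 := hlip _ (hmem x y hxy θ hθ) y (hxy (right_mem_segment ℝ x y))
    rw [hnx x y θ hθ] at h1
    rw [hny x y θ hθ] at h2
    have h3 := mul_le_mul_of_nonneg_left h1 hθ.1
    have h4 := mul_le_mul_of_nonneg_left h2 (by linarith [hθ.2] : 0 ≤ 1 - θ)
    linarith

theorem IsSemiconcaveOn.mono {S S' : Set E} {f : E → ℝ} (h : IsSemiconcaveOn S f) (hS : S' ⊆ S) :
    IsSemiconcaveOn S' f := by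
  obtain ⟨w, h1, h2, h3, h4, h5⟩ := h
  exact ⟨w, h1, h2, h3, h4, fun x y hxy => h5 x y (hxy.trans hS)⟩

end Semiconcavity

/-! ### The running cost on one edge -/

section OneEdge

variable {N : ℕ} {p T : ℝ} {ℓ : Fin N → ℝ → ℝ → ℝ → ℝ} {ℓstar : ℝ → ℝ}

theorem RegularRunningCosts.hasDerivAt_control (hℓ : RegularRunningCosts T ℓ) (i : Fin N)
    {y a s : ℝ} (hy : 0 ≤ y) (hs : s ∈ Icc 0 T) :
    HasDerivAt (fun b => ℓ i y b s) (partialA ℓ i y a s) a := by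
  refine DifferentiableAt.hasDerivAt ?_
  have h := hℓ.differentiableOn i s hs (y, a) ⟨hy, mem_univ _⟩
  have h2 : DifferentiableWithinAt ℝ (fun b : ℝ => ((y, b) : ℝ × ℝ)) univ a := by fun_prop
  have := DifferentiableWithinAt.comp (g := fun q : ℝ × ℝ => ℓ i q.1 q.2 s) a h h2
    fun b _ => ⟨hy, mem_univ _⟩
  exact this.differentiableAt univ_mem

theorem RegularRunningCosts.hasFDerivAt (hℓ : RegularRunningCosts T ℓ) (i : Fin N)
    {y a s : ℝ} (hy : 0 < y) (hs : s ∈ Icc 0 T) :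
    HasFDerivAt (fun q : ℝ × ℝ => ℓ i q.1 q.2 s)
      (partialY ℓ i y a s • ContinuousLinearMap.fst ℝ ℝ ℝ
        + partialA ℓ i y a s • ContinuousLinearMap.snd ℝ ℝ ℝ) (y, a) := by
  have hnhds : Ici (0 : ℝ) ×ˢ (univ : Set ℝ) ∈ 𝓝 (y, a) :=
    prod_mem_nhds (Ici_mem_nhds hy) univ_mem
  have h := ((hℓ.differentiableOn i s hs).differentiableAt hnhds).hasFDerivAt
  set D := fderiv ℝ (fun q : ℝ × ℝ => ℓ i q.1 q.2 s) (y, a) with hD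
  have h1 : HasDerivAt (fun z => ℓ i z a s) (D (1, 0)) y :=
    h.comp_hasDerivAt (f := fun z : ℝ => ((z, a) : ℝ × ℝ)) y
      ((hasDerivAt_id y).prodMk (hasDerivAt_const y a))
  have h2 : HasDerivAt (fun b => ℓ i y b s) (D (0, 1)) a :=
    h.comp_hasDerivAt (f := fun b : ℝ => ((y, b) : ℝ × ℝ)) a
      ((hasDerivAt_const a y).prodMk (hasDerivAt_id a))
  -- At y > 0 the one-sided derivative on the half-line is the ordinary one.
  have e1 : partialY ℓ i y a s = D (1, 0) :=
    h1.hasDerivWithinAt.derivWithin (uniqueDiffOn_Ici 0 y hy.le)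
  have e2 : partialA ℓ i y a s = D (0, 1) := h2.deriv
  convert h using 1
  rw [e1, e2]
  ext <;> simp

/-- The graph of a convex function lies above its tangents. -/
theorem tangent_le_of_convexOn {φ : ℝ → ℝ} (hφ : ConvexOn ℝ univ φ) {a φ' : ℝ}
    (h : HasDerivAt φ φ' a) (b : ℝ) : φ a + φ' * (b - a) ≤ φ b := by
  rcases lt_trichotomy a b with hab | rfl | hab
  · have := hφ.le_slope_of_hasDerivAt (mem_univ _) (mem_univ _) hab h
    rw [slope_def_field, le_div_iff₀ (by linarith)] at this
    linarith
  · simp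
  · have := hφ.slope_le_of_hasDerivAt (mem_univ _) (mem_univ _) hab h
    rw [slope_def_field, div_le_iff₀ (by linarith)] at this
    linarith

/-- The assumptions on the running costs give a Lagrangian on each edge. -/
theorem isLagrangian (hℓ : RegularRunningCosts T ℓ) (h1 : H1 p T ℓ ℓstar) (h2 : H2 p T ℓ)
    (h3 : H3 p T ℓ) (h4 : H4 T ℓ) (hLip : LocallyUniformlyLipschitzInTime T ℓ) (i : Fin N) :
    IsLagrangian p T (ℓ i) (partialY ℓ i) (partialA ℓ i) where
  continuousOn := hℓ.continuousOn i
  continuousOn_fy := hℓ.continuousOn_partialY i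
  continuousOn_fa := hℓ.continuousOn_partialA i
  hasFDerivAt _ _ _ hy hs := hℓ.hasFDerivAt i hy hs
  tangent_le y _ b s hy hs :=
    tangent_le_of_convexOn (h4 i y s hy hs).convexOn (hℓ.hasDerivAt_control i hy hs) b
  coercive := by
    obtain ⟨C₀, c₀, hC₀, h, -⟩ := h1
    exact ⟨C₀, c₀, hC₀, h i⟩
  time_modulus r hr := by
    obtain ⟨w, hw, h⟩ := h2 r hr
    exact ⟨w, hw, h i⟩
  growth r hr := by
    obtain ⟨c, hc, h⟩ := h3 r hr
    exact ⟨c, hc, h i⟩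
  time_lipschitz r hr := by
    obtain ⟨K, hK, h⟩ := hLip r hr
    exact ⟨K, hK, h i⟩

end OneEdge

/-! ### Geometry of the junction -/

section Geometry

variable {N : ℕ}

theorem norm_smul_single {i : Fin N} {r : ℝ} (hr : 0 ≤ r) :
    ‖r • EuclideanSpace.single i (1 : ℝ)‖ = r := by
  rw [norm_smul, PiLp.norm_single, norm_one, mul_one, Real.norm_of_nonneg hr]

theorem smul_single_apply (i j : Fin N) (r : ℝ) :
    (r • EuclideanSpace.single i (1 : ℝ)) j = if j = i then r else 0 := by
  rw [PiLp.smul_apply, PiLp.single_apply]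
  simp

theorem smul_single_mem_junction (i : Fin N) {r : ℝ} (hr : 0 ≤ r) :
    r • EuclideanSpace.single i (1 : ℝ) ∈ junction N :=
  mem_iUnion.2 ⟨i, r, hr, rfl⟩

theorem mem_openEdge_iff {i : Fin N} {x : EuclideanSpace ℝ (Fin N)} :
    x ∈ openEdge i ↔ ∃ r : ℝ, 0 < r ∧ x = r • EuclideanSpace.single i (1 : ℝ) := by
  constructor
  · rintro ⟨⟨r, hr, rfl⟩, hx⟩
    refine ⟨r, hr.lt_of_ne ?_, rfl⟩
    rintro rfl
    exact hx (by simp)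
  · rintro ⟨r, hr, rfl⟩
    refine ⟨⟨r, hr.le, rfl⟩, fun h => ?_⟩
    have := norm_smul_single (i := i) hr.le
    rw [h, norm_zero] at this
    exact hr.ne this

theorem smul_single_mem_openEdge (i : Fin N) {r : ℝ} (hr : 0 < r) :
    r • EuclideanSpace.single i (1 : ℝ) ∈ openEdge i :=
  mem_openEdge_iff.2 ⟨r, hr, rfl⟩

theorem eq_of_mem_openEdge {i j : Fin N} {x : EuclideanSpace ℝ (Fin N)} (hi : x ∈ openEdge i)
    (hj : x ∈ openEdge j) : i = j := by
  obtain ⟨r, hr, rfl⟩ := mem_openEdge_iff.1 hi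
  obtain ⟨r', hr', h⟩ := mem_openEdge_iff.1 hj
  by_contra hne
  have := congrArg (fun z : EuclideanSpace ℝ (Fin N) => z i) h
  rw [smul_single_apply, smul_single_apply, if_pos rfl, if_neg hne] at this
  exact hr.ne' this

theorem eq_zero_or_mem_openEdge {x : EuclideanSpace ℝ (Fin N)} (hx : x ∈ junction N) :
    x = 0 ∨ ∃ j, x ∈ openEdge j := by
  obtain ⟨j, hj⟩ := mem_iUnion.1 hx
  by_cases h : x = 0
  · exact Or.inl h
  · exact Or.inr ⟨j, hj, h⟩

/-- On the other edges the i-th coordinate vanishes. Positivity of this coordinate thus certifies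
that a trajectory is on edge i and reduces it to a scalar curve. -/
theorem eq_smul_single_of_pos {i : Fin N} {x : EuclideanSpace ℝ (Fin N)} (hx : x ∈ junction N)
    (h : 0 < x i) : x = x i • EuclideanSpace.single i (1 : ℝ) := by
  obtain ⟨j, r, hr, rfl⟩ := mem_iUnion.1 hx
  rw [smul_single_apply] at h ⊢
  split_ifs at h ⊢ with hij
  · rw [hij]
  · exact absurd h (lt_irrefl _)

theorem isClosed_edge (i : Fin N) : IsClosed (edge i) := by
  have : edge i = {x : EuclideanSpace ℝ (Fin N) | 0 ≤ x i} ∩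
      {x : EuclideanSpace ℝ (Fin N) | x = x i • EuclideanSpace.single i (1 : ℝ)} := by
    ext x
    constructor
    · rintro ⟨r, hr, rfl⟩
      have h : (r • EuclideanSpace.single i (1 : ℝ)) i = r := by rw [smul_single_apply, if_pos rfl]
      exact ⟨hr.trans_eq h.symm, congrArg (· • EuclideanSpace.single i (1 : ℝ)) h.symm⟩
    · rintro ⟨h1, h2⟩
      exact ⟨x i, h1, h2⟩
  rw [this]
  have hc : Continuous fun x : EuclideanSpace ℝ (Fin N) => x i := by fun_prop
  exact (isClosed_le continuous_const hc).inter
    (isClosed_eq continuous_id (hc.smul continuous_const))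

theorem measurableSet_openEdge (i : Fin N) : MeasurableSet (openEdge i) :=
  (isClosed_edge i).measurableSet.diff (measurableSet_singleton 0)

variable {ℓ : Fin N → ℝ → ℝ → ℝ → ℝ} {ℓstar : ℝ → ℝ} {g : Fin N → ℝ → ℝ} {gstar : ℝ}

theorem runningCost_of_mem_openEdge {i : Fin N} {y : EuclideanSpace ℝ (Fin N)}
    (hy : y ∈ openEdge i) (α : EuclideanSpace ℝ (Fin N)) (τ : ℝ) :
    runningCost ℓ ℓstar y α τ = ℓ i ‖y‖ (α i) τ := by
  unfold runningCost
  rw [Finset.sum_eq_single i, indicator_of_mem hy, indicator_of_notMem hy.2, add_zero]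
  · intro j _ hj
    exact indicator_of_notMem (fun h => hj (eq_of_mem_openEdge h hy)) _
  · exact fun h => absurd (Finset.mem_univ i) h

theorem runningCost_zero (α : EuclideanSpace ℝ (Fin N)) (τ : ℝ) :
    runningCost ℓ ℓstar 0 α τ = vertexCost ℓ ℓstar τ := by
  unfold runningCost
  rw [Finset.sum_eq_zero, zero_add, indicator_of_mem (mem_singleton _)]
  exact fun j _ => indicator_of_notMem (fun h => h.2 rfl) _

theorem terminalCost_of_mem_openEdge {i : Fin N} {y : EuclideanSpace ℝ (Fin N)}
    (hy : y ∈ openEdge i) : terminalCost g gstar y = g i ‖y‖ := by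
  unfold terminalCost
  rw [Finset.sum_eq_single i, indicator_of_mem hy, indicator_of_notMem hy.2, add_zero]
  · intro j _ hj
    exact indicator_of_notMem (fun h => hj (eq_of_mem_openEdge h hy)) _
  · exact fun h => absurd (Finset.mem_univ i) h

theorem terminalCost_zero : terminalCost g gstar 0 = min gstar (⨅ i, g i 0) := by
  unfold terminalCost
  rw [Finset.sum_eq_zero, zero_add, indicator_of_mem (mem_singleton _)]
  exact fun j _ => indicator_of_notMem (fun h => h.2 rfl) _

/-- The terminal cost is bounded on the junction. -/
theorem exists_abs_terminalCost_le (hg : RegularTerminalCosts g) :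
    ∃ G, 0 ≤ G ∧ ∀ y ∈ junction N, |terminalCost g gstar y| ≤ G := by
  choose hc M hM using hg
  refine ⟨(∑ j, |M j|) + |min gstar (⨅ i, g i 0)|, by positivity, fun y hy => ?_⟩
  have hs : 0 ≤ ∑ j, |M j| := by positivity
  rcases eq_zero_or_mem_openEdge hy with rfl | ⟨j, hj⟩
  · rw [terminalCost_zero]; linarith
  · rw [terminalCost_of_mem_openEdge hj]
    have h1 := hM j ‖y‖ (norm_nonneg _)
    have h2 := Finset.single_le_sum (f := fun j => |M j|) (fun _ _ => abs_nonneg _)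
      (Finset.mem_univ j)
    have h3 := abs_nonneg (min gstar (⨅ i, g i 0))
    linarith [le_abs_self (M j)]

theorem le_runningCost (hN : 0 < N) {T c₀ : ℝ}
    (hc : ∀ i, ∀ y a s : ℝ, 0 ≤ y → s ∈ Icc 0 T → c₀ ≤ ℓ i y a s)
    (hstar : ∀ s ∈ Icc 0 T, c₀ ≤ ℓstar s) {y : EuclideanSpace ℝ (Fin N)} (hy : y ∈ junction N)
    (α : EuclideanSpace ℝ (Fin N)) {τ : ℝ} (hτ : τ ∈ Icc 0 T) : c₀ ≤ runningCost ℓ ℓstar y α τ := by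
  have : Nonempty (Fin N) := ⟨⟨0, hN⟩⟩
  rcases eq_zero_or_mem_openEdge hy with rfl | ⟨j, hj⟩
  · rw [runningCost_zero]
    exact le_min (hstar τ hτ) (le_ciInf fun j => hc j _ _ _ le_rfl hτ)
  · rw [runningCost_of_mem_openEdge hj]
    exact hc j _ _ _ (norm_nonneg _) hτ

theorem continuousOn_vertexCost (hN : 0 < N) {T : ℝ} (hℓ : RegularRunningCosts T ℓ)
    (hℓstar : ContinuousOn ℓstar (Icc 0 T)) : ContinuousOn (vertexCost ℓ ℓstar) (Icc 0 T) := by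
  have : Nonempty (Fin N) := ⟨⟨0, hN⟩⟩
  unfold vertexCost
  refine ContinuousOn.inf hℓstar ?_
  have h : ∀ j, ContinuousOn (fun τ => ℓ j 0 0 τ) (Icc 0 T) := fun j =>
    (hℓ.continuousOn j).comp (f := fun τ : ℝ => ((0, 0, τ) : ℝ × ℝ × ℝ)) (by fun_prop)
      fun τ hτ => ⟨mem_Ici.2 le_rfl, mem_univ _, hτ⟩
  have h' := ContinuousOn.finset_inf'_apply (s := Finset.univ) Finset.univ_nonempty
    fun j _ => h j
  refine h'.congr fun τ _ => ?_
  exact (Finset.inf'_univ_eq_ciInf fun j => ℓ j 0 0 τ).symm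

end Geometry

/-! ### Admissible trajectories and their coordinates -/

section Trajectories

variable {N : ℕ} {p T : ℝ}

theorem integral_apply {S : Set ℝ} {F : ℝ → EuclideanSpace ℝ (Fin N)} (hF : IntegrableOn F S)
    (j : Fin N) : (∫ s in S, F s) j = ∫ s in S, F s j :=
  ((EuclideanSpace.proj j : EuclideanSpace ℝ (Fin N) →L[ℝ] ℝ).integral_comp_comm hF).symm

theorem integrableOn_apply {S : Set ℝ} {F : ℝ → EuclideanSpace ℝ (Fin N)} (hF : IntegrableOn F S)
    (j : Fin N) : IntegrableOn (fun s => F s j) S :=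
  (EuclideanSpace.proj j : EuclideanSpace ℝ (Fin N) →L[ℝ] ℝ).integrable_comp hF

theorem integrableOn_smul_of_hasCompactSupport {E : Type*} [NormedAddCommGroup E] [NormedSpace ℝ E]
    {S : Set ℝ} {F : ℝ → E} (hF : IntegrableOn F S) {φ : ℝ → ℝ} (hφ : Continuous φ)
    (hc : HasCompactSupport φ) : IntegrableOn (fun s => φ s • F s) S := by
  obtain ⟨C, hC⟩ := hc.exists_bound_of_continuous hφ
  exact hF.bdd_smul C hφ.aestronglyMeasurable (Eventually.of_forall hC)

/-- Weak derivatives can be computed coordinatewise. -/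
theorem isWeakDerivOn_iff_forall_apply {a b : ℝ} (hab : a ≤ b)
    {y v : ℝ → EuclideanSpace ℝ (Fin N)} (hy : IntegrableOn y (Ioo a b))
    (hv : IntegrableOn v (Ioo a b)) :
    IsWeakDerivOn a b y v ↔ ∀ (j : Fin N) (φ : ℝ → ℝ), ContDiff ℝ ∞ φ → HasCompactSupport φ →
      tsupport φ ⊆ Ioo a b → ∫ s in a..b, deriv φ s * y s j = -∫ s in a..b, φ s * v s j := by
  have key : ∀ (φ : ℝ → ℝ) (F : ℝ → EuclideanSpace ℝ (Fin N)), Continuous φ → HasCompactSupport φ →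
      IntegrableOn F (Ioo a b) → ∀ j, (∫ s in Ioo a b, φ s • F s) j
        = ∫ s in a..b, φ s * F s j := by
    intro φ F hφ hc hF j
    rw [integral_apply (integrableOn_smul_of_hasCompactSupport hF hφ hc),
      intervalIntegral.integral_of_le hab, integral_Ioc_eq_integral_Ioo]
    rfl
  have hd : ∀ φ : ℝ → ℝ, ContDiff ℝ ∞ φ → Continuous (deriv φ) := fun φ hφ =>
    hφ.continuous_deriv (by exact_mod_cast le_top)
  constructor
  · intro h j φ hφ hc hs
    have := congrArg (fun z : EuclideanSpace ℝ (Fin N) => z j) (h φ hφ hc hs)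
    simp only [PiLp.neg_apply] at this
    rwa [key _ _ (hd φ hφ) hc.deriv hy, key _ _ hφ.continuous hc hv] at this
  · intro h φ hφ hc hs
    ext j
    rw [PiLp.neg_apply, key _ _ (hd φ hφ) hc.deriv hy, key _ _ hφ.continuous hc hv]
    exact h j φ hφ hc hs

/-- An integrable function is the weak derivative of its primitive. -/
theorem isWeakDerivOn_of_primitive {a b : ℝ} (hab : a ≤ b) {y v : ℝ → EuclideanSpace ℝ (Fin N)}
    (hy : IntegrableOn y (Ioo a b)) (hv : IntegrableOn v (Ioo a b))
    (h : ∀ j, ∀ s ∈ Icc a b, y s j = y a j + ∫ τ in a..s, v τ j) : IsWeakDerivOn a b y v := by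
  rw [isWeakDerivOn_iff_forall_apply hab hy hv]
  intro j φ hφ _ hs
  refine integral_deriv_mul_of_primitive hab (y := fun s => y s j) (v := fun s => v s j)
    ?_ (h j) hφ hs
  rw [intervalIntegrable_iff_integrableOn_Ioo_of_le hab]
  exact integrableOn_apply hv j

namespace IsAdmissible

variable {x : EuclideanSpace ℝ (Fin N)} {t : ℝ} {y v : ℝ → EuclideanSpace ℝ (Fin N)}

theorem integrableOn (h : IsAdmissible p T x t y v) (hp : 1 < p) : IntegrableOn y (Ioo t T) :=
  h.memLp.integrable (by rw [ENNReal.one_le_ofReal]; exact hp.le)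

theorem integrableOn_deriv (h : IsAdmissible p T x t y v) (hp : 1 < p) :
    IntegrableOn v (Ioo t T) :=
  h.memLp_deriv.integrable (by rw [ENNReal.one_le_ofReal]; exact hp.le)

theorem intervalIntegrable_apply (h : IsAdmissible p T x t y v) (hp : 1 < p) (ht : t ≤ T)
    (j : Fin N) : IntervalIntegrable (fun τ => v τ j) volume t T := by
  rw [intervalIntegrable_iff_integrableOn_Ioo_of_le ht]
  exact integrableOn_apply (h.integrableOn_deriv hp) j

theorem intervalIntegrable_rpow (h : IsAdmissible p T x t y v) (hp : 1 < p) (ht : t ≤ T)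
    (j : Fin N) : IntervalIntegrable (fun τ => |v τ j| ^ p) volume t T := by
  rw [intervalIntegrable_iff_integrableOn_Ioo_of_le ht]
  have h1 : MemLp (fun τ => v τ j) (ENNReal.ofReal p) (volume.restrict (Ioo t T)) :=
    h.memLp_deriv.of_le (integrableOn_apply (h.integrableOn_deriv hp) j).aestronglyMeasurable
      (Eventually.of_forall fun τ => PiLp.norm_apply_le _ _)
  have h2 := h1.integrable_norm_rpow'
  rw [ENNReal.toReal_ofReal (by linarith)] at h2
  exact h2

/-- The du Bois-Reymond lemma in each coordinate. From here on weak derivatives are handled through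
the fundamental theorem of calculus. -/
theorem apply_eq (h : IsAdmissible p T x t y v) (hp : 1 < p) (ht : t ≤ T) (j : Fin N) :
    ∀ s ∈ Icc t T, y s j = x j + ∫ τ in t..s, v τ j := by
  have hc : ContinuousOn (fun s => y s j) (Icc t T) :=
    (EuclideanSpace.proj j : EuclideanSpace ℝ (Fin N) →L[ℝ] ℝ).continuous.comp_continuousOn
      h.continuousOn
  have := eq_primitive_of_integral_deriv_mul ht hc (h.intervalIntegrable_apply hp ht j)
    ((isWeakDerivOn_iff_forall_apply ht (h.integrableOn hp) (h.integrableOn_deriv hp)).1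
      h.isWeakDeriv j)
  rwa [h.initial] at this

theorem of_primitive {x : EuclideanSpace ℝ (Fin N)} (hp : 1 < p) (ht : t ≤ T)
    (hc : ContinuousOn y (Icc t T)) (hm : MapsTo y (Icc t T) (junction N))
    (hv : MemLp v (ENNReal.ofReal p) (volume.restrict (Ioo t T)))
    (hprim : ∀ j, ∀ s ∈ Icc t T, y s j = x j + ∫ τ in t..s, v τ j) (hx : y t = x) :
    IsAdmissible p T x t y v := by
  have hyL : MemLp y (ENNReal.ofReal p) (volume.restrict (Ioo t T)) := by
    obtain ⟨C, hC⟩ := isCompact_Icc.exists_bound_of_continuousOn hc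
    refine MemLp.of_bound ((hc.mono Ioo_subset_Icc_self).aestronglyMeasurable measurableSet_Ioo) C ?_
    filter_upwards [ae_restrict_mem measurableSet_Ioo] with s hs using hC s (Ioo_subset_Icc_self hs)
  have h1 : (1 : ENNReal) ≤ ENNReal.ofReal p := by rw [ENNReal.one_le_ofReal]; exact hp.le
  exact ⟨hc, hm, hyL, hv, isWeakDerivOn_of_primitive ht (hyL.integrable h1) (hv.integrable h1)
    (by rw [hx]; exact hprim), hx⟩

theorem restrict (h : IsAdmissible p T x t y v) (hp : 1 < p) {t' : ℝ} (htt' : t ≤ t')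
    (ht' : t' ≤ T) : IsAdmissible p T (y t') t' y v := by
  have hsub : Icc t' T ⊆ Icc t T := Icc_subset_Icc_left htt'
  refine of_primitive hp ht' (h.continuousOn.mono hsub) (h.mapsTo.mono_left hsub)
    (h.memLp_deriv.mono_measure (Measure.restrict_mono (Ioo_subset_Ioo_left htt') le_rfl))
    (fun j s hs => ?_) rfl
  have ht := htt'.trans ht'
  have hi := h.intervalIntegrable_apply hp ht j
  have hs1 : IntervalIntegrable (fun τ => v τ j) volume t s := hi.mono_set (by
    rw [uIcc_of_le (htt'.trans hs.1), uIcc_of_le ht]; exact Icc_subset_Icc_right hs.2)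
  have hs2 : IntervalIntegrable (fun τ => v τ j) volume t t' := hi.mono_set (by
    rw [uIcc_of_le htt', uIcc_of_le ht]; exact Icc_subset_Icc_right ht')
  rw [h.apply_eq hp ht j s (hsub hs), h.apply_eq hp ht j t' ⟨htt', ht'⟩, add_assoc,
    ← intervalIntegral.integral_interval_sub_left hs1 hs2]
  ring

/-- Integrability of the running cost along an admissible trajectory. -/
theorem intervalIntegrable_runningCost (h : IsAdmissible p T x t y v) (hp : 1 < p) (hN : 0 < N)
    (ht0 : 0 ≤ t) (ht : t ≤ T) {ℓ fy fa : Fin N → ℝ → ℝ → ℝ → ℝ} {ℓstar : ℝ → ℝ}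
    (hL : ∀ i, IsLagrangian p T (ℓ i) (fy i) (fa i)) (hℓ : RegularRunningCosts T ℓ)
    (hℓstar : ContinuousOn ℓstar (Icc 0 T)) :
    IntervalIntegrable (fun τ => runningCost ℓ ℓstar (y τ) (v τ) τ) volume t T := by
  obtain ⟨R, hR⟩ := isCompact_Icc.exists_bound_of_continuousOn h.continuousOn
  have hym : AEMeasurable y (volume.restrict (Ioc t T)) :=
    ((h.continuousOn.mono Ioc_subset_Icc_self).aestronglyMeasurable measurableSet_Ioc).aemeasurable
  rw [intervalIntegrable_iff_integrableOn_Ioc_of_le ht]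
  refine Integrable.add (integrable_finsetSum _ fun j _ => ?_) ?_
  · have h1 := (hL j).intervalIntegrable_comp (ρ := fun τ => ‖y τ‖) (v := fun τ => v τ j) (r := R)
      hp ht ht0 le_rfl h.continuousOn.norm (fun τ hτ => ⟨norm_nonneg _, hR τ hτ⟩)
      (h.intervalIntegrable_apply hp ht j).1.aestronglyMeasurable (h.intervalIntegrable_rpow hp ht j)
    rw [intervalIntegrable_iff_integrableOn_Ioc_of_le ht] at h1
    exact Integrable.indicator₀ h1 (hym.nullMeasurableSet_preimage (measurableSet_openEdge j))
  · have h1 : IntegrableOn (vertexCost ℓ ℓstar) (Ioc t T) :=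
      (((continuousOn_vertexCost hN hℓ hℓstar).mono
        (Icc_subset_Icc_left ht0)).integrableOn_Icc).mono_set Ioc_subset_Icc_self
    exact Integrable.indicator₀ h1 (hym.nullMeasurableSet_preimage (measurableSet_singleton 0))

end IsAdmissible

end Trajectories

/-! ### The value function near an open edge -/

/-- The assumptions of the control problem that are used for dynamic programming. -/
structure IsControlProblem {N : ℕ} (p T : ℝ) (ℓ fy fa : Fin N → ℝ → ℝ → ℝ → ℝ) (ℓstar : ℝ → ℝ)
    (g : Fin N → ℝ → ℝ) : Prop where
  pos : 0 < N
  one_lt : 1 < p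
  lagrangian : ∀ i, IsLagrangian p T (ℓ i) (fy i) (fa i)
  regular : RegularRunningCosts T ℓ
  continuousOn_star : ContinuousOn ℓstar (Icc 0 T)
  coercive : H1 p T ℓ ℓstar
  terminal : RegularTerminalCosts g

namespace IsControlProblem

variable {N : ℕ} {p T : ℝ} {ℓ fy fa : Fin N → ℝ → ℝ → ℝ → ℝ} {ℓstar : ℝ → ℝ}
  {g : Fin N → ℝ → ℝ} {gstar : ℝ}

theorem exists_le_runningCost (hD : IsControlProblem p T ℓ fy fa ℓstar g) :
    ∃ c₀, ∀ y ∈ junction N, ∀ α, ∀ τ ∈ Icc 0 T, c₀ ≤ runningCost ℓ ℓstar y α τ := by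
  obtain ⟨C₀, c₀, hC₀, h, hs⟩ := hD.coercive
  refine ⟨c₀, fun y hy α τ hτ => le_runningCost hD.pos (fun i y a s hy hs => ?_) hs hy α hτ⟩
  have : 0 ≤ C₀ * |a| ^ p := by positivity
  linarith [h i y a s hy hs]

/-- Running and terminal costs are bounded below on the whole junction. Uniformity in the starting
point matters: the bound is also applied to tails of trajectories, wherever they have gone. -/
theorem exists_le_cost (hD : IsControlProblem p T ℓ fy fa ℓstar g) :
    ∃ B, 0 ≤ B ∧ ∀ x t y v, 0 ≤ t → t ≤ T → IsAdmissible p T x t y v →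
      -B ≤ cost T ℓ ℓstar g gstar t y v := by
  obtain ⟨c₀, hc⟩ := hD.exists_le_runningCost
  obtain ⟨G, hG0, hG⟩ := exists_abs_terminalCost_le (gstar := gstar) hD.terminal
  refine ⟨|c₀| * |T| + G, by positivity, fun x t y v ht0 ht h => ?_⟩
  have h1 : ∫ _ in t..T, c₀ ≤ ∫ τ in t..T, runningCost ℓ ℓstar (y τ) (v τ) τ :=
    intervalIntegral.integral_mono_on ht intervalIntegrable_const
      (h.intervalIntegrable_runningCost hD.one_lt hD.pos ht0 ht hD.lagrangian hD.regular
        hD.continuousOn_star)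
      fun τ hτ => hc _ (h.mapsTo hτ) _ τ ⟨ht0.trans hτ.1, hτ.2⟩
  have h2 := (abs_le.1 (hG _ (h.mapsTo (right_mem_Icc.2 ht)))).1
  rw [intervalIntegral.integral_const, smul_eq_mul] at h1
  have h3 : -((T - t) * c₀) ≤ |c₀| * |T| := by
    refine (neg_le_abs _).trans ?_
    rw [abs_mul, mul_comm, abs_of_nonneg (by linarith : 0 ≤ T - t)]
    gcongr
    linarith [le_abs_self T]
  unfold cost
  linarith

theorem bddBelow (hD : IsControlProblem p T ℓ fy fa ℓstar g) {t : ℝ} (ht0 : 0 ≤ t) (ht : t ≤ T)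
    (x : EuclideanSpace ℝ (Fin N)) :
    BddBelow {c | ∃ y v : ℝ → EuclideanSpace ℝ (Fin N),
      IsAdmissible p T x t y v ∧ c = cost T ℓ ℓstar g gstar t y v} := by
  obtain ⟨B, -, hB⟩ := hD.exists_le_cost (gstar := gstar)
  refine ⟨-B, ?_⟩
  rintro c ⟨y, v, h, rfl⟩
  exact hB x t y v ht0 ht h

theorem valueFunction_le_cost (hD : IsControlProblem p T ℓ fy fa ℓstar g) {t : ℝ} (ht0 : 0 ≤ t)
    (ht : t ≤ T) {x : EuclideanSpace ℝ (Fin N)} {y v : ℝ → EuclideanSpace ℝ (Fin N)}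
    (h : IsAdmissible p T x t y v) :
    valueFunction p T ℓ ℓstar g gstar x t ≤ cost T ℓ ℓstar g gstar t y v :=
  csInf_le (hD.bddBelow ht0 ht x) ⟨y, v, h, rfl⟩

theorem cost_eq_add (hD : IsControlProblem p T ℓ fy fa ℓstar g) {t t' : ℝ} (ht0 : 0 ≤ t)
    (htt' : t ≤ t') (ht' : t' ≤ T) {x : EuclideanSpace ℝ (Fin N)}
    {y v : ℝ → EuclideanSpace ℝ (Fin N)} (h : IsAdmissible p T x t y v) :
    cost T ℓ ℓstar g gstar t y v
      = (∫ τ in t..t', runningCost ℓ ℓstar (y τ) (v τ) τ) + cost T ℓ ℓstar g gstar t' y v := by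
  have hi := h.intervalIntegrable_runningCost hD.one_lt hD.pos ht0 (htt'.trans ht') hD.lagrangian
    hD.regular hD.continuousOn_star
  unfold cost
  rw [← add_assoc, intervalIntegral.integral_add_adjacent_intervals]
  · exact hi.mono_set (by
      rw [uIcc_of_le htt', uIcc_of_le (htt'.trans ht')]; exact Icc_subset_Icc_right ht')
  · exact hi.mono_set (by
      rw [uIcc_of_le ht', uIcc_of_le (htt'.trans ht')]; exact Icc_subset_Icc_left htt')

/-- The trajectory that stays at a point. -/
theorem isAdmissible_const (hp : 1 < p) {t : ℝ} (ht : t ≤ T) {x : EuclideanSpace ℝ (Fin N)}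
    (hx : x ∈ junction N) : IsAdmissible p T x t (fun _ => x) fun _ => 0 :=
  IsAdmissible.of_primitive hp ht continuousOn_const (fun _ _ => hx) MemLp.zero
    (fun j s _ => by simp) rfl

theorem exists_cost_le (hD : IsControlProblem p T ℓ fy fa ℓstar g) {t : ℝ}
    (ht : t ≤ T) {x : EuclideanSpace ℝ (Fin N)} (hx : x ∈ junction N) {η : ℝ} (hη : 0 < η) :
    ∃ y v, IsAdmissible p T x t y v ∧
      cost T ℓ ℓstar g gstar t y v ≤ valueFunction p T ℓ ℓstar g gstar x t + η := by
  have hne : {c | ∃ y v : ℝ → EuclideanSpace ℝ (Fin N),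
      IsAdmissible p T x t y v ∧ c = cost T ℓ ℓstar g gstar t y v}.Nonempty :=
    ⟨_, _, _, isAdmissible_const hD.one_lt ht hx, rfl⟩
  obtain ⟨c, ⟨y, v, h, rfl⟩, hc⟩ := Real.lt_sInf_add_pos hne hη
  exact ⟨y, v, h, hc.le⟩

/-- The value function is bounded on bounded subsets of the open edges. -/
theorem exists_abs_valueFunction_le (hD : IsControlProblem p T ℓ fy fa ℓstar g) (i : Fin N)
    (b : ℝ) : ∃ B, 0 ≤ B ∧ ∀ r, 0 < r → r ≤ b → ∀ t, 0 ≤ t → t ≤ T →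
      |valueFunction p T ℓ ℓstar g gstar (r • EuclideanSpace.single i (1 : ℝ)) t| ≤ B := by
  obtain ⟨B, hB0, hB⟩ := hD.exists_le_cost (gstar := gstar)
  obtain ⟨G, hG0, hG⟩ := exists_abs_terminalCost_le (gstar := gstar) hD.terminal
  obtain ⟨F, hF0, hF⟩ :=
    IsLagrangian.exists_bound_of_continuousOn (hD.lagrangian i).continuousOn b 0
  refine ⟨B + G + F * |T|, by positivity, fun r hr hrb t ht0 ht => ?_⟩
  have hx := smul_single_mem_junction i hr.le
  have hadm := isAdmissible_const hD.one_lt ht hx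
  have hFT : 0 ≤ F * |T| := by positivity
  rw [abs_le]
  constructor
  · have hlow : -B ≤ valueFunction p T ℓ ℓstar g gstar (r • EuclideanSpace.single i (1 : ℝ)) t := by
      refine le_csInf ⟨_, _, _, hadm, rfl⟩ ?_
      rintro c ⟨y, v, h, rfl⟩
      exact hB _ t y v ht0 ht h
    linarith
  · refine (hD.valueFunction_le_cost ht0 ht hadm).trans ?_
    unfold cost
    have h1 := (abs_le.1 (hG _ hx)).2
    have h2 : |∫ τ in t..T, runningCost ℓ ℓstar (r • EuclideanSpace.single i (1 : ℝ)) 0 τ|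
        ≤ F * |T - t| := by
      rw [← Real.norm_eq_abs]
      refine intervalIntegral.norm_integral_le_of_norm_le_const fun τ hτ => ?_
      rw [uIoc_of_le ht] at hτ
      rw [runningCost_of_mem_openEdge (smul_single_mem_openEdge i hr), norm_smul_single hr.le]
      exact hF r ⟨hr.le, hrb⟩ _ (by simp) τ ⟨ht0.trans hτ.1.le, hτ.2⟩
    have h3 : F * |T - t| ≤ F * |T| := by
      refine mul_le_mul_of_nonneg_left ?_ hF0
      rw [abs_of_nonneg (by linarith), abs_of_nonneg (by linarith)]
      linarith
    linarith [le_abs_self (∫ τ in t..T, runningCost ℓ ℓstar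
      (r • EuclideanSpace.single i (1 : ℝ)) 0 τ)]

end IsControlProblem

/-! ### Concatenation with a straight line -/

section Concatenation

variable {N : ℕ} {p T : ℝ} {y v : ℝ → EuclideanSpace ℝ (Fin N)}

/-- Concatenation of a straight line on the edge `i` with an admissible trajectory. -/
theorem IsAdmissible.prepend (hp : 1 < p) {i : Fin N} {r r' t t' V : ℝ} (hr : 0 ≤ r)
    (hr' : 0 ≤ r') (htt' : t < t') (ht' : t' ≤ T) (hV : r + (t' - t) * V = r')
    (h : IsAdmissible p T (r' • EuclideanSpace.single i (1 : ℝ)) t' y v) :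
    IsAdmissible p T (r • EuclideanSpace.single i (1 : ℝ)) t
      (fun τ => if τ ≤ t' then (r + (τ - t) * V) • EuclideanSpace.single i (1 : ℝ) else y τ)
      (fun τ => if τ ≤ t' then V • EuclideanSpace.single i (1 : ℝ) else v τ) := by
  set e := EuclideanSpace.single i (1 : ℝ) with he
  have hleft : EqOn (fun τ => if τ ≤ t' then (r + (τ - t) * V) • e else y τ)
      (fun τ => (r + (τ - t) * V) • e) (Icc t t') := fun τ hτ => if_pos hτ.2
  have hright : EqOn (fun τ => if τ ≤ t' then (r + (τ - t) * V) • e else y τ) y (Icc t' T) := by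
    intro τ hτ
    rcases hτ.1.eq_or_lt with rfl | hlt
    · simp only [le_refl, if_true]
      rw [hV, h.initial]
    · exact if_neg (not_le.2 hlt)
  have hunion : Icc t T = Icc t t' ∪ Icc t' T := (Icc_union_Icc_eq_Icc htt'.le ht').symm
  have hvL : MemLp (fun τ => if τ ≤ t' then V • e else v τ) (ENNReal.ofReal p)
      (volume.restrict (Ioo t T)) := by
    have h1 : MemLp ((Ioi t').indicator v) (ENNReal.ofReal p) (volume.restrict (Ioo t T)) := by
      rw [memLp_indicator_iff_restrict measurableSet_Ioi, Measure.restrict_restrict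
        measurableSet_Ioi]
      exact h.memLp_deriv.mono_measure
        (Measure.restrict_mono
          (show Ioi t' ∩ Ioo t T ⊆ Ioo t' T from fun τ hτ => ⟨hτ.1, hτ.2.2⟩) le_rfl)
    have h2 : MemLp ((Iic t').indicator fun _ => V • e) (ENNReal.ofReal p)
        (volume.restrict (Ioo t T)) := (memLp_const _).indicator measurableSet_Iic
    refine (h2.add h1).ae_eq (Eventually.of_forall fun τ => ?_)
    by_cases hτ : τ ≤ t' <;> simp [hτ]
  refine IsAdmissible.of_primitive hp (htt'.le.trans ht') ?_ ?_ hvL ?_ ?_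
  · rw [hunion]
    refine ContinuousOn.union_of_isClosed ?_ (h.continuousOn.congr hright) isClosed_Icc isClosed_Icc
    exact ContinuousOn.congr (by fun_prop) hleft
  · intro τ hτ
    rw [hunion] at hτ
    rcases hτ with hτ | hτ
    · rw [hleft hτ]
      refine smul_single_mem_junction i ?_
      -- The line interpolates between its end values, so it never leaves the half-line.
      have h1 : (t' - t) * (r + (τ - t) * V) = (t' - τ) * r + (τ - t) * r' := by
        rw [← hV]; ring
      have h2 : 0 ≤ (t' - τ) * r + (τ - t) * r' :=
        add_nonneg (mul_nonneg (by linarith [hτ.2]) hr) (mul_nonneg (by linarith [hτ.1]) hr')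
      exact nonneg_of_mul_nonneg_right (h1 ▸ h2) (by linarith)
    · rw [hright hτ]
      exact h.mapsTo hτ
  · intro j s hs
    have hi : IntervalIntegrable (fun τ => (if τ ≤ t' then V • e else v τ) j) volume t T := by
      rw [intervalIntegrable_iff_integrableOn_Ioo_of_le (htt'.le.trans ht')]
      exact integrableOn_apply
        (hvL.integrable (by rw [ENNReal.one_le_ofReal]; exact hp.le)) j
    have hline : ∀ s ∈ Icc t t',
        ∫ τ in t..s, (if τ ≤ t' then V • e else v τ) j = (s - t) * (V • e) j := by
      intro s hs
      rw [← smul_eq_mul, ← intervalIntegral.integral_const]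
      refine intervalIntegral.integral_congr fun τ hτ => ?_
      rw [uIcc_of_le hs.1] at hτ
      simp only [if_pos (hτ.2.trans hs.2)]
    rw [hunion] at hs
    rcases hs with hs | hs
    · have hls := hleft hs
      beta_reduce at hls ⊢
      rw [hls, hline s hs]
      simp only [PiLp.smul_apply, smul_eq_mul]
      ring
    · have hs' : IntervalIntegrable (fun τ => (if τ ≤ t' then V • e else v τ) j) volume t t' :=
        hi.mono_set (by
          rw [uIcc_of_le htt'.le, uIcc_of_le (htt'.le.trans ht')]; exact Icc_subset_Icc_right ht')
      have hs'' : IntervalIntegrable (fun τ => (if τ ≤ t' then V • e else v τ) j) volume t' s :=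
        hi.mono_set (by
          rw [uIcc_of_le hs.1, uIcc_of_le (htt'.le.trans ht')]; exact Icc_subset_Icc htt'.le hs.2)
      have hint : ∫ τ in t'..s, (if τ ≤ t' then V • e else v τ) j = ∫ τ in t'..s, v τ j := by
        refine intervalIntegral.integral_congr_ae (Eventually.of_forall fun τ hτ => ?_)
        rw [uIoc_of_le hs.1] at hτ
        rw [if_neg (not_le.2 hτ.1)]
      have hrs := hright hs
      beta_reduce at hrs ⊢
      rw [hrs, h.apply_eq hp ht' j s hs,
        ← intervalIntegral.integral_add_adjacent_intervals hs' hs'', hint,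
        hline t' ⟨htt'.le, le_rfl⟩, ← hV]
      simp only [PiLp.smul_apply, smul_eq_mul]
      ring
  · simp [htt'.le]

/-- A straight segment followed by a nearly optimal trajectory from its end is a competitor. As r
and r' are positive, the segment avoids the vertex and pays only ℓ_i. -/
theorem IsControlProblem.hasDynamicProgramming {ℓ fy fa : Fin N → ℝ → ℝ → ℝ → ℝ} {ℓstar : ℝ → ℝ}
    {g : Fin N → ℝ → ℝ} {gstar : ℝ} (hD : IsControlProblem p T ℓ fy fa ℓstar g) (i : Fin N) :
    HasDynamicProgramming T (ℓ i) fun r t =>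
      valueFunction p T ℓ ℓstar g gstar (r • EuclideanSpace.single i (1 : ℝ)) t := by
  intro r r' t t' hr hr' ht0 htt' ht'
  refine le_of_forall_pos_le_add fun η hη => ?_
  obtain ⟨y, v, h, hc⟩ := hD.exists_cost_le (gstar := gstar) ht'.le
    (smul_single_mem_junction i hr'.le) hη
  set V := (r' - r) / (t' - t) with hVdef
  have htpos : 0 < t' - t := by linarith
  have hV : r + (t' - t) * V = r' := by rw [hVdef]; field_simp; ring
  have hadm := h.prepend hD.one_lt hr.le hr'.le htt' ht'.le hV
  refine (hD.valueFunction_le_cost ht0 (htt'.le.trans ht'.le) hadm).trans ?_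
  rw [hD.cost_eq_add ht0 htt'.le ht'.le hadm]
  have e1 : ∫ τ in t..t', runningCost ℓ ℓstar
      (if τ ≤ t' then (r + (τ - t) * V) • EuclideanSpace.single i (1 : ℝ) else y τ)
      (if τ ≤ t' then V • EuclideanSpace.single i (1 : ℝ) else v τ) τ
      = ∫ τ in t..t', ℓ i (r + (τ - t) * V) V τ := by
    refine intervalIntegral.integral_congr fun τ hτ => ?_
    rw [uIcc_of_le htt'.le] at hτ
    have hpos : 0 < r + (τ - t) * V := by
      have h1 : (t' - t) * (r + (τ - t) * V) = (t' - τ) * r + (τ - t) * r' := by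
        rw [← hV]; ring
      have h2 : 0 < (t' - τ) * r + (τ - t) * r' := by
        rcases hτ.1.eq_or_lt with rfl | hlt
        · have := mul_pos htpos hr
          linarith
        · exact add_pos_of_nonneg_of_pos (mul_nonneg (by linarith [hτ.2]) hr.le)
            (mul_pos (by linarith) hr')
      exact pos_of_mul_pos_right (h1 ▸ h2) htpos.le
    simp only [if_pos hτ.2]
    rw [runningCost_of_mem_openEdge (smul_single_mem_openEdge i hpos), norm_smul_single hpos.le,
      smul_single_apply, if_pos rfl]
  have e2 : cost T ℓ ℓstar g gstar t'
      (fun τ => if τ ≤ t' then (r + (τ - t) * V) • EuclideanSpace.single i (1 : ℝ) else y τ)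
      (fun τ => if τ ≤ t' then V • EuclideanSpace.single i (1 : ℝ) else v τ)
      = cost T ℓ ℓstar g gstar t' y v := by
    unfold cost
    beta_reduce
    -- Since t' < T strictly, the terminal point is read from the second piece.
    rw [if_neg (not_le.2 ht')]
    congr 1
    refine intervalIntegral.integral_congr_ae (Eventually.of_forall fun τ hτ => ?_)
    rw [uIoc_of_le ht'.le] at hτ
    rw [if_neg (not_le.2 hτ.1), if_neg (not_le.2 hτ.1)]
  rw [e1, e2]
  linarith

end Concatenation

/-! ### Nearly optimal trajectories stay on their edge for a while -/

namespace IsControlProblem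

variable {N : ℕ} {p T : ℝ} {ℓ fy fa : Fin N → ℝ → ℝ → ℝ → ℝ} {ℓstar : ℝ → ℝ}
  {g : Fin N → ℝ → ℝ} {gstar : ℝ}

/-- Energy estimate as long as the trajectory stays on the edge. -/
theorem exists_energy_le (hD : IsControlProblem p T ℓ fy fa ℓstar g) (gstar : ℝ) (i : Fin N)
    (A : ℝ) :
    ∃ E₁, 0 ≤ E₁ ∧ ∀ x t s y v, 0 ≤ t → t ≤ s → s ≤ T → IsAdmissible p T x t y v →
      cost T ℓ ℓstar g gstar t y v ≤ A → (∀ τ ∈ Ioo t s, 0 < y τ i) →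
      ∫ τ in t..s, |v τ i| ^ p ≤ E₁ := by
  obtain ⟨B, hB0, hB⟩ := hD.exists_le_cost (gstar := gstar)
  obtain ⟨C₀, c₀, hC₀, hco⟩ := (hD.lagrangian i).coercive
  refine ⟨(|A| + B + |c₀| * |T|) / C₀, by positivity, fun x t s y v ht0 hts hsT h hA hpos => ?_⟩
  have htT := hts.trans hsT
  have hsub : uIcc t s ⊆ uIcc t T := by
    rw [uIcc_of_le hts, uIcc_of_le htT]; exact Icc_subset_Icc_right hsT
  have hL := (h.intervalIntegrable_runningCost hD.one_lt hD.pos ht0 htT hD.lagrangian hD.regular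
    hD.continuousOn_star).mono_set hsub
  have hv := (h.intervalIntegrable_rpow hD.one_lt htT i).mono_set hsub
  have h1 : ∫ τ in t..s, (C₀ * |v τ i| ^ p + c₀)
      ≤ ∫ τ in t..s, runningCost ℓ ℓstar (y τ) (v τ) τ := by
    refine intervalIntegral.integral_mono_on_of_le_Ioo hts
      ((hv.const_mul C₀).add intervalIntegrable_const) hL fun τ hτ => ?_
    have hτT : τ ∈ Icc t T := ⟨hτ.1.le, hτ.2.le.trans hsT⟩
    have hy := eq_smul_single_of_pos (h.mapsTo hτT) (hpos τ hτ)
    have hmem : y τ ∈ openEdge i := mem_openEdge_iff.2 ⟨_, hpos τ hτ, hy⟩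
    rw [runningCost_of_mem_openEdge hmem]
    exact hco _ _ _ (norm_nonneg _) ⟨ht0.trans hτT.1, hτT.2⟩
  have h2 := hD.cost_eq_add (gstar := gstar) ht0 hts hsT h
  -- After time s the trajectory may visit the vertex or other edges; only the uniform lower bound
  -- of its remaining cost is needed.
  have h3 := hB (y s) s y v (ht0.trans hts) hsT (h.restrict hD.one_lt hts hsT)
  rw [intervalIntegral.integral_add (hv.const_mul C₀) intervalIntegrable_const,
    intervalIntegral.integral_const_mul, intervalIntegral.integral_const, smul_eq_mul] at h1
  have h4 : -((s - t) * c₀) ≤ |c₀| * |T| := by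
    refine (neg_le_abs _).trans ?_
    rw [abs_mul, mul_comm, abs_of_nonneg (by linarith : 0 ≤ s - t)]
    exact mul_le_mul_of_nonneg_left (by linarith [le_abs_self T]) (abs_nonneg _)
  rw [le_div_iff₀ hC₀]
  linarith [le_abs_self A]

/-- Trajectories of bounded cost that start in a compact part of an open edge stay close to their
starting point for a uniform time. -/
theorem exists_confinement (hD : IsControlProblem p T ℓ fy fa ℓstar g) (gstar : ℝ) (i : Fin N)
    (A : ℝ) {a : ℝ} (ha : 0 < a) :
    ∃ h₁, 0 < h₁ ∧ ∀ h, 0 < h → h ≤ h₁ → ∀ r₀ t y v, a ≤ r₀ → 0 ≤ t → t + h ≤ T →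
      IsAdmissible p T (r₀ • EuclideanSpace.single i (1 : ℝ)) t y v →
      cost T ℓ ℓstar g gstar t y v ≤ A → ∀ s ∈ Icc t (t + h), |y s i - r₀| ≤ a / 4 := by
  obtain ⟨E₁, hE₁, hen⟩ := hD.exists_energy_le gstar i A
  obtain ⟨c, hc0, hc⟩ := exists_le_mul_rpow_add hD.one_lt (μ := a / (16 * (E₁ + 1))) (by positivity)
  refine ⟨a / (16 * (c + 1)), by positivity, fun h hh hh1 r₀ t y v hr₀ ht0 htT hadm hA => ?_⟩
  rw [le_div_iff₀ (by positivity)] at hh1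
  have ht : t ≤ T := by linarith
  have hρc : ContinuousOn (fun s => |y s i - r₀|) (Icc t (t + h)) := by
    have : ContinuousOn (fun s => y s i) (Icc t (t + h)) :=
      (EuclideanSpace.proj i : EuclideanSpace ℝ (Fin N) →L[ℝ] ℝ).continuous.comp_continuousOn
        (hadm.continuousOn.mono (Icc_subset_Icc_right htT))
    exact (this.sub continuousOn_const).abs
  by_contra! hcon
  obtain ⟨s, hs, hsa⟩ := hcon
  have hK : IsCompact (Icc t (t + h) ∩ (fun s => |y s i - r₀|) ⁻¹' Ici (a / 4)) :=
    isCompact_Icc.of_isClosed_subset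
      (hρc.preimage_isClosed_of_isClosed isClosed_Icc isClosed_Ici) inter_subset_left
  -- At the first time s₁ when the distance reaches a/4, the trajectory has stayed on the edge
  -- because r₀ ≥ a. The energy estimate then bounds the displacement by a/16 + a/16, a
  -- contradiction.
  obtain ⟨s₁, ⟨hs₁, hs₁a⟩, hleast⟩ := hK.exists_isLeast ⟨s, hs, hsa.le⟩
  have hbefore : ∀ τ ∈ Ioo t s₁, 0 < y τ i := by
    intro τ hτ
    by_contra hneg
    have hτ' : τ ∈ Icc t (t + h) := ⟨hτ.1.le, hτ.2.le.trans hs₁.2⟩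
    have hmem : a / 4 ≤ |y τ i - r₀| := by
      rw [abs_sub_comm]
      exact le_trans (by linarith) (le_abs_self _)
    exact absurd (hleast ⟨hτ', hmem⟩) (not_le.2 hτ.2)
  have hsT : s₁ ≤ T := hs₁.2.trans htT
  have hE := hen _ t s₁ y v ht0 hs₁.1 hsT hadm hA hbefore
  have hsub : uIcc t s₁ ⊆ uIcc t T := by
    rw [uIcc_of_le hs₁.1, uIcc_of_le ht]; exact Icc_subset_Icc_right hsT
  have hv := (hadm.intervalIntegrable_apply hD.one_lt ht i).mono_set hsub
  have hvp := (hadm.intervalIntegrable_rpow hD.one_lt ht i).mono_set hsub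
  have hprim := hadm.apply_eq hD.one_lt ht i s₁ ⟨hs₁.1, hsT⟩
  rw [smul_single_apply, if_pos rfl] at hprim
  have hint : |y s₁ i - r₀| ≤ a / (16 * (E₁ + 1)) * E₁ + (s₁ - t) * c := by
    rw [hprim, add_sub_cancel_left]
    calc |∫ τ in t..s₁, v τ i| ≤ ∫ τ in t..s₁, |v τ i| :=
          intervalIntegral.abs_integral_le_integral_abs hs₁.1
      _ ≤ ∫ τ in t..s₁, (a / (16 * (E₁ + 1)) * |v τ i| ^ p + c) :=
          intervalIntegral.integral_mono_on hs₁.1 hv.abs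
            ((hvp.const_mul _).add intervalIntegrable_const) fun τ _ => hc _ (abs_nonneg _)
      _ = a / (16 * (E₁ + 1)) * (∫ τ in t..s₁, |v τ i| ^ p) + (s₁ - t) * c := by
          rw [intervalIntegral.integral_add (hvp.const_mul _) intervalIntegrable_const,
            intervalIntegral.integral_const_mul, intervalIntegral.integral_const, smul_eq_mul]
      _ ≤ _ := by gcongr
  have h1 : a / (16 * (E₁ + 1)) * E₁ ≤ a / 16 := by
    rw [div_mul_eq_mul_div, div_le_div_iff₀ (by positivity) (by positivity)]
    linarith
  have h2 : (s₁ - t) * c ≤ h * (c + 1) :=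
    mul_le_mul (by linarith [hs₁.2]) (by linarith) hc0 hh.le
  have h3 : a / 4 ≤ |y s₁ i - r₀| := hs₁a
  linarith

/-- The i-th coordinate of a nearly optimal trajectory works: its cost is at most B + 1 by the local
bound on the value function, so confinement applies, and the cost of the tail dominates the value at
the end of the window. -/
theorem exists_isNearlyOptimal (hD : IsControlProblem p T ℓ fy fa ℓstar g) (gstar : ℝ) (i : Fin N)
    {a b α β : ℝ} (ha : 0 < a) (hα : 0 ≤ α) (hβ : β < T) :
    ∃ E h₁, 0 < h₁ ∧ ∀ h, 0 < h → h ≤ h₁ → ∀ r₀ ∈ Icc a b, ∀ t₀ ∈ Icc α β, ∀ η, 0 < η → η ≤ 1 →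
      ∃ ρ v, IsNearlyOptimal p (ℓ i) (fun r t => valueFunction p T ℓ ℓstar g gstar
        (r • EuclideanSpace.single i (1 : ℝ)) t) a E h r₀ t₀ η ρ v := by
  obtain ⟨B, hB0, hB⟩ := hD.exists_abs_valueFunction_le (gstar := gstar) i b
  obtain ⟨B', hB'0, hB'⟩ := hD.exists_le_cost (gstar := gstar)
  obtain ⟨h₁, hh₁, hconf⟩ := hD.exists_confinement gstar i (B + 1) ha
  refine ⟨B + 1 + B', min h₁ (T - β), lt_min hh₁ (by linarith),
    fun h hh hhle r₀ hr₀ t₀ ht₀ η hη hη1 => ?_⟩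
  have ht0 : 0 ≤ t₀ := hα.trans ht₀.1
  have hhT : t₀ + h ≤ T := by linarith [hhle.trans (min_le_right _ _), ht₀.2]
  have ht0T : t₀ ≤ T := by linarith
  have hr₀0 : 0 < r₀ := ha.trans_le hr₀.1
  obtain ⟨y, v, hadm, hcost⟩ := hD.exists_cost_le (gstar := gstar) ht0T
    (smul_single_mem_junction i hr₀0.le) hη
  have hA : cost T ℓ ℓstar g gstar t₀ y v ≤ B + 1 := by
    linarith [(abs_le.1 (hB r₀ hr₀0 hr₀.2 t₀ ht0 ht0T)).2]
  have hclose := hconf h hh (hhle.trans (min_le_left _ _)) r₀ t₀ y v hr₀.1 ht0 hhT hadm hA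
  have hpos : ∀ s ∈ Icc t₀ (t₀ + h), 0 < y s i := by
    intro s hs
    have := (abs_le.1 (hclose s hs)).1
    linarith [hr₀.1]
  have hIcc : Icc t₀ (t₀ + h) ⊆ Icc t₀ T := Icc_subset_Icc_right hhT
  have hy : ∀ s ∈ Icc t₀ (t₀ + h), y s = y s i • EuclideanSpace.single i (1 : ℝ) := fun s hs =>
    eq_smul_single_of_pos (hadm.mapsTo (hIcc hs)) (hpos s hs)
  have hsub : uIcc t₀ (t₀ + h) ⊆ uIcc t₀ T := by
    rw [uIcc_of_le (by linarith), uIcc_of_le ht0T]; exact hIcc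
  have hrun : ∫ τ in t₀..(t₀ + h), runningCost ℓ ℓstar (y τ) (v τ) τ
      = ∫ τ in t₀..(t₀ + h), ℓ i (y τ i) (v τ i) τ := by
    refine intervalIntegral.integral_congr fun τ hτ => ?_
    rw [uIcc_of_le (by linarith)] at hτ
    have hmem : y τ ∈ openEdge i := mem_openEdge_iff.2 ⟨_, hpos τ hτ, hy τ hτ⟩
    have hnorm : ‖y τ‖ = y τ i := by
      conv_lhs => rw [hy τ hτ]
      exact norm_smul_single (hpos τ hτ).le
    beta_reduce
    rw [runningCost_of_mem_openEdge hmem, hnorm]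
  have hsplit := hD.cost_eq_add (gstar := gstar) ht0 (by linarith : t₀ ≤ t₀ + h) hhT hadm
  have hadm' := hadm.restrict hD.one_lt (by linarith : t₀ ≤ t₀ + h) hhT
  have hlow := hB' _ _ y v (by linarith) hhT hadm'
  have hend := hD.valueFunction_le_cost (gstar := gstar) (by linarith) hhT hadm'
  rw [hy _ ⟨by linarith, le_rfl⟩] at hend
  refine ⟨fun s => y s i, fun s => v s i, ?_, ?_, ?_, ?_, hclose, ?_, ?_⟩
  · exact (EuclideanSpace.proj i : EuclideanSpace ℝ (Fin N) →L[ℝ] ℝ).continuous.comp_continuousOn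
      (hadm.continuousOn.mono hIcc)
  · exact (hadm.intervalIntegrable_apply hD.one_lt ht0T i).mono_set hsub
  · exact (hadm.intervalIntegrable_rpow hD.one_lt ht0T i).mono_set hsub
  · intro s hs
    have := hadm.apply_eq hD.one_lt ht0T i s (hIcc hs)
    rwa [smul_single_apply, if_pos rfl] at this
  · rw [← hrun]; linarith
  · rw [← hrun]; linarith

/-- The value function is semiconcave in compact boxes of an open edge times `(0, T)`. -/
theorem isSemiconcaveOn_box (hD : IsControlProblem p T ℓ fy fa ℓstar g) (gstar : ℝ) (i : Fin N)
    {a b α β : ℝ} (ha : 0 < a) (hab : a ≤ b) (hα : 0 ≤ α) (hβ : β < T) :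
    IsSemiconcaveOn {z : WithLp 2 (EuclideanSpace ℝ (Fin N) × ℝ) |
        z.fst = z.fst i • EuclideanSpace.single i (1 : ℝ) ∧ z.fst i ∈ Icc a b ∧ z.snd ∈ Icc α β}
      (fun z => valueFunction p T ℓ ℓstar g gstar z.fst z.snd) := by
  obtain ⟨B, hB0, hB⟩ := hD.exists_abs_valueFunction_le (gstar := gstar) i b
  obtain ⟨E, h₁, hh₁, hnear⟩ := hD.exists_isNearlyOptimal gstar i (b := b) ha hα hβ
  refine isSemiconcaveOn_of_supergradient (B := B) ?_ ?_
  · rintro z ⟨hz1, hz2, hz3⟩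
    rw [hz1]
    exact hB _ (ha.trans_le hz2.1) hz2.2 _ (hα.trans hz3.1) (hz3.2.trans hβ.le)
  · intro ε hε
    -- The tolerance is halved because the state and time increments are each bounded by the
    -- Euclidean norm.
    obtain ⟨δ, P, hδ, hP, h⟩ := (hD.lagrangian i).exists_supergradient hD.one_lt
      (hD.hasDynamicProgramming (gstar := gstar) i) ha hab hα hβ hh₁ hnear (half_pos hε)
    have hfst : ∀ x : WithLp 2 (EuclideanSpace ℝ (Fin N) × ℝ), |x.fst i| ≤ ‖x‖ := fun x =>
      (PiLp.norm_apply_le x.fst i).trans (WithLp.norm_fst_le _ x)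
    have hsnd : ∀ x : WithLp 2 (EuclideanSpace ℝ (Fin N) × ℝ), |x.snd| ≤ ‖x‖ := fun x =>
      WithLp.norm_snd_le _ x
    refine ⟨δ, 2 * P, hδ, by positivity, ?_⟩
    rintro z₀ ⟨hz1, hz2, hz3⟩ η hη
    obtain ⟨p₁, p₂, hp₁, hp₂, hsg⟩ := h _ hz2 _ hz3 η hη
    refine ⟨fun x => p₁ * x.fst i + p₂ * x.snd, fun c x => ?_, fun x => ?_, ?_⟩
    · simp only [WithLp.smul_fst, WithLp.smul_snd, PiLp.smul_apply, smul_eq_mul]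
      ring
    · have e1 : p₁ * x.fst i ≤ P * ‖x‖ := (le_abs_self _).trans (by
        rw [abs_mul]; exact mul_le_mul hp₁ (hfst x) (abs_nonneg _) hP)
      have e2 : p₂ * x.snd ≤ P * ‖x‖ := (le_abs_self _).trans (by
        rw [abs_mul]; exact mul_le_mul hp₂ (hsnd x) (abs_nonneg _) hP)
      linarith
    · rintro z ⟨hw1, hw2, hw3⟩ hd
      have e1 : |z.fst i - z₀.fst i| ≤ ‖z - z₀‖ := hfst (z - z₀)
      have e2 : |z.snd - z₀.snd| ≤ ‖z - z₀‖ := hsnd (z - z₀)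
      have e3 := hsg _ hw2 _ hw3 (e1.trans hd) (e2.trans hd)
      beta_reduce at e3
      rw [← hw1, ← hz1] at e3
      simp only [WithLp.sub_fst, WithLp.sub_snd, PiLp.sub_apply]
      have e4 : ε / 2 * (|z.fst i - z₀.fst i| + |z.snd - z₀.snd|) ≤ ε * ‖z - z₀‖ := by
        have := mul_le_mul_of_nonneg_left (add_le_add e1 e2) (half_pos hε).le
        linarith
      linarith

end IsControlProblem

end Junction

/-- The value function is locally semiconcave in `(J_i ∖ {0}) × (0,T)`, as a function of the
pair `(x,t)`; the product `ℝ^N × ℝ` carries its Euclidean norm. -/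
theorem mainTheorem10 (N : ℕ) (hN : 1 < N) (p T : ℝ) (hp : 1 < p) (hT : 0 < T)
    (ℓ : Fin N → ℝ → ℝ → ℝ → ℝ) (ℓstar : ℝ → ℝ) (g : Fin N → ℝ → ℝ) (gstar : ℝ)
    (hℓ : Junction.RegularRunningCosts T ℓ)
    (hℓstar : ContinuousOn ℓstar (Icc 0 T))
    (hg : Junction.RegularTerminalCosts g)
    (h1 : Junction.H1 p T ℓ ℓstar)
    (h2 : Junction.H2 p T ℓ)
    (h3 : Junction.H3 p T ℓ)
    (h4 : Junction.H4 T ℓ)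
    (h5 : Junction.H5 g)
    (hLip : Junction.LocallyUniformlyLipschitzInTime T ℓ)
    (i : Fin N) :
    Junction.IsLocallySemiconcaveOn
      {z : WithLp 2 (EuclideanSpace ℝ (Fin N) × ℝ) |
        z.fst ∈ Junction.openEdge i ∧ z.snd ∈ Ioo 0 T}
      (fun z => Junction.valueFunction p T ℓ ℓstar g gstar z.fst z.snd) := by
  have hD : Junction.IsControlProblem p T ℓ (Junction.partialY ℓ) (Junction.partialA ℓ) ℓstar g :=
    ⟨by omega, hp, Junction.isLagrangian hℓ h1 h2 h3 h4 hLip, hℓ, hℓstar, h1, hg⟩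
  intro K hK hKc
  rcases K.eq_empty_or_nonempty with rfl | hne
  · refine (hD.isSemiconcaveOn_box gstar i one_pos le_rfl (hT.le : 0 ≤ T) (β := 0) hT).mono ?_
    exact empty_subset _
  have hsnd : Continuous fun z : WithLp 2 (EuclideanSpace ℝ (Fin N) × ℝ) => z.snd :=
    WithLp.continuous_snd ..
  have hfst : Continuous fun z : WithLp 2 (EuclideanSpace ℝ (Fin N) × ℝ) => z.fst i :=
    (EuclideanSpace.proj i : EuclideanSpace ℝ (Fin N) →L[ℝ] ℝ).continuous.comp
      (WithLp.continuous_fst ..)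
  have hedge : ∀ z ∈ K, 0 < z.fst i ∧ z.fst = z.fst i • EuclideanSpace.single i (1 : ℝ) := by
    intro z hz
    obtain ⟨r, hr, hzr⟩ := Junction.mem_openEdge_iff.1 (hK hz).1
    have hi : z.fst i = r := by rw [hzr, Junction.smul_single_apply, if_pos rfl]
    rw [hi]
    exact ⟨hr, hzr⟩
  -- The extreme values of the edge coordinate and of time are attained on K, so the enclosing box
  -- stays away from the vertex and from T.
  obtain ⟨za, hza, hamin⟩ := hKc.exists_isMinOn hne hfst.continuousOn
  obtain ⟨zb, hzb, hbmax⟩ := hKc.exists_isMaxOn hne hfst.continuousOn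
  obtain ⟨zα, hzα, hαmin⟩ := hKc.exists_isMinOn hne hsnd.continuousOn
  obtain ⟨zβ, hzβ, hβmax⟩ := hKc.exists_isMaxOn hne hsnd.continuousOn
  refine (hD.isSemiconcaveOn_box gstar i (a := za.fst i) (b := zb.fst i) (α := zα.snd)
    (β := zβ.snd) (hedge za hza).1 (hamin hzb) (hK hzα).2.1.le (hK hzβ).2.2).mono ?_
  exact fun z hz => ⟨(hedge z hz).2, ⟨hamin hz, hbmax hz⟩, ⟨hαmin hz, hβmax hz⟩⟩
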